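/- Let $H^m_{\rm per}([0,1])$ be the space of $1$-periodic functions on $\mathbb R$ that lie in $H^m_{\rm loc}(\mathbb R)$, with the norm $\big(\sum_{k\le m}\|\partial_h^k f\|_{L^2([0,1])}^2\big)^{1/2}$ (for $m\ge1$ we use continuous representatives). For positive $u$ put $$E(u)=\int_0^1\big((u^3+u)_{hh}\big)^2\,dh,\qquad F(u)=\int_0^1\Big(\tfrac12u^2+\ln u\Big)\,dh .$$ For $T>0$, a strong solution on $[0,T]$ with initial datum $u_0$ is a positive function $u$ with $$u\in C([0,T];H^2_{\rm per}([0,1]))\cap L^2([0,T];H^4_{\rm per}([0,1])),\qquad u_t\in L^2([0,T];L^2_{\rm per}([0,1])),$$ $u(0,\cdot)=u_0$ and $u_t=-u^2(u^3+u)_{hhhh}$ for a.e. $(t,h)\in[0,T]\times[0,1]$. **Theorem.** Let $u_0\in H^2_{\rm per}([0,1])$ with $u_0\ge0$ and $\int_0^1\frac1{u_0}\,dh=L<\infty$ (with $1/0=+\infty$). Then there is a unique function $u:[0,\infty)\times\mathbb R\to(0,\infty)$ which for every $T>0$ is a strong solution on $[0,T]$ with initial datum $u_0$; moreover, for each $T>0$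 every strong solution on $[0,T]$ with initial datum $u_0$ equals $u$ on $[0,T]$. For every $T>0$, $$E(u(T,\cdot))+\int_0^T\!\!\int_0^1 2(u^2+3u^4)\big((u^3+u)_{hhhh}\big)^2\,dh\,dt=E(u_0),$$ $$F(u(T,\cdot))+\int_0^T E(u(t,\cdot))\,dt=F(u_0),$$ where all the integrals are finite. Further, write $E(t)=E(u(t,\cdot))$, $E_0=E(u_0)$ and $$J(E)=\begin{cases}\dfrac1{3L^3E}&\text{if }E\ge\dfrac2{L^2},\\[2mm]\dfrac1{2L}-\dfrac{E^{1/2}}{3\sqrt2}&\text{if }E<\dfrac2{L^2}.\end{cases}$$ Then for all $t\ge0$ and $h\in\mathbb R$ $$u(t,h)\ge J(E(t)),\qquad J(E(t))\ge\min\Big\{\frac1{3L^3E(t)},\ \frac1{2L}-\frac{E(t)^{1/2}}{3\sqrt2}\Big\},\qquad J(E(t))\ge\min\Big\{\frac1{3L^3E_0},\ \frac1{6L}\Big\}>0,$$ where $1/(3L^3E)$ is read as $+\infty$ if $E=0$. -/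

import Mathlib

open MeasureTheory Set Filter Topology
open scoped ENNReal ContDiff

namespace SlopeEq

noncomputable section

/-- `g` is the `k`-th weak derivative of `f` on `ℝ`: both are locally integrable and
`∫ f φ⁽ᵏ⁾ = (-1)ᵏ ∫ g φ` for every smooth compactly supported `φ`. -/
def HasWeakDeriv (k : ℕ) (f g : ℝ → ℝ) : Prop :=
  LocallyIntegrable f ∧ LocallyIntegrable g ∧
    ∀ φ : ℝ → ℝ, ContDiff ℝ ∞ φ → HasCompactSupport φ →
      ∫ x, f x * iteratedDeriv k φ x = (-1) ^ k * ∫ x, g x * φ x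

open Classical in
/-- A representative of the `k`-th weak derivative of `f` (it is unique up to null sets);
zero if there is none. -/
def weakDeriv (k : ℕ) (f : ℝ → ℝ) : ℝ → ℝ :=
  if h : ∃ g, HasWeakDeriv k f g then h.choose else 0

/-- `f` belongs to `H^m_per([0,1])`: it is `1`-periodic and its weak derivatives of order `≤ m`
exist and are square integrable over a period. As only `m ≥ 1` is used, where each class has exactly
one continuous representative, elements of the space are taken to be these representatives. -/
structure MemHper (m : ℕ) (f : ℝ → ℝ) : Prop where
  continuous : Continuous f
  periodic : Function.Periodic f 1
  weak : ∀ k ≤ m, ∃ g, HasWeakDeriv k f g ∧ MemLp g 2 (volume.restrict (Icc 0 1))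

/-- The norm of `H^m_per([0,1])`. -/
def hperNorm (m : ℕ) (f : ℝ → ℝ) : ℝ :=
  √(∑ k ∈ Finset.range (m + 1), ∫ x in (0 : ℝ)..1, (weakDeriv k f x) ^ 2)

/-- Lebesgue measure on `[0,T] × [0,1]`. -/
def cylMeasure (T : ℝ) : Measure (ℝ × ℝ) :=
  (volume.restrict (Icc 0 T)).prod (volume.restrict (Icc 0 1))

/-- `u ∈ C([0,T]; H^m_per([0,1]))`. -/
def MemCHper (T : ℝ) (m : ℕ) (u : ℝ → ℝ → ℝ) : Prop :=
  (∀ t ∈ Icc 0 T, MemHper m (u t)) ∧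
    ∀ t ∈ Icc 0 T,
      Tendsto (fun s => hperNorm m (fun h => u s h - u t h)) (𝓝[Icc 0 T] t) (𝓝 0)

/-- `u ∈ L²([0,T]; H^m_per([0,1]))`. -/
def MemL2Hper (T : ℝ) (m : ℕ) (u : ℝ → ℝ → ℝ) : Prop :=
  AEStronglyMeasurable (Function.uncurry u) (cylMeasure T) ∧
    (∀ᵐ t ∂(volume.restrict (Icc 0 T)), MemHper m (u t)) ∧
    ∫⁻ t in Icc 0 T, ENNReal.ofReal (hperNorm m (u t) ^ 2) < ⊤

/-- `u_t = w ∈ L²([0,T]; L²_per([0,1]))`, where `u_t` is the weak derivative of the `L²`-valued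
function `t ↦ u t`: for every `φ ∈ C_c^∞((0,T))`, `∫ φ' u dt = - ∫ φ w dt` in `L²([0,1])`. -/
def HasL2TimeDeriv (T : ℝ) (u w : ℝ → ℝ → ℝ) : Prop :=
  MemLp (Function.uncurry w) 2 (cylMeasure T) ∧ (∀ t, Function.Periodic (w t) 1) ∧
    ∀ φ : ℝ → ℝ, ContDiff ℝ ∞ φ → HasCompactSupport φ → tsupport φ ⊆ Ioo 0 T →
      ∀ᵐ h ∂(volume.restrict (Icc (0 : ℝ) 1)),
        ∫ t in (0 : ℝ)..T, deriv φ t * u t h = - ∫ t in (0 : ℝ)..T, φ t * w t h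

/-- `(u³ + u)_{hhhh}` for a function `u` of `h`. -/
def flux (u : ℝ → ℝ) : ℝ → ℝ := weakDeriv 4 (fun h => u h ^ 3 + u h)

/-- `u` is a (positive) strong solution on `[0,T]` of `u_t = -u² (u³ + u)_{hhhh}` with
`1`-periodic boundary conditions and initial datum `u₀`. -/
structure IsStrongSolution (T : ℝ) (u₀ : ℝ → ℝ) (u : ℝ → ℝ → ℝ) : Prop where
  pos : ∀ t ∈ Icc 0 T, ∀ h, 0 < u t h
  memC : MemCHper T 2 u
  memL2 : MemL2Hper T 4 u
  init : u 0 = u₀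
  eqn : ∃ w : ℝ → ℝ → ℝ, HasL2TimeDeriv T u w ∧
    ∀ᵐ t ∂(volume.restrict (Icc 0 T)), ∀ᵐ h ∂(volume.restrict (Icc (0 : ℝ) 1)),
      w t h = -(u t h) ^ 2 * flux (u t) h

/-- `E(u) = ∫₀¹ ((u³ + u)_{hh})² dh`. -/
def energyE (u : ℝ → ℝ) : ℝ :=
  ∫ h in (0 : ℝ)..1, (weakDeriv 2 (fun y => u y ^ 3 + u y) h) ^ 2

/-- `F(u) = ∫₀¹ (u²/2 + ln u) dh`. -/
def energyF (u : ℝ → ℝ) : ℝ :=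
  ∫ h in (0 : ℝ)..1, (1 / 2 * u h ^ 2 + Real.log (u h))

/-- The integrand `2 (u² + 3u⁴) ((u³ + u)_{hhhh})²` of the dissipation of `E`. -/
def dissDensity (u : ℝ → ℝ) (h : ℝ) : ℝ :=
  2 * (u h ^ 2 + 3 * u h ^ 4) * (flux u h) ^ 2

/-- The lower bound `J(E)`: `1/(3L³E)` if `E ≥ 2/L²`, and `1/(2L) - E^{1/2}/(3√2)` if `E < 2/L²`. -/
def lowerJ (L E : ℝ) : ℝ :=
  if 2 / L ^ 2 ≤ E then 1 / (3 * L ^ 3 * E) else 1 / (2 * L) - √E / (3 * √2)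

/-- `min {1/(3L³E), 1/(2L) - E^{1/2}/(3√2)}`, with `1/(3L³E) = +∞` for `E = 0`. -/
def lowerMin (L E : ℝ) : ℝ :=
  if E = 0 then 1 / (2 * L) - √E / (3 * √2)
  else min (1 / (3 * L ^ 3 * E)) (1 / (2 * L) - √E / (3 * √2))

/-- `min {1/(3L³E₀), 1/(6L)}`, with `1/(3L³E₀) = +∞` for `E₀ = 0`. -/
def lowerInit (L E₀ : ℝ) : ℝ :=
  if E₀ = 0 then 1 / (6 * L) else min (1 / (3 * L ^ 3 * E₀)) (1 / (6 * L))

end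

end SlopeEq

open SlopeEq

/-!
In terms of `w = 1/u` the equation becomes `w_t = ∂⁴ f(w)` with the decreasing function
`f(w) = w⁻³ + w⁻¹`, so that `f(w) = u³ + u`, and it conserves `∫ w = L`. Everything rests on this
form.

*A priori bounds.* The quantity `E = ∫ (f(w)_hh)²` is a Lyapunov function. By Sobolev embedding
`v = u³ + u`, and with it `u`, exceeds its minimum at distance `r` by at most `2/3 √E r^{3/2}`. As
`∫ 1/u = L`, the minimum of `u` is at least `J(E)` (`lowerJ_le`). Hence `u` stays between positive
constants determined by the datum. This applies to the datum itself, which is therefore strictly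
positive (`lowerJ_le_datum`). It also shows that replacing `f` outside a sufficiently large
interval `[a,b]` by affine functions, which makes it bilipschitz (`truncF`), does not affect the
solution (`mem_range_of_bounds`).

*Existence for bilipschitz `f`.* In the orthonormal basis `cos (2πkh) + sin (2πkh)` of real
eigenfunctions of `∂⁴`, with eigenvalues `μ_k`, the unknown is `η = w_t`, and the equation reads
`η_k = μ_k f(w₀ + Jη)_k`, where `J` is integration in time. Let `-C ≤ f' ≤ -c < 0`. Adding `C Jη`
on both sides turns this into `Jη = S (N (Jη))`, where `N(x) = f(w₀ + x) + C x` has the Lipschitz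
constant `C - c`, and `S = ∑ μ_k J (1 + C μ_k J)⁻¹ P_k` has norm at most `1/C`, because `J` is
accretive. The map `S ∘ N` is a contraction. Since `S` commutes with `J` and the chain rule gives
`N (Jη) = N 0 + Jγ` with `‖γ‖ ≤ (C - c) ‖η‖`, the iterates stay in the image under `J` of a fixed
ball. That image is closed, by weak compactness, and so contains the fixed point
(`ModeSystem.exists_solution`, `exists_weak_solution`).

*Regularity and the energy identities.* The coefficients of `v = f(w)` satisfy
`(μ_k v_k²)_t = 2 η_k (v_t)_k`. Summing with Parseval's identity in `h`, integrated in time,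
yields `E(t) = E(0) + 2 ∫∫ f'(w) η²`, together with a summable majorant of `μ_k v_k²` that is
uniform in time. Therefore `v` is a continuous curve in `H²`, and `v_hhhh = η` is square
integrable (`WeakSol`). Composition with the smooth inverse of `u³ + u` carries this over to `u`
(`TruncSol`). The identity for `F` follows in the same way from `F = ∫ G(w)` with `G' = -f` and
`∫ f(w) η = E`.

*Uniqueness.* For two solutions, `y = 1/u - 1/v` has the coefficients `y_k = μ_k ∫₀ᵗ z_k`, with
`z = (u³ + u) - (v³ + v)`. Thus `y_0 = 0` and `∫∫ y z = ∑_{k≠0} y_k(T)² / (2 μ_k) ≥ 0`, whereas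
`y z ≤ 0` pointwise, so that `y z = 0` (`IsStrongSolution.unique`). By uniqueness the solutions on
the intervals `[0,T]` fit together.
-/

namespace SlopeEq

noncomputable section

/-! ### Absolutely continuous primitives -/

/-- `f` is an absolutely continuous primitive of the locally integrable function `g`. -/
structure IsPrim (f g : ℝ → ℝ) : Prop where
  locInt : LocallyIntegrable g
  eq : ∀ x, f x = f 0 + ∫ y in (0 : ℝ)..x, g y

namespace IsPrim

variable {f g f₁ g₁ f₂ g₂ : ℝ → ℝ}

theorem intervalIntegrable (h : IsPrim f g) (a b : ℝ) : IntervalIntegrable g volume a b :=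
  (h.locInt.integrableOn_isCompact isCompact_uIcc).intervalIntegrable

theorem integral_eq (h : IsPrim f g) (a b : ℝ) : ∫ y in a..b, g y = f b - f a := by
  rw [h.eq a, h.eq b, ← intervalIntegral.integral_add_adjacent_intervals
    (h.intervalIntegrable 0 a) (h.intervalIntegrable a b)]
  ring

theorem continuous (h : IsPrim f g) : Continuous f := by
  have : f = fun x => f 0 + ∫ y in (0 : ℝ)..x, g y := funext h.eq
  rw [this]
  exact continuous_const.add (intervalIntegral.continuous_primitive h.intervalIntegrable 0)

theorem of_hasDerivAt (h : ∀ x, HasDerivAt f (g x) x) (hg : Continuous g) : IsPrim f g := by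
  refine ⟨hg.locallyIntegrable, fun x => ?_⟩
  rw [intervalIntegral.integral_eq_sub_of_hasDerivAt (fun y _ => h y) (hg.intervalIntegrable _ _)]
  ring

theorem hasDerivAt (h : IsPrim f g) (hg : Continuous g) (x : ℝ) : HasDerivAt f (g x) x := by
  have : f = fun x => f 0 + ∫ y in (0 : ℝ)..x, g y := funext h.eq
  rw [this]
  exact (hg.integral_hasStrictDerivAt 0 x).hasDerivAt.const_add _

theorem congr (h : IsPrim f g) (hg : g =ᵐ[volume] g₁) : IsPrim f g₁ := by
  refine ⟨(locallyIntegrable_congr hg).1 h.locInt, fun x => ?_⟩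
  rw [h.eq x, intervalIntegral.integral_congr_ae (hg.mono fun y hy _ => hy)]

theorem ae_hasDerivAt (h : IsPrim f g) : ∀ᵐ x, HasDerivAt f (g x) x := by
  have hf : f = fun x => f 0 + ∫ y in (0 : ℝ)..x, g y := funext h.eq
  filter_upwards [LocallyIntegrable.ae_hasDerivAt_integral h.locInt] with x hx
  rw [hf]
  exact (hx 0).const_add _

theorem add (h₁ : IsPrim f₁ g₁) (h₂ : IsPrim f₂ g₂) :
    IsPrim (fun x => f₁ x + f₂ x) (fun x => g₁ x + g₂ x) := by
  refine ⟨h₁.locInt.add h₂.locInt, fun x => ?_⟩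
  rw [intervalIntegral.integral_add (h₁.intervalIntegrable _ _) (h₂.intervalIntegrable _ _),
    h₁.eq x, h₂.eq x]
  ring

theorem const_mul (h : IsPrim f g) (c : ℝ) : IsPrim (fun x => c * f x) (fun x => c * g x) := by
  refine ⟨h.locInt.smul c, fun x => ?_⟩
  rw [intervalIntegral.integral_const_mul, h.eq x]
  ring

theorem sub (h₁ : IsPrim f₁ g₁) (h₂ : IsPrim f₂ g₂) :
    IsPrim (fun x => f₁ x - f₂ x) (fun x => g₁ x - g₂ x) := by
  simpa [sub_eq_add_neg] using h₁.add (h₂.const_mul (-1))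

theorem absolutelyContinuousOnInterval (h : IsPrim f g) (a b : ℝ) :
    AbsolutelyContinuousOnInterval f a b := by
  have hf : f = fun x => f a + ∫ y in a..x, g y := by
    funext x; rw [h.integral_eq]; ring
  have h1 := (h.intervalIntegrable a b).absolutelyContinuousOnInterval_intervalIntegral
    (c := a) left_mem_uIcc
  rw [absolutelyContinuousOnInterval_iff] at h1 ⊢
  rw [hf]
  simpa [dist_add_left] using h1

/-- Chain rule for an absolutely continuous inner function; the outer function only has to be
`C¹` along the values of the inner one. -/
theorem comp {Φ Φ' : ℝ → ℝ} (h : IsPrim f g) (hΦ : ∀ x, HasDerivAt Φ (Φ' (f x)) (f x))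
    (hc : Continuous fun x => Φ' (f x)) :
    IsPrim (fun x => Φ (f x)) (fun x => Φ' (f x) * g x) := by
  have hloc : LocallyIntegrable (fun x => Φ' (f x) * g x) := by
    have := h.locInt.smul_continuous hc
    simpa [smul_eq_mul, mul_comm] using this
  refine ⟨hloc, fun x => ?_⟩
  have hac : AbsolutelyContinuousOnInterval (fun x => Φ (f x)) 0 x := by
    obtain ⟨C, hC⟩ := (isCompact_uIcc (a := (0 : ℝ)) (b := x)).exists_bound_of_continuousOn
      hc.continuousOn
    have hlip : LipschitzOnWith C.toNNReal Φ (f '' uIcc 0 x) := by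
      refine Convex.lipschitzOnWith_of_nnnorm_hasDerivWithin_le (f' := Φ') ?_ ?_ ?_
      · exact ((isPreconnected_uIcc).image f h.continuous.continuousOn).ordConnected.convex
      · rintro _ ⟨y, -, rfl⟩
        exact (hΦ y).hasDerivWithinAt
      · rintro _ ⟨y, hy, rfl⟩
        exact NNReal.le_toNNReal_of_coe_le (hC y hy)
    have h1 := h.absolutelyContinuousOnInterval 0 x
    rw [absolutelyContinuousOnInterval_iff] at h1 ⊢
    intro ε hε
    obtain ⟨δ, hδ, hE⟩ := h1 (ε / (C.toNNReal + 1)) (by positivity)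
    refine ⟨δ, hδ, fun E hE1 hE2 => ?_⟩
    have h2 := hE E hE1 hE2
    have h3 : ∀ i ∈ Finset.range E.1, dist (Φ (f (E.2 i).1)) (Φ (f (E.2 i).2)) ≤
        (C.toNNReal + 1) * dist (f (E.2 i).1) (f (E.2 i).2) := by
      intro i hi
      have h4 := hE1.1 i hi
      refine (hlip.dist_le_mul _ (mem_image_of_mem f h4.1) _ (mem_image_of_mem f h4.2)).trans ?_
      gcongr
      linarith
    refine (Finset.sum_le_sum h3).trans_lt ?_
    rw [← Finset.mul_sum]
    rwa [lt_div_iff₀' (by positivity)] at h2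
  have h5 := hac.integral_deriv_eq_sub
  have h6 : ∫ y in (0 : ℝ)..x, deriv (fun x => Φ (f x)) y = ∫ y in (0 : ℝ)..x, Φ' (f y) * g y := by
    refine intervalIntegral.integral_congr_ae (h.ae_hasDerivAt.mono fun y hy _ => ?_)
    exact ((hΦ y).comp y hy).deriv
  rw [← h6, h5]
  ring

theorem sq (h : IsPrim f g) : IsPrim (fun x => f x ^ 2) (fun x => 2 * f x * g x) := by
  refine h.comp (Φ := fun y => y ^ 2) (Φ' := fun y => 2 * y) (fun x => ?_)
    (continuous_const.mul h.continuous)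
  simpa using hasDerivAt_pow 2 (f x)

/-- Product rule for absolutely continuous functions. -/
theorem mul (h₁ : IsPrim f₁ g₁) (h₂ : IsPrim f₂ g₂) :
    IsPrim (fun x => f₁ x * f₂ x) (fun x => g₁ x * f₂ x + f₁ x * g₂ x) := by
  have := ((h₁.add h₂).sq.sub (h₁.sub h₂).sq).const_mul (1 / 4)
  convert this using 2 <;> ring

end IsPrim

/-- The lemma of du Bois-Reymond: on a nonempty open interval, a function whose weak derivative
vanishes is constant. -/
theorem ae_eq_const_of_integral_deriv_mul_eq_zero {U : Set ℝ} (hU : IsOpen U) (hU' : U.OrdConnected)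
    (hne : U.Nonempty) {f : ℝ → ℝ} (hf : LocallyIntegrableOn f U)
    (h : ∀ φ : ℝ → ℝ, ContDiff ℝ ∞ φ → HasCompactSupport φ → tsupport φ ⊆ U →
      ∫ x, f x * deriv φ x = 0) : ∃ c : ℝ, ∀ᵐ x, x ∈ U → f x = c := by
  obtain ⟨x₀, hx₀⟩ := hne
  obtain ⟨r, hr, hrU⟩ := Metric.isOpen_iff.1 hU x₀ hx₀
  let B : ContDiffBump x₀ := ⟨r / 4, r / 2, by positivity, by linarith⟩
  set ρ : ℝ → ℝ := B.normed volume with hρ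
  have hρs : ContDiff ℝ ∞ ρ := B.contDiff_normed
  have hρc : HasCompactSupport ρ := B.hasCompactSupport_normed
  have hρt : tsupport ρ ⊆ U := by
    rw [hρ, B.tsupport_normed_eq]
    exact (Metric.closedBall_subset_ball (by change r / 2 < r; linarith)).trans hrU
  have hρ1 : ∫ x, ρ x = 1 := B.integral_normed
  have key : ∀ φ : ℝ → ℝ, ContDiff ℝ ∞ φ → HasCompactSupport φ → tsupport φ ⊆ U →
      Integrable (fun x => φ x * f x) := by
    intro φ h1 h2 h3
    have h4 : IntegrableOn f (tsupport φ) := hf.integrableOn_compact_subset h3 h2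
    have := (integrable_indicator_iff (isClosed_tsupport φ).measurableSet).2
      (h4.continuousOn_mul h1.continuous.continuousOn h2)
    refine this.congr (Eventually.of_forall fun x => ?_)
    by_cases hx : x ∈ tsupport φ
    · simp [hx]
    · simp [hx, image_eq_zero_of_notMem_tsupport hx]
  refine ⟨∫ x, ρ x * f x, ?_⟩
  have hmain := hU.ae_eq_zero_of_integral_contDiff_smul_eq_zero (μ := volume)
    (f := fun x => f x - ∫ y, ρ y * f y) (hf.sub (locallyIntegrableOn_const _)) ?_
  · filter_upwards [hmain] with x hx hxU
    linarith [hx hxU]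
  intro φ h1 h2 h3
  -- subtracting a multiple of the bump `ρ` makes the mean zero, so that the primitive `Ψ` of `ψ` has
  -- compact support in `U` and is an admissible test function
  set m := ∫ x, φ x with hm
  let ψ : ℝ → ℝ := fun x => φ x - m * ρ x
  have hψs : ContDiff ℝ ∞ ψ := h1.sub (contDiff_const.mul hρs)
  have hψc : HasCompactSupport ψ := h2.sub (hρc.mul_left (f := fun _ => m))
  have hψi : Integrable ψ := hψs.continuous.integrable_of_hasCompactSupport hψc
  have hψ0 : ∫ x, ψ x = 0 := by
    rw [integral_sub (h1.continuous.integrable_of_hasCompactSupport h2)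
      ((hρs.continuous.integrable_of_hasCompactSupport hρc).const_mul m), integral_const_mul, hρ1]
    simp [hm]
  have hK : IsCompact (tsupport φ ∪ tsupport ρ) := h2.isCompact.union hρc
  have hKne : (tsupport φ ∪ tsupport ρ).Nonempty := by
    refine ⟨x₀, Or.inr ?_⟩
    rw [hρ, B.tsupport_normed_eq]
    exact Metric.mem_closedBall_self (by change 0 ≤ r / 2; linarith)
  obtain ⟨p, hp⟩ := hK.exists_isLeast hKne
  obtain ⟨q, hq⟩ := hK.exists_isGreatest hKne
  have hKU : tsupport φ ∪ tsupport ρ ⊆ U := union_subset h3 hρt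
  have hpqU : Icc p q ⊆ U := hU'.out (hKU hp.1) (hKU hq.1)
  have hψz : ∀ x, x ∉ Icc p q → ψ x = 0 := by
    intro x hx
    have : x ∉ tsupport φ ∪ tsupport ρ := fun h => hx ⟨hp.2 h, hq.2 h⟩
    rw [mem_union, not_or] at this
    simp [ψ, image_eq_zero_of_notMem_tsupport this.1, image_eq_zero_of_notMem_tsupport this.2]
  let Ψ : ℝ → ℝ := fun x => ∫ y in p..x, ψ y
  have hΨd : ∀ x, HasDerivAt Ψ (ψ x) x := fun x =>
    (hψs.continuous.integral_hasStrictDerivAt p x).hasDerivAt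
  have hΨ' : deriv Ψ = ψ := funext fun x => (hΨd x).deriv
  have hΨs : ContDiff ℝ ∞ Ψ := by
    rw [contDiff_infty_iff_deriv, hΨ']
    exact ⟨fun x => (hΨd x).differentiableAt, hψs⟩
  have hpq : p ≤ q := hp.2 hq.1
  have hΨz : ∀ x, x ∉ Icc p q → Ψ x = 0 := by
    intro x hx
    rcases lt_or_ge x p with hxp | hxp
    · have : ∫ y in p..x, ψ y = ∫ y in p..x, (0 : ℝ) := by
        refine intervalIntegral.integral_congr_ae (Eventually.of_forall fun y hy => ?_)
        rw [uIoc_of_ge hxp.le] at hy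
        rcases eq_or_lt_of_le hy.2 with h | h
        · subst h
          have : y ∈ closure (Iio y) := by simp
          refine (isClosed_eq hψs.continuous continuous_const).closure_subset_iff.2 ?_ this
          intro z hz
          exact hψz z fun h => absurd h.1 (not_le.2 hz)
        · exact hψz y fun h' => absurd h'.1 (not_le.2 h)
      change ∫ y in p..x, ψ y = 0
      simpa using this
    · have hxq : q < x := by
        by_contra hcon
        exact hx ⟨hxp, not_lt.1 hcon⟩
      change ∫ y in p..x, ψ y = 0
      rw [← hψ0]
      have hsub : Function.support ψ ⊆ Ioc (p - 1) x := by
        intro y hy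
        by_contra hcon
        exact hy (hψz y fun h' => hcon ⟨by linarith [h'.1], by linarith [h'.2]⟩)
      rw [← intervalIntegral.integral_eq_integral_of_support_subset hsub,
        ← intervalIntegral.integral_add_adjacent_intervals (a := p - 1) (b := p) hψi.intervalIntegrable
          hψi.intervalIntegrable]
      have : ∫ y in (p - 1)..p, ψ y = ∫ y in (p - 1)..p, (0 : ℝ) := by
        refine intervalIntegral.integral_congr_ae ?_
        filter_upwards [compl_mem_ae_iff.2 (measure_singleton (μ := (volume : Measure ℝ)) p)]
          with y hyp hy
        rw [uIoc_of_le (by linarith)] at hy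
        exact hψz y fun h' => hyp (le_antisymm hy.2 h'.1)
      rw [this]; simp
  have hΨt : tsupport Ψ ⊆ Icc p q := by
    refine closure_minimal (fun x hx => ?_) isClosed_Icc
    by_contra hcon
    exact hx (hΨz x hcon)
  have hΨc : HasCompactSupport Ψ := isCompact_Icc.of_isClosed_subset (isClosed_tsupport _) hΨt
  have h7 := h Ψ hΨs hΨc (hΨt.trans hpqU)
  rw [hΨ'] at h7
  have hiφ := key φ h1 h2 h3
  have hiρ := key ρ hρs hρc hρt
  have h8 : ∫ x, f x * ψ x = (∫ x, φ x * f x) - m * ∫ x, ρ x * f x := by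
    rw [← integral_const_mul, ← integral_sub hiφ (hiρ.const_mul m)]
    exact integral_congr_ae (Eventually.of_forall fun x => by simp only [ψ]; ring)
  have h9 : ∫ x, φ x • (f x - ∫ y, ρ y * f y) = (∫ x, φ x * f x) - m * ∫ x, ρ x * f x := by
    rw [hm, ← integral_mul_const, ← integral_sub hiφ
      ((h1.continuous.integrable_of_hasCompactSupport h2).mul_const _)]
    exact integral_congr_ae (Eventually.of_forall fun x => by simp only [smul_eq_mul]; ring)
  rw [h9, ← h8, h7]

/-! ### Weak derivatives and chains of derivatives -/

/-- Integration by parts against a compactly supported test function. -/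
theorem IsPrim.integral_mul_deriv {f g φ : ℝ → ℝ} (h : IsPrim f g) (hφ : ContDiff ℝ ∞ φ)
    (hc : HasCompactSupport φ) : ∫ x, f x * deriv φ x = -∫ x, g x * φ x := by
  have hd : Continuous (deriv φ) := hφ.continuous_deriv (by simp)
  have hprim : IsPrim φ (deriv φ) :=
    IsPrim.of_hasDerivAt (fun x => (hφ.differentiable (by simp) x).hasDerivAt) hd
  obtain ⟨R, hR0, hR⟩ := hc.isCompact.isBounded.subset_ball_lt 0 0
  have hz : ∀ x, x ∉ Ioo (-R) R → x ∉ tsupport φ := by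
    intro x hx hx'
    have := hR hx'
    rw [Real.ball_eq_Ioo] at this
    exact hx (by simpa using this)
  have hφz : ∀ x, x ∉ Ioo (-R) R → φ x = 0 := fun x hx => image_eq_zero_of_notMem_tsupport (hz x hx)
  have hdz : ∀ x, x ∉ Ioo (-R) R → deriv φ x = 0 := fun x hx =>
    image_eq_zero_of_notMem_tsupport fun h' => hz x hx (tsupport_deriv_subset h')
  have h1 := (h.mul hprim).integral_eq (-R) R
  rw [hφz R (by simp), hφz (-R) (by simp)] at h1
  rw [intervalIntegral.integral_add] at h1
  · have s1 : Function.support (fun x => g x * φ x) ⊆ Ioc (-R) R := by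
      intro x hx
      by_contra hcon
      exact hx (by simp [hφz x fun h' => hcon (Ioo_subset_Ioc_self h')])
    have s2 : Function.support (fun x => f x * deriv φ x) ⊆ Ioc (-R) R := by
      intro x hx
      by_contra hcon
      exact hx (by simp [hdz x fun h' => hcon (Ioo_subset_Ioc_self h')])
    rw [intervalIntegral.integral_eq_integral_of_support_subset s1,
      intervalIntegral.integral_eq_integral_of_support_subset s2] at h1
    linarith
  · exact (h.intervalIntegrable _ _).mul_continuousOn hφ.continuous.continuousOn
  · exact (h.continuous.mul hd).intervalIntegrable _ _

theorem hasWeakDeriv_zero {f : ℝ → ℝ} (hf : LocallyIntegrable f) : HasWeakDeriv 0 f f :=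
  ⟨hf, hf, fun φ _ _ => by simp⟩

theorem contDiff_iteratedDeriv_of_contDiff_infty {φ : ℝ → ℝ} (hφ : ContDiff ℝ ∞ φ) (k : ℕ) :
    ContDiff ℝ ∞ (iteratedDeriv k φ) := by
  rw [iteratedDeriv_eq_iterate]
  exact hφ.iterate_deriv k

theorem hasCompactSupport_iteratedDeriv {φ : ℝ → ℝ} (hφ : HasCompactSupport φ) (k : ℕ) :
    HasCompactSupport (iteratedDeriv k φ) := by
  induction k with
  | zero => simpa
  | succ k ih => rw [iteratedDeriv_succ]; exact ih.deriv

theorem HasWeakDeriv.succ_of_isPrim {f g l : ℝ → ℝ} {k : ℕ} (h : HasWeakDeriv k g l)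
    (hfg : IsPrim f g) : HasWeakDeriv (k + 1) f l := by
  refine ⟨hfg.continuous.locallyIntegrable, h.2.1, fun φ hφ hc => ?_⟩
  rw [iteratedDeriv_succ, hfg.integral_mul_deriv (contDiff_iteratedDeriv_of_contDiff_infty hφ k)
    (hasCompactSupport_iteratedDeriv hc k), h.2.2 φ hφ hc]
  ring

theorem HasWeakDeriv.ae_unique {f g₁ g₂ : ℝ → ℝ} {k : ℕ} (h₁ : HasWeakDeriv k f g₁)
    (h₂ : HasWeakDeriv k f g₂) : g₁ =ᵐ[volume] g₂ := by
  refine ae_eq_of_integral_contDiff_smul_eq h₁.2.1 h₂.2.1 fun φ hφ hc => ?_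
  have h3 := (h₁.2.2 φ hφ hc).symm.trans (h₂.2.2 φ hφ hc)
  simpa [mul_comm] using mul_left_cancel₀ (by simp) h3

theorem HasWeakDeriv.weakDeriv_ae_eq {f g : ℝ → ℝ} {k : ℕ} (h : HasWeakDeriv k f g) :
    weakDeriv k f =ᵐ[volume] g := by
  have h' : ∃ g, HasWeakDeriv k f g := ⟨g, h⟩
  rw [weakDeriv, dif_pos h']
  exact h'.choose_spec.ae_unique h

/-- The weak derivative of a weak derivative. -/
theorem HasWeakDeriv.one_of_succ {f g l : ℝ → ℝ} {k : ℕ} (h₁ : HasWeakDeriv k f g)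
    (h₂ : HasWeakDeriv (k + 1) f l) : HasWeakDeriv 1 g l := by
  refine ⟨h₁.2.1, h₂.2.1, fun φ hφ hc => ?_⟩
  have h3 := h₁.2.2 (deriv φ) (by simpa using contDiff_iteratedDeriv_of_contDiff_infty hφ 1) hc.deriv
  have h4 := h₂.2.2 φ hφ hc
  rw [iteratedDeriv_succ', h3, pow_succ, mul_assoc] at h4
  simpa using mul_left_cancel₀ (by simp) h4

/-- A function with a weak derivative agrees almost everywhere with a primitive of it. -/
theorem HasWeakDeriv.exists_isPrim {f g : ℝ → ℝ} (h : HasWeakDeriv 1 f g) :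
    ∃ f', f =ᵐ[volume] f' ∧ IsPrim f' g := by
  have hG : IsPrim (fun x => ∫ y in (0 : ℝ)..x, g y) g := ⟨h.2.1, fun x => by simp⟩
  obtain ⟨c, hc⟩ := ae_eq_const_of_integral_deriv_mul_eq_zero isOpen_univ ordConnected_univ
    univ_nonempty (f := fun x => f x - ∫ y in (0 : ℝ)..x, g y)
    ((h.1.sub hG.continuous.locallyIntegrable).locallyIntegrableOn _) (fun φ hφ hφc _ => by
      have h1 := h.2.2 φ hφ hφc
      have h2 := hG.integral_mul_deriv hφ hφc
      have hdc : Continuous (deriv φ) := hφ.continuous_deriv (by simp)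
      have i1 : Integrable (fun x => f x * deriv φ x) := by
        simpa [mul_comm] using h.1.integrable_smul_left_of_hasCompactSupport hdc hφc.deriv
      have i2 : Integrable (fun x => (∫ y in (0 : ℝ)..x, g y) * deriv φ x) :=
        (hG.continuous.mul hdc).integrable_of_hasCompactSupport hφc.deriv.mul_left
      simp only [sub_mul]
      rw [integral_sub i1 i2, h2]
      simp only [iteratedDeriv_one] at h1
      rw [h1]; ring)
  refine ⟨fun x => c + ∫ y in (0 : ℝ)..x, g y, ?_, h.2.1, fun x => by simp⟩
  filter_upwards [hc] with x hx
  linarith [hx (mem_univ x)]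

/-- A chain of derivatives `d 0, …, d m`: each member is an absolutely continuous `1`-periodic
primitive of the next, and the last one is square integrable over a period. For `m ≥ 1` this is the
classical description of `d 0 ∈ H^m_per([0,1])`. -/
structure PerChain (m : ℕ) (d : ℕ → ℝ → ℝ) : Prop where
  prim : ∀ j < m, IsPrim (d j) (d (j + 1))
  per : ∀ j ≤ m, Function.Periodic (d j) 1
  memLp : MemLp (d m) 2 (volume.restrict (Icc 0 1))

namespace PerChain

variable {m : ℕ} {d : ℕ → ℝ → ℝ}

theorem continuous (h : PerChain m d) {j : ℕ} (hj : j < m) : Continuous (d j) :=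
  (h.prim j hj).continuous

theorem locInt (h : PerChain m d) (hm : 1 ≤ m) {j : ℕ} (hj : j ≤ m) : LocallyIntegrable (d j) := by
  rcases hj.lt_or_eq with h1 | h1
  · exact (h.continuous h1).locallyIntegrable
  · obtain ⟨i, rfl⟩ : ∃ i, m = i + 1 := ⟨m - 1, by omega⟩
    rw [h1]; exact (h.prim i (by omega)).locInt

theorem memLp_of_le (h : PerChain m d) {j : ℕ} (hj : j ≤ m) :
    MemLp (d j) 2 (volume.restrict (Icc 0 1)) := by
  rcases hj.lt_or_eq with h1 | h1
  · obtain ⟨C, hC⟩ := (isCompact_Icc (a := (0 : ℝ)) (b := 1)).exists_bound_of_continuousOn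
      (h.continuous h1).continuousOn
    exact MemLp.of_bound (h.continuous h1).aestronglyMeasurable C
      ((ae_restrict_iff' measurableSet_Icc).2 (Eventually.of_forall hC))
  · rw [h1]; exact h.memLp

theorem mono (h : PerChain m d) {k : ℕ} (hk : k ≤ m) : PerChain k d :=
  ⟨fun j hj => h.prim j (hj.trans_le hk), fun j hj => h.per j (hj.trans hk), h.memLp_of_le hk⟩

theorem hasWeakDeriv (h : PerChain m d) (hm : 1 ≤ m) : ∀ k j, j + k ≤ m →
    HasWeakDeriv k (d j) (d (j + k)) := by
  intro k
  induction k with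
  | zero => exact fun j hj => hasWeakDeriv_zero (h.locInt hm hj)
  | succ k ih =>
    intro j hj
    have := (ih (j + 1) (by omega)).succ_of_isPrim (h.prim j (by omega))
    rwa [show j + 1 + k = j + (k + 1) by omega] at this

theorem weakDeriv_ae_eq (h : PerChain m d) (hm : 1 ≤ m) {k : ℕ} (hk : k ≤ m) :
    weakDeriv k (d 0) =ᵐ[volume] d k := by
  have := (h.hasWeakDeriv hm k 0 (by omega)).weakDeriv_ae_eq
  rwa [zero_add] at this

theorem memHper (h : PerChain m d) (hm : 1 ≤ m) : MemHper m (d 0) where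
  continuous := h.continuous (by omega)
  periodic := h.per 0 (by omega)
  weak k hk := ⟨d k, by simpa using h.hasWeakDeriv hm k 0 (by omega), h.memLp_of_le hk⟩

theorem hperNorm_sq (h : PerChain m d) (hm : 1 ≤ m) :
    hperNorm m (d 0) ^ 2 = ∑ k ∈ Finset.range (m + 1), ∫ x in (0 : ℝ)..1, d k x ^ 2 := by
  have h1 : ∀ k ∈ Finset.range (m + 1), ∫ x in (0 : ℝ)..1, weakDeriv k (d 0) x ^ 2 =
      ∫ x in (0 : ℝ)..1, d k x ^ 2 := fun k hk =>
    intervalIntegral.integral_congr_ae ((h.weakDeriv_ae_eq hm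
      (by simpa [Nat.lt_succ_iff] using hk)).mono fun x hx _ => by rw [hx])
  rw [hperNorm, Real.sq_sqrt, Finset.sum_congr rfl h1]
  exact Finset.sum_nonneg fun k _ => intervalIntegral.integral_nonneg zero_le_one
    fun x _ => sq_nonneg _

end PerChain

theorem IsPrim.periodic {f g : ℝ → ℝ} (h : IsPrim f g) (hg : ∀ᵐ x, g (x + 1) = g x)
    (h0 : f 1 = f 0) : Function.Periodic f 1 := by
  intro x
  have h1 : ∫ y in (0 : ℝ)..x, g (y + 1) = ∫ y in (0 : ℝ)..x, g y :=
    intervalIntegral.integral_congr_ae (hg.mono fun y hy _ => hy)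
  rw [intervalIntegral.integral_comp_add_right, zero_add, h.integral_eq, h.integral_eq, h0] at h1
  linarith

/-- The density of a periodic absolutely continuous function is periodic up to a null set. -/
theorem IsPrim.ae_comp_fract {f g : ℝ → ℝ} (h : IsPrim f g) (hp : Function.Periodic f 1) :
    (fun x => g (Int.fract x)) =ᵐ[volume] g := by
  have h1 : ∀ n : ℤ, ∀ᵐ x, g (x - n) = g x := by
    intro n
    have h2 := (measurePreserving_sub_right volume (n : ℝ)).quasiMeasurePreserving.ae
      h.ae_hasDerivAt
    filter_upwards [h2, h.ae_hasDerivAt] with x hx hx'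
    have h3 : HasDerivAt (fun y => f (y - n)) (g (x - n)) x := by
      simpa using HasDerivAt.comp_sub_const x (n : ℝ) hx
    have h4 : (fun y => f (y - n)) = f := by
      funext y
      have := hp.sub_int_mul_eq (x := y) n
      simpa using this
    rw [h4] at h3
    exact h3.unique hx'
  filter_upwards [ae_all_iff.2 h1] with x hx
  exact hx ⌊x⌋

/-- Elements of `H^m_per` are the initial members of chains of derivatives. -/
theorem MemHper.exists_perChain {m : ℕ} (hm : 1 ≤ m) {f : ℝ → ℝ} (h : MemHper m f) :
    ∃ d, d 0 = f ∧ PerChain m d := by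
  choose! g hg using h.weak
  have hprim : ∀ j, ∃ f', (j < m → g j =ᵐ[volume] f' ∧ IsPrim f' (g (j + 1))) := by
    intro j
    by_cases hj : j < m
    · obtain ⟨f', h1, h2⟩ := ((hg j hj.le).1.one_of_succ (hg (j + 1) hj).1).exists_isPrim
      exact ⟨f', fun _ => ⟨h1, h2⟩⟩
    · exact ⟨0, fun h' => absurd h' hj⟩
  choose F hF using hprim
  -- the last derivative is periodic only up to a null set, which `Int.fract` repairs
  set d : ℕ → ℝ → ℝ := fun j => if j < m then F j else fun x => g m (Int.fract x) with hd
  have hdj : ∀ j < m, d j = F j := fun j hj => by simp [hd, hj]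
  have hdm : d m = fun x => g m (Int.fract x) := by simp [hd]
  have h0f : F 0 = f := by
    have h1 : g 0 =ᵐ[volume] f := (hg 0 (by omega)).1.ae_unique
      (hasWeakDeriv_zero h.continuous.locallyIntegrable)
    have h2 : F 0 =ᵐ[volume] f := (hF 0 (by omega)).1.symm.trans h1
    exact (Continuous.ae_eq_iff_eq volume (hF 0 (by omega)).2.continuous h.continuous).1 h2
  have hpF : ∀ j, j + 1 < m → IsPrim (F j) (F (j + 1)) := fun j hj =>
    (hF j (by omega)).2.congr (hF (j + 1) hj).1
  have hper : ∀ j < m, Function.Periodic (F j) 1 := by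
    intro j
    induction j with
    | zero => intro _; rw [h0f]; exact h.periodic
    | succ j ih =>
      intro hj
      have h1 := ih (by omega)
      have hc := (hF (j + 1) hj).2.continuous
      have hc' : Continuous fun x => F (j + 1) (x + 1) := hc.comp (continuous_add_const 1)
      have h2 : IsPrim (F j) (fun x => F (j + 1) (x + 1)) := by
        refine ⟨hc'.locallyIntegrable, fun x => ?_⟩
        rw [intervalIntegral.integral_comp_add_right (fun y => F (j + 1) y),
            (hpF j hj).integral_eq, h1 x, h1 0]
        ring
      intro x
      exact (h2.hasDerivAt hc' x).unique ((hpF j hj).hasDerivAt hc x)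
  have hgm : (fun x => g m (Int.fract x)) =ᵐ[volume] g m := by
    obtain ⟨i, rfl⟩ : ∃ i, m = i + 1 := ⟨m - 1, by omega⟩
    exact (hF i (by omega)).2.ae_comp_fract (hper i (by omega))
  refine ⟨d, by rw [hdj 0 (by omega), h0f], fun j hj => ?_, fun j hj => ?_, ?_⟩
  · rw [hdj j hj]
    rcases (Nat.succ_le_of_lt hj).lt_or_eq with h1 | h1
    · rw [hdj (j + 1) h1]; exact hpF j h1
    · have h2 : d (j + 1) = fun x => g (j + 1) (Int.fract x) := by
        have := hdm; rwa [← h1] at this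
      rw [h2]
      refine (hF j hj).2.congr ?_
      rw [← h1] at hgm
      exact hgm.symm
  · rcases hj.lt_or_eq with h1 | h1
    · rw [hdj j h1]; exact hper j h1
    · rw [h1, hdm]; intro x; simp
  · rw [hdm]
    exact (hg m le_rfl).2.ae_eq (ae_restrict_of_ae hgm.symm)

/-! ### Composition with smooth functions -/

theorem memLp_two_of_continuous {f : ℝ → ℝ} (hf : Continuous f) :
    MemLp f 2 (volume.restrict (Icc (0 : ℝ) 1)) := by
  obtain ⟨C, hC⟩ := (isCompact_Icc (a := (0 : ℝ)) (b := 1)).exists_bound_of_continuousOn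
    hf.continuousOn
  exact MemLp.of_bound hf.aestronglyMeasurable C
    ((ae_restrict_iff' measurableSet_Icc).2 (Eventually.of_forall hC))

theorem memLp_continuous_mul {c g : ℝ → ℝ} (hc : Continuous c)
    (hg : MemLp g 2 (volume.restrict (Icc (0 : ℝ) 1))) :
    MemLp (fun x => c x * g x) 2 (volume.restrict (Icc (0 : ℝ) 1)) := by
  obtain ⟨C, hC⟩ := (isCompact_Icc (a := (0 : ℝ)) (b := 1)).exists_bound_of_continuousOn
    hc.continuousOn
  refine hg.of_le_mul (c := C) (hc.aestronglyMeasurable.mul hg.1)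
    ((ae_restrict_iff' measurableSet_Icc).2 (Eventually.of_forall fun x hx => ?_))
  rw [norm_mul]
  exact mul_le_mul_of_nonneg_right (hC x hx) (norm_nonneg _)

/-- The derivatives of order at most four of `Φ ∘ d 0`, by Faà di Bruno's formula; entries of
index `> 4` repeat the fourth derivative. -/
def compChain (Φ : ℝ → ℝ) (d : ℕ → ℝ → ℝ) : ℕ → ℝ → ℝ
  | 0 => fun x => Φ (d 0 x)
  | 1 => fun x => iteratedDeriv 1 Φ (d 0 x) * d 1 x
  | 2 => fun x => iteratedDeriv 2 Φ (d 0 x) * d 1 x ^ 2 + iteratedDeriv 1 Φ (d 0 x) * d 2 x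
  | 3 => fun x => iteratedDeriv 3 Φ (d 0 x) * d 1 x ^ 3 +
      3 * (iteratedDeriv 2 Φ (d 0 x) * d 1 x * d 2 x) + iteratedDeriv 1 Φ (d 0 x) * d 3 x
  | _ => fun x => iteratedDeriv 4 Φ (d 0 x) * d 1 x ^ 4 +
      6 * (iteratedDeriv 3 Φ (d 0 x) * d 1 x ^ 2 * d 2 x) +
      3 * (iteratedDeriv 2 Φ (d 0 x) * d 2 x ^ 2) +
      4 * (iteratedDeriv 2 Φ (d 0 x) * d 1 x * d 3 x) + iteratedDeriv 1 Φ (d 0 x) * d 4 x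

theorem IsPrim.comp_iteratedDeriv {f g Φ : ℝ → ℝ} (h : IsPrim f g) (hΦ : ContDiff ℝ ∞ Φ) (i : ℕ) :
    IsPrim (fun x => iteratedDeriv i Φ (f x)) (fun x => iteratedDeriv (i + 1) Φ (f x) * g x) := by
  have hi := contDiff_iteratedDeriv_of_contDiff_infty hΦ
  refine h.comp (fun x => ?_) ((hi (i + 1)).continuous.comp h.continuous)
  rw [iteratedDeriv_succ]
  exact ((hi i).differentiable (by simp) _).hasDerivAt

/-- `H²_per` and `H⁴_per` are stable under composition with smooth functions. -/
theorem PerChain.comp {m : ℕ} {d : ℕ → ℝ → ℝ} {Φ : ℝ → ℝ} (h : PerChain m d)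
    (hm : m = 2 ∨ m = 4) (hΦ : ContDiff ℝ ∞ Φ) : PerChain m (compChain Φ d) := by
  have h2m : 2 ≤ m := by omega
  have p0 := h.prim 0 (by omega)
  have p1 := h.prim 1 (by omega)
  have hΦp := fun i => p0.comp_iteratedDeriv hΦ i
  have e1 : IsPrim (compChain Φ d 0) (compChain Φ d 1) := by
    simpa [compChain, iteratedDeriv_zero] using hΦp 0
  have e2 : IsPrim (compChain Φ d 1) (compChain Φ d 2) := by
    convert (hΦp 1).mul p1 using 1
    · rfl
    · funext x; simp only [compChain]; ring
  have e3 : 3 < m → IsPrim (compChain Φ d 2) (compChain Φ d 3) := by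
    intro hm3
    convert ((hΦp 2).mul p1.sq).add ((hΦp 1).mul (h.prim 2 (by omega))) using 1
    · rfl
    · funext x; simp only [compChain]; ring
  have e4 : 3 < m → IsPrim (compChain Φ d 3) (compChain Φ d 4) := by
    intro hm3
    have p2 := h.prim 2 (by omega)
    convert (((hΦp 3).mul (p1.sq.mul p1)).add ((((hΦp 2).mul p1).mul p2).const_mul 3)).add
      ((hΦp 1).mul (h.prim 3 (by omega))) using 1
    · funext x; simp only [compChain]; ring
    · funext x; simp only [compChain]; ring
  have c0 := fun i => (hΦp i).continuous
  have c1 := p1.continuous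
  refine ⟨fun j hj => ?_, fun j hj => ?_, ?_⟩
  · rcases hm with rfl | rfl <;> interval_cases j <;> simp only [zero_add, Nat.reduceAdd]
    exacts [e1, e2, e1, e2, e3 (by norm_num), e4 (by norm_num)]
  · have q0 := h.per 0 (by omega)
    have q1 := h.per 1 (by omega)
    intro x
    have q2 := h.per 2 (by omega)
    rcases hm with rfl | rfl <;> interval_cases j
    · simp [compChain, q0 x]
    · simp [compChain, q0 x, q1 x]
    · simp [compChain, q0 x, q1 x, q2 x]
    · simp [compChain, q0 x]
    · simp [compChain, q0 x, q1 x]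
    · simp [compChain, q0 x, q1 x, q2 x]
    · simp [compChain, q0 x, q1 x, q2 x, h.per 3 (by omega) x]
    · simp [compChain, q0 x, q1 x, q2 x, h.per 3 (by omega) x, h.per 4 (by omega) x]
  · rcases hm with rfl | rfl
    · exact (memLp_two_of_continuous ((c0 2).mul (c1.pow 2))).add (memLp_continuous_mul (c0 1) h.memLp)
    · have c2 := (h.prim 2 (by omega)).continuous
      have c3 := (h.prim 3 (by omega)).continuous
      refine MemLp.add (memLp_two_of_continuous ?_) (memLp_continuous_mul (c0 1) h.memLp)
      exact ((((c0 4).mul (c1.pow 4)).add (continuous_const.mul (((c0 3).mul (c1.pow 2)).mul c2))).add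
        (continuous_const.mul ((c0 2).mul (c2.pow 2)))).add
        (continuous_const.mul (((c0 2).mul c1).mul c3))

theorem PerChain.sub {m : ℕ} {d₁ d₂ : ℕ → ℝ → ℝ} (h₁ : PerChain m d₁) (h₂ : PerChain m d₂) :
    PerChain m (fun j x => d₁ j x - d₂ j x) :=
  ⟨fun j hj => (h₁.prim j hj).sub (h₂.prim j hj), fun j hj => (h₁.per j hj).sub (h₂.per j hj),
    h₁.memLp.sub h₂.memLp⟩

/-! ### The Fourier basis of real eigenfunctions -/

/-- The frequency `2πk`. -/
def freq (k : ℤ) : ℝ := 2 * Real.pi * k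

/-- The functions `cos (2πkx) + sin (2πkx)`, `k ∈ ℤ`: an orthonormal basis of `L²([0,1])`
consisting of real eigenfunctions of `∂⁴`, with a single formula for all indices. -/
def cas (k : ℤ) (x : ℝ) : ℝ := Real.cos (freq k * x) + Real.sin (freq k * x)

/-- The coefficients with respect to the basis `cas`. -/
def fcoef (f : ℝ → ℝ) (k : ℤ) : ℝ := ∫ x in (0 : ℝ)..1, f x * cas k x

theorem freq_neg (k : ℤ) : freq (-k) = -freq k := by simp [freq]

theorem freq_zero : freq 0 = 0 := by simp [freq]

theorem freq_ne_zero {k : ℤ} (hk : k ≠ 0) : freq k ≠ 0 := by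
  simp [freq, hk, Real.pi_ne_zero]

theorem cas_zero (x : ℝ) : cas 0 x = 1 := by simp [cas, freq]

theorem hasDerivAt_cas (k : ℤ) (x : ℝ) : HasDerivAt (cas k) (freq k * cas (-k) x) x := by
  have h1 : HasDerivAt (fun x => freq k * x) (freq k) x := by
    simpa using (hasDerivAt_id x).const_mul (freq k)
  refine (h1.cos.add h1.sin).congr_deriv ?_
  simp only [cas, freq_neg, neg_mul, Real.cos_neg, Real.sin_neg]
  ring

theorem continuous_cas (k : ℤ) : Continuous (cas k) :=
  continuous_iff_continuousAt.2 fun x => (hasDerivAt_cas k x).continuousAt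

theorem abs_cas_le (k : ℤ) (x : ℝ) : |cas k x| ≤ 2 := by
  refine (abs_add_le _ _).trans ?_
  linarith [Real.abs_cos_le_one (freq k * x), Real.abs_sin_le_one (freq k * x)]

theorem isPrim_cas (k : ℤ) : IsPrim (cas k) (fun x => freq k * cas (-k) x) :=
  IsPrim.of_hasDerivAt (hasDerivAt_cas k) (continuous_const.mul (continuous_cas _))

theorem periodic_cas (k : ℤ) : Function.Periodic (cas k) 1 := by
  intro x
  have h : freq k * (x + 1) = freq k * x + k * (2 * Real.pi) := by simp only [freq]; ring
  simp only [cas, h, Real.cos_add_int_mul_two_pi, Real.sin_add_int_mul_two_pi]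

theorem integral_cos_freq (k : ℤ) :
    ∫ x in (0 : ℝ)..1, Real.cos (freq k * x) = if k = 0 then 1 else 0 := by
  split_ifs with hk
  · simp [hk, freq_zero]
  · rw [intervalIntegral.integral_comp_mul_left (fun y => Real.cos y) (freq_ne_zero hk)]
    have : Real.sin (freq k) = 0 := by
      have h := Real.sin_int_mul_pi (2 * k)
      rwa [show ((2 * k : ℤ) : ℝ) * Real.pi = freq k by simp [freq]; ring] at h
    simp [this]

theorem integral_sin_freq (k : ℤ) : ∫ x in (0 : ℝ)..1, Real.sin (freq k * x) = 0 := by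
  by_cases hk : k = 0
  · simp [hk, freq_zero]
  · rw [intervalIntegral.integral_comp_mul_left (fun y => Real.sin y) (freq_ne_zero hk)]
    have : Real.cos (freq k) = 1 := by
      have h := Real.cos_int_mul_two_pi k
      rwa [show (k : ℝ) * (2 * Real.pi) = freq k by simp [freq]; ring] at h
    simp [this]

theorem integral_cas_mul_cas (j k : ℤ) :
    ∫ x in (0 : ℝ)..1, cas j x * cas k x = if j = k then 1 else 0 := by
  have h1 : ∀ x, cas j x * cas k x =
      Real.cos (freq (j - k) * x) + Real.sin (freq (j + k) * x) := by
    intro x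
    have e1 : freq (j - k) * x = freq j * x - freq k * x := by simp only [freq]; push_cast; ring
    have e2 : freq (j + k) * x = freq j * x + freq k * x := by simp only [freq]; push_cast; ring
    rw [e1, e2, Real.cos_sub, Real.sin_add, cas, cas]
    ring
  simp only [h1]
  rw [intervalIntegral.integral_add, integral_cos_freq, integral_sin_freq, add_zero]
  · simp [sub_eq_zero]
  · exact (by fun_prop : Continuous fun x => Real.cos (freq (j - k) * x)).intervalIntegrable _ _
  · exact (by fun_prop : Continuous fun x => Real.sin (freq (j + k) * x)).intervalIntegrable _ _

/-- Lebesgue measure on the unit interval. -/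
abbrev unitMeasure : Measure ℝ := volume.restrict (Icc (0 : ℝ) 1)

theorem integral_unitMeasure (f : ℝ → ℝ) : ∫ x, f x ∂unitMeasure = ∫ x in (0 : ℝ)..1, f x := by
  rw [intervalIntegral.integral_of_le zero_le_one, restrict_Ioc_eq_restrict_Icc]

instance : IsProbabilityMeasure unitMeasure := ⟨by simp [unitMeasure]⟩

theorem memLp_cas (k : ℤ) : MemLp (cas k) 2 unitMeasure := memLp_two_of_continuous (continuous_cas k)

theorem memLp_intervalIntegrable {f : ℝ → ℝ} (hf : MemLp f 2 unitMeasure) :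
    IntervalIntegrable f volume 0 1 := by
  rw [intervalIntegrable_iff_integrableOn_Icc_of_le zero_le_one]
  exact hf.integrable (by norm_num)

theorem memLp_mul_intervalIntegrable {f g : ℝ → ℝ} (hf : MemLp f 2 unitMeasure)
    (hg : MemLp g 2 unitMeasure) : IntervalIntegrable (fun x => f x * g x) volume 0 1 := by
  rw [intervalIntegrable_iff_integrableOn_Icc_of_le zero_le_one]
  exact hf.integrable_mul hg

theorem fcoef_congr {f g : ℝ → ℝ} (h : f =ᵐ[unitMeasure] g) (k : ℤ) : fcoef f k = fcoef g k := by
  rw [fcoef, fcoef, ← integral_unitMeasure, ← integral_unitMeasure]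
  exact integral_congr_ae (h.mono fun x hx => by simp only [hx])

theorem fcoef_sub {f g : ℝ → ℝ} (hf : IntervalIntegrable f volume 0 1)
    (hg : IntervalIntegrable g volume 0 1) (k : ℤ) :
    fcoef (fun x => f x - g x) k = fcoef f k - fcoef g k := by
  simp only [fcoef, sub_mul]
  exact intervalIntegral.integral_sub (hf.mul_continuousOn (continuous_cas k).continuousOn)
    (hg.mul_continuousOn (continuous_cas k).continuousOn)

/-- The system `cas` is complete. -/
theorem ae_eq_zero_of_fcoef_eq_zero {f : ℝ → ℝ} (hf : MemLp f 2 unitMeasure)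
    (h : ∀ k, fcoef f k = 0) : f =ᵐ[unitMeasure] 0 := by
  have hfc : MemLp (fun x => (f x : ℂ)) 2 (volume.restrict (Ioc (0 : ℝ) 1)) := by
    rw [restrict_Ioc_eq_restrict_Icc]; exact hf.ofReal
  have hs := hasSum_sq_fourierCoeffOn zero_lt_one hfc
  have hz : ∀ n : ℤ, fourierCoeffOn zero_lt_one (fun x => (f x : ℂ)) n = 0 := by
    intro n
    rw [fourierCoeffOn_eq_integral]
    -- the complex exponentials are combinations of `cas n` and `cas (-n)`
    have e : ∀ x : ℝ, (fourier (-n) (x : AddCircle (1 - 0 : ℝ)) : ℂ) • (f x : ℂ) =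
        (1 - Complex.I) / 2 * ((f x * cas n x : ℝ) : ℂ) +
        (1 + Complex.I) / 2 * ((f x * cas (-n) x : ℝ) : ℂ) := by
      intro x
      have e1 : (fourier (-n) (x : AddCircle (1 - 0 : ℝ)) : ℂ) =
          Complex.cos (freq n * x) - Complex.sin (freq n * x) * Complex.I := by
        rw [fourier_coe_apply, show (2 * Real.pi * Complex.I * ((-n : ℤ) : ℂ) * (x : ℂ) /
          ((1 - 0 : ℝ) : ℂ)) = (-(freq n * x : ℂ)) * Complex.I by
          simp only [freq]; push_cast; ring, Complex.exp_mul_I, Complex.cos_neg, Complex.sin_neg]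
        ring
      rw [e1, smul_eq_mul]
      simp only [cas, freq_neg, neg_mul, Real.cos_neg, Real.sin_neg]
      push_cast
      ring
    simp only [e]
    rw [intervalIntegral.integral_add, intervalIntegral.integral_const_mul,
      intervalIntegral.integral_const_mul, intervalIntegral.integral_ofReal,
      intervalIntegral.integral_ofReal]
    · have h1 := h n
      have h2 := h (-n)
      simp only [fcoef] at h1 h2
      simp [h1, h2]
    · have := memLp_mul_intervalIntegrable hf (memLp_cas n)
      exact IntervalIntegrable.const_mul ⟨this.1.ofReal, this.2.ofReal⟩ _
    · have := memLp_mul_intervalIntegrable hf (memLp_cas (-n))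
      exact IntervalIntegrable.const_mul ⟨this.1.ofReal, this.2.ofReal⟩ _
  simp only [hz] at hs
  have h0 : ∫ x in (0 : ℝ)..1, f x ^ 2 = 0 := by
    have h1 : HasSum (fun _ : ℤ => ‖(0 : ℂ)‖ ^ 2) 0 := by
      simp
    simpa using hs.unique h1
  rw [← integral_unitMeasure, integral_eq_zero_iff_of_nonneg (fun x => sq_nonneg _)
    hf.integrable_sq] at h0
  filter_upwards [h0] with x hx
  simpa using hx

/-- `cas k` as an element of `L²([0,1])`. -/
def casLp (k : ℤ) : Lp ℝ 2 unitMeasure := (memLp_cas k).toLp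

theorem inner_casLp {f : ℝ → ℝ} (hf : MemLp f 2 unitMeasure) (k : ℤ) :
    inner ℝ (hf.toLp) (casLp k) = fcoef f k := by
  rw [L2.inner_def, fcoef, ← integral_unitMeasure]
  refine integral_congr_ae ?_
  filter_upwards [hf.coeFn_toLp, (memLp_cas k).coeFn_toLp] with x h1 h2
  rw [h1, casLp, h2]
  simp [mul_comm]

theorem orthonormal_casLp : Orthonormal ℝ casLp := by
  rw [orthonormal_iff_ite]
  intro j k
  rw [casLp, inner_casLp, fcoef, integral_cas_mul_cas]

/-- The Hilbert basis of `L²([0,1])` given by the functions `cas k`. -/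
def casBasis : HilbertBasis ℤ ℝ (Lp ℝ 2 unitMeasure) :=
  HilbertBasis.mkOfOrthogonalEqBot orthonormal_casLp (by
    rw [Submodule.eq_bot_iff]
    intro f hf
    have h1 : ∀ k, fcoef f k = 0 := by
      intro k
      rw [← inner_casLp (Lp.memLp f) k, Lp.toLp_coeFn]
      exact Submodule.inner_left_of_mem_orthogonal (Submodule.subset_span (mem_range_self k)) hf
    exact (Lp.eq_zero_iff_ae_eq_zero).2 (ae_eq_zero_of_fcoef_eq_zero (Lp.memLp f) h1))

theorem casBasis_apply (k : ℤ) : casBasis k = casLp k := by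
  rw [casBasis, HilbertBasis.coe_mkOfOrthogonalEqBot]

/-- Parseval's identity. -/
theorem hasSum_fcoef_mul_fcoef {f g : ℝ → ℝ} (hf : MemLp f 2 unitMeasure)
    (hg : MemLp g 2 unitMeasure) :
    HasSum (fun k => fcoef f k * fcoef g k) (∫ x in (0 : ℝ)..1, f x * g x) := by
  have := casBasis.hasSum_inner_mul_inner hf.toLp hg.toLp
  have h1 : ∀ k, inner ℝ hf.toLp (casBasis k) * inner ℝ (casBasis k) hg.toLp =
      fcoef f k * fcoef g k := fun k => by
    rw [casBasis_apply, inner_casLp, real_inner_comm, inner_casLp]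
  have h2 : inner ℝ hf.toLp hg.toLp = ∫ x in (0 : ℝ)..1, f x * g x := by
    rw [L2.inner_def, ← integral_unitMeasure]
    refine integral_congr_ae ?_
    filter_upwards [hf.coeFn_toLp, hg.coeFn_toLp] with x h1 h2
    rw [h1, h2]
    simp [mul_comm]
  simpa only [h1, h2] using this

theorem hasSum_fcoef_sq {f : ℝ → ℝ} (hf : MemLp f 2 unitMeasure) :
    HasSum (fun k => fcoef f k ^ 2) (∫ x in (0 : ℝ)..1, f x ^ 2) := by
  simpa only [← sq] using hasSum_fcoef_mul_fcoef hf hf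

theorem ae_eq_of_fcoef_eq {f g : ℝ → ℝ} (hf : MemLp f 2 unitMeasure) (hg : MemLp g 2 unitMeasure)
    (h : ∀ k, fcoef f k = fcoef g k) : f =ᵐ[unitMeasure] g := by
  have h1 := ae_eq_zero_of_fcoef_eq_zero (hf.sub hg) fun k => by
    have := fcoef_sub (memLp_intervalIntegrable hf) (memLp_intervalIntegrable hg) k
    rw [h k, sub_self] at this
    exact this
  filter_upwards [h1] with x hx
  simpa [sub_eq_zero] using hx

/-- The Riesz–Fischer theorem. -/
theorem exists_fcoef_eq {c : ℤ → ℝ} (hc : Summable fun k => c k ^ 2) :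
    ∃ y : ℝ → ℝ, MemLp y 2 unitMeasure ∧ ∀ k, fcoef y k = c k := by
  have hm : Memℓp c 2 := by
    rw [memℓp_gen_iff (by norm_num)]
    simpa using hc
  let y := casBasis.repr.symm ⟨c, hm⟩
  refine ⟨y, Lp.memLp y, fun k => ?_⟩
  rw [← inner_casLp (Lp.memLp y) k, Lp.toLp_coeFn, real_inner_comm, ← casBasis_apply,
    ← casBasis.repr_apply_apply]
  simp [y]

theorem IsPrim.fcoef_eq {f g : ℝ → ℝ} (h : IsPrim f g) (h1 : f 1 = f 0) (k : ℤ) :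
    fcoef g k = -freq k * fcoef f (-k) := by
  have h2 := (h.mul (isPrim_cas k)).integral_eq 0 1
  have h3 : cas k 1 = cas k 0 := by simpa using periodic_cas k 0
  rw [h1, h3, sub_self, intervalIntegral.integral_add] at h2
  · have h4 : ∫ x in (0 : ℝ)..1, f x * (freq k * cas (-k) x) = freq k * fcoef f (-k) := by
      rw [fcoef, ← intervalIntegral.integral_const_mul]
      congr 1; funext x; ring
    rw [h4] at h2
    rw [fcoef]; linarith
  · exact (h.intervalIntegrable 0 1).mul_continuousOn (continuous_cas k).continuousOn
  · exact (h.continuous.mul (continuous_const.mul (continuous_cas _))).intervalIntegrable _ _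

theorem PerChain.fcoef_even {n : ℕ} {d : ℕ → ℝ → ℝ} (h : PerChain (2 * n) d) (k : ℤ) :
    fcoef (d (2 * n)) k = (-freq k ^ 2) ^ n * fcoef (d 0) k := by
  induction n with
  | zero => simp
  | succ n ih =>
    have p0 : ∀ j < 2 * (n + 1), d j 1 = d j 0 := fun j hj => by simpa using h.per j hj.le 0
    rw [show 2 * (n + 1) = 2 * n + 1 + 1 by ring, (h.prim _ (by omega)).fcoef_eq (p0 _ (by omega)),
      (h.prim _ (by omega)).fcoef_eq (p0 _ (by omega)), freq_neg, neg_neg, neg_neg,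
      ih (h.mono (by omega))]
    ring

theorem exists_periodic_isPrim {y : ℝ → ℝ} (hy : LocallyIntegrable y)
    (hp : Function.Periodic y 1) (h0 : fcoef y 0 = 0) :
    ∃ Y, IsPrim Y y ∧ Function.Periodic Y 1 ∧ fcoef Y 0 = 0 := by
  have hI : IsPrim (fun x => ∫ t in (0 : ℝ)..x, y t) y := ⟨hy, fun x => by simp⟩
  set m := ∫ x in (0 : ℝ)..1, ∫ t in (0 : ℝ)..x, y t with hm
  have hY : IsPrim (fun x => (∫ t in (0 : ℝ)..x, y t) - m) y :=
    ⟨hy, fun x => by simp; ring⟩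
  refine ⟨_, hY, hY.periodic (Eventually.of_forall hp) ?_, ?_⟩
  · simp only [fcoef, cas_zero, mul_one] at h0
    simp [h0]
  · simp only [fcoef, cas_zero, mul_one]
    rw [intervalIntegral.integral_sub (hI.continuous.intervalIntegrable _ _) (by simp)]
    simp [hm]

theorem exists_perChain_of_fcoef_zero {y : ℝ → ℝ} (hy : LocallyIntegrable y)
    (hL : MemLp y 2 unitMeasure) (hp : Function.Periodic y 1) (h0 : fcoef y 0 = 0) (m : ℕ) :
    ∃ d, PerChain m d ∧ d m = y ∧ fcoef (d 0) 0 = 0 ∧ LocallyIntegrable (d 0) ∧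
      Function.Periodic (d 0) 1 := by
  induction m with
  | zero => exact ⟨fun _ => y, ⟨by simp, fun _ _ => hp, hL⟩, rfl, h0, hy, hp⟩
  | succ m ih =>
    obtain ⟨d, hd, hdm, h00, hl, hdp⟩ := ih
    obtain ⟨Y, hY, hYp, hY0⟩ := exists_periodic_isPrim hl hdp h00
    refine ⟨fun j => if j = 0 then Y else d (j - 1), ⟨fun j hj => ?_, fun j hj => ?_, ?_⟩, ?_, ?_,
      ?_, ?_⟩
    · rcases Nat.eq_zero_or_pos j with rfl | hj0
      · simpa using hY
      · obtain ⟨i, rfl⟩ : ∃ i, j = i + 1 := ⟨j - 1, by omega⟩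
        simpa using hd.prim i (by omega)
    · rcases Nat.eq_zero_or_pos j with rfl | hj0
      · simpa using hYp
      · obtain ⟨i, rfl⟩ : ∃ i, j = i + 1 := ⟨j - 1, by omega⟩
        simpa using hd.per i (by omega)
    · simpa using hd.memLp
    · simpa using hdm
    · simpa using hY0
    · simpa using hY.continuous.locallyIntegrable
    · simpa using hYp

theorem locallyIntegrable_comp_fract {y : ℝ → ℝ} (hL : IntegrableOn y (Ioc 0 1)) :
    LocallyIntegrable (fun x => y (Int.fract x)) := by
  have hper : Function.Periodic (fun x => y (Int.fract x)) 1 := fun x => by simp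
  have h1 : IntervalIntegrable (fun x => y (Int.fract x)) volume 0 (0 + 1) := by
    rw [zero_add, intervalIntegrable_iff_integrableOn_Ioo_of_le zero_le_one]
    refine (hL.mono_set Ioo_subset_Ioc_self).congr_fun (fun x hx => ?_) measurableSet_Ioo
    simp only [Int.fract_eq_self.2 ⟨hx.1.le, hx.2⟩]
  intro x
  have h2 := hper.intervalIntegrable (by norm_num) h1 (x - 1) (x + 1)
  rw [intervalIntegrable_iff_integrableOn_Icc_of_le (by linarith)] at h2
  exact ⟨Icc (x - 1) (x + 1), Icc_mem_nhds (by linarith) (by linarith), h2⟩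

theorem comp_fract_ae_eq (y : ℝ → ℝ) : (fun x => y (Int.fract x)) =ᵐ[unitMeasure] y := by
  rw [unitMeasure, ← restrict_Ico_eq_restrict_Icc]
  filter_upwards [ae_restrict_mem measurableSet_Ico] with x hx
  rw [Int.fract_eq_self.2 hx]

/-- Square summability of the coefficients of `∂^{2n} f` characterises `H^{2n}_per`. -/
theorem exists_perChain_of_fcoef {n : ℕ} (hn : 1 ≤ n) {f y : ℝ → ℝ} (hf : MemLp f 2 unitMeasure)
    (hy : MemLp y 2 unitMeasure) (h : ∀ k, fcoef y k = (-freq k ^ 2) ^ n * fcoef f k) :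
    ∃ d, PerChain (2 * n) d ∧ (d (2 * n) = fun x => y (Int.fract x)) ∧ d 0 =ᵐ[unitMeasure] f := by
  have hfr := comp_fract_ae_eq y
  have hyi : IntegrableOn y (Ioc 0 1) :=
    (intervalIntegrable_iff_integrableOn_Ioc_of_le zero_le_one).1 (memLp_intervalIntegrable hy)
  obtain ⟨d, hd, hdm, h0, -, -⟩ := exists_perChain_of_fcoef_zero
    (locallyIntegrable_comp_fract hyi) (hy.ae_eq hfr.symm) (fun x => by simp)
    (by rw [fcoef_congr hfr, h 0, freq_zero]; simp [show n ≠ 0 by omega]) (2 * n)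
  -- primitives of mean zero are taken `2n` times; the mean of `f` has to be added back
  have hd' : PerChain (2 * n) (fun j => if j = 0 then fun x => d 0 x + fcoef f 0 else d j) := by
    refine ⟨fun j hj => ?_, fun j hj => ?_, ?_⟩
    · rcases Nat.eq_zero_or_pos j with rfl | hj0
      · have := hd.prim 0 (by omega)
        simp only [if_true, zero_add, one_ne_zero, if_false]
        exact ⟨this.locInt, fun x => by rw [this.eq x]; ring⟩
      · simpa [hj0.ne'] using hd.prim j hj
    · rcases Nat.eq_zero_or_pos j with rfl | hj0
      · intro x; simp [hd.per 0 (by omega) x]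
      · simpa [hj0.ne'] using hd.per j hj
    · simpa [show n ≠ 0 by omega] using hd.memLp
  refine ⟨_, hd', by simp [show n ≠ 0 by omega, hdm], ?_⟩
  refine ae_eq_of_fcoef_eq (hd'.memLp_of_le (Nat.zero_le _)) hf fun k => ?_
  by_cases hk : k = 0
  · subst hk
    have hi := (hd.continuous (j := 0) (by omega)).intervalIntegrable (μ := volume) 0 1
    simp only [fcoef, cas_zero, mul_one, if_true] at h0 ⊢
    rw [intervalIntegral.integral_add hi (by simp), h0]
    simp
  · have h1 := hd'.fcoef_even k
    rw [if_neg (by omega), hdm, fcoef_congr hfr, h k] at h1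
    have : (-freq k ^ 2) ^ n ≠ 0 := pow_ne_zero _ (neg_ne_zero.2 (pow_ne_zero _ (freq_ne_zero hk)))
    exact (mul_left_cancel₀ this h1).symm

/-! ### Sobolev inequalities and the static lower bound -/

/-- The Cauchy–Schwarz inequality against the constant function on an interval. -/
theorem sq_integral_le {g : ℝ → ℝ} {a b : ℝ} (hab : a ≤ b) (hg : IntervalIntegrable g volume a b)
    (hg2 : IntervalIntegrable (fun x => g x ^ 2) volume a b) :
    (∫ x in a..b, g x) ^ 2 ≤ (b - a) * ∫ x in a..b, g x ^ 2 := by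
  set I := ∫ x in a..b, g x with hI
  rcases hab.eq_or_lt with rfl | hlt
  · simp [hI]
  have h1 : 0 ≤ ∫ x in a..b, ((b - a) * g x - I) ^ 2 :=
    intervalIntegral.integral_nonneg hab fun x _ => sq_nonneg _
  have h2 : ∫ x in a..b, ((b - a) * g x - I) ^ 2 =
      (b - a) ^ 2 * (∫ x in a..b, g x ^ 2) - 2 * (b - a) * I * I + (b - a) * I ^ 2 := by
    have e : ∀ x, ((b - a) * g x - I) ^ 2 =
        (b - a) ^ 2 * g x ^ 2 - 2 * (b - a) * I * g x + I ^ 2 := fun x => by ring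
    simp only [e]
    rw [intervalIntegral.integral_add ((hg2.const_mul _).sub (hg.const_mul _)) (by simp),
      intervalIntegral.integral_sub (hg2.const_mul _) (hg.const_mul _),
      intervalIntegral.integral_const_mul, intervalIntegral.integral_const_mul,
      intervalIntegral.integral_const, ← hI, smul_eq_mul]
  rw [h2] at h1
  have h3 : 0 ≤ (b - a) * ((b - a) * (∫ x in a..b, g x ^ 2) - I ^ 2) := by linarith
  have h4 := nonneg_of_mul_nonneg_right h3 (sub_pos.2 hlt)
  linarith

theorem memLp_sq_intervalIntegrable {f : ℝ → ℝ} (hf : MemLp f 2 unitMeasure) :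
    IntervalIntegrable (fun x => f x ^ 2) volume 0 1 := by
  simpa only [sq] using memLp_mul_intervalIntegrable hf hf

/-- The oscillation of a periodic function is controlled by the `L²` norm of its derivative. -/
theorem IsPrim.sq_sub_le {f g : ℝ → ℝ} (h : IsPrim f g) (hp : Function.Periodic f 1)
    (hg : MemLp g 2 unitMeasure) (x y : ℝ) : (f x - f y) ^ 2 ≤ ∫ t in (0 : ℝ)..1, g t ^ 2 := by
  have key : ∀ a b, 0 ≤ a → a ≤ b → b ≤ 1 → (f b - f a) ^ 2 ≤ ∫ t in (0 : ℝ)..1, g t ^ 2 := by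
    intro a b ha hab hb
    have hg2 := memLp_sq_intervalIntegrable hg
    have hsub : uIcc a b ⊆ uIcc 0 1 := by
      rw [uIcc_of_le hab, uIcc_of_le zero_le_one]; exact Icc_subset_Icc ha hb
    have h1 := sq_integral_le hab (h.intervalIntegrable a b) (hg2.mono_set hsub)
    rw [h.integral_eq] at h1
    have h2 : ∫ t in a..b, g t ^ 2 ≤ ∫ t in (0 : ℝ)..1, g t ^ 2 :=
      intervalIntegral.integral_mono_interval ha hab hb
        (Eventually.of_forall fun t => sq_nonneg _) hg2
    have h3 : 0 ≤ ∫ t in a..b, g t ^ 2 :=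
      intervalIntegral.integral_nonneg hab fun t _ => sq_nonneg _
    nlinarith
  have hf : ∀ z, f (Int.fract z) = f z := fun z => by
    have := hp.sub_int_mul_eq (x := z) ⌊z⌋
    rwa [mul_one] at this
  rw [← hf x, ← hf y]
  rcases le_total (Int.fract x) (Int.fract y) with h1 | h1
  · rw [← neg_sub, neg_sq]
    exact key _ _ (Int.fract_nonneg _) h1 (Int.fract_lt_one _).le
  · exact key _ _ (Int.fract_nonneg _) h1 (Int.fract_lt_one _).le

theorem exists_sq_le_integral {f : ℝ → ℝ} (hf : Continuous f) :
    ∃ y, f y ^ 2 ≤ ∫ t in (0 : ℝ)..1, f t ^ 2 := by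
  by_contra! hcon
  have h1 : ∫ t in (0 : ℝ)..1, ((∫ s in (0 : ℝ)..1, f s ^ 2) : ℝ) < ∫ t in (0 : ℝ)..1, f t ^ 2 :=
    intervalIntegral.integral_lt_integral_of_continuousOn_of_le_of_exists_lt zero_lt_one
      continuousOn_const (hf.pow 2).continuousOn (fun x _ => (hcon x).le)
      ⟨0, by simp, hcon 0⟩
  simp at h1

theorem IsPrim.abs_le {f g : ℝ → ℝ} (h : IsPrim f g) (hp : Function.Periodic f 1)
    (hg : MemLp g 2 unitMeasure) (x : ℝ) :
    |f x| ≤ √(∫ t in (0 : ℝ)..1, f t ^ 2) + √(∫ t in (0 : ℝ)..1, g t ^ 2) := by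
  obtain ⟨y, hy⟩ := exists_sq_le_integral h.continuous
  have h1 := Real.abs_le_sqrt hy
  have h2 := Real.abs_le_sqrt (h.sq_sub_le hp hg x y)
  calc |f x| = |f y + (f x - f y)| := by ring_nf
    _ ≤ _ := (abs_add_le _ _).trans (add_le_add h1 h2)

namespace PerChain

variable {m : ℕ} {d : ℕ → ℝ → ℝ}

theorem exists_zero (h : PerChain m d) {j : ℕ} (hj : j + 1 < m) :
    ∃ y, d (j + 1) y = 0 := by
  have hc := h.continuous hj
  obtain ⟨c, -, hc⟩ := exists_hasDerivAt_eq_zero (f := d j) (f' := d (j + 1)) zero_lt_one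
    (h.continuous (by omega : j < m)).continuousOn
    (by simpa using (h.per j (by omega) 0).symm)
    fun x _ => (h.prim j (by omega)).hasDerivAt hc x
  exact ⟨c, hc⟩

theorem sq_le (h : PerChain m d) {j : ℕ} (hj : j + 1 < m) (x : ℝ) :
    d (j + 1) x ^ 2 ≤ ∫ t in (0 : ℝ)..1, d (j + 2) t ^ 2 := by
  obtain ⟨y, hy⟩ := h.exists_zero hj
  have := (h.prim (j + 1) hj).sq_sub_le (h.per _ hj.le) (h.memLp_of_le (by omega)) x y
  simpa [hy] using this

theorem integral_sq_le (h : PerChain m d) {j : ℕ} (hj : j + 1 < m) :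
    ∫ t in (0 : ℝ)..1, d (j + 1) t ^ 2 ≤ ∫ t in (0 : ℝ)..1, d (j + 2) t ^ 2 := by
  have := intervalIntegral.integral_mono_on zero_le_one
    (((h.continuous hj).pow 2).intervalIntegrable (μ := volume) 0 1)
    (by simp : IntervalIntegrable (fun _ : ℝ => ∫ t in (0 : ℝ)..1, d (j + 2) t ^ 2) volume 0 1)
    fun x _ => h.sq_le hj x
  simpa using this

theorem integral_sq_period (h : PerChain m d) {j : ℕ} (hj : j ≤ m) (a : ℝ) :
    ∫ t in a..(a + 1), d j t ^ 2 = ∫ t in (0 : ℝ)..1, d j t ^ 2 := by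
  have hp : Function.Periodic (fun t => d j t ^ 2) 1 := fun t => by simp [h.per j hj t]
  simpa using hp.intervalIntegral_add_eq a 0

theorem sq_intervalIntegrable (h : PerChain m d) {j : ℕ} (hj : j ≤ m) (a b : ℝ) :
    IntervalIntegrable (fun t => d j t ^ 2) volume a b := by
  have hp : Function.Periodic (fun t => d j t ^ 2) 1 := fun t => by simp [h.per j hj t]
  exact hp.intervalIntegrable₀ (by norm_num)
    (memLp_sq_intervalIntegrable (h.memLp_of_le hj)) a b

/-- The growth of a function away from a critical point is of order `3/2`, with a constant given by
the `L²` norm of the second derivative. -/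
theorem sub_le_of_critical {E : ℝ} (h : PerChain 2 d) (hE : ∫ t in (0 : ℝ)..1, d 2 t ^ 2 ≤ E)
    {h₀ : ℝ} (hcr : d 1 h₀ = 0) {x : ℝ} (hx : |x - h₀| ≤ 1) :
    d 0 x - d 0 h₀ ≤ 2 / 3 * √E * (|x - h₀| * √|x - h₀|) := by
  have p0 := h.prim 0 (by norm_num)
  have p1 := h.prim 1 (by norm_num)
  have hroot : ∀ a : ℝ, 0 ≤ a → ∫ s in (0 : ℝ)..a, √s = 2 / 3 * (a * √a) := by
    intro a ha
    simp only [Real.sqrt_eq_rpow]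
    rw [integral_rpow (Or.inl (by norm_num)), Real.zero_rpow (by norm_num),
      show (1 / 2 + 1 : ℝ) = 1 + 1 / 2 by norm_num,
      Real.rpow_add_of_nonneg ha (by norm_num) (by norm_num), Real.rpow_one]
    ring
  have hcs : ∀ a b, a ≤ b → b ≤ a + 1 → |∫ t in a..b, d 2 t| ≤ √E * √(b - a) := by
    intro a b hab hb
    have h2 := sq_integral_le hab (p1.intervalIntegrable a b) (h.sq_intervalIntegrable le_rfl a b)
    have h3 : ∫ t in a..b, d 2 t ^ 2 ≤ E := by
      refine le_trans ?_ ((h.integral_sq_period le_rfl a).le.trans hE)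
      exact intervalIntegral.integral_mono_interval le_rfl hab hb
        (Eventually.of_forall fun t => sq_nonneg _) (h.sq_intervalIntegrable le_rfl _ _)
    have hE0 : 0 ≤ E := (intervalIntegral.integral_nonneg hab fun t _ => sq_nonneg _).trans h3
    rw [← Real.sqrt_mul hE0]
    refine Real.abs_le_sqrt (h2.trans ?_)
    rw [mul_comm E]
    exact mul_le_mul_of_nonneg_left h3 (by linarith)
  rcases le_total h₀ x with hle | hle
  · rw [abs_of_nonneg (by linarith)] at hx ⊢
    rw [← p0.integral_eq h₀ x]
    have h1 : ∀ s ∈ Icc h₀ x, d 1 s ≤ √E * √(s - h₀) := by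
      intro s hs
      have := (le_abs_self _).trans (hcs h₀ s hs.1 (by linarith [hs.2]))
      rwa [p1.integral_eq, hcr, sub_zero] at this
    have hc1 : Continuous fun s : ℝ => √E * √(s - h₀) := by fun_prop
    have h2 := intervalIntegral.integral_mono_on hle (p0.intervalIntegrable h₀ x)
      (hc1.intervalIntegrable _ _) h1
    rw [intervalIntegral.integral_const_mul,
      intervalIntegral.integral_comp_sub_right (fun s => √s), sub_self,
      hroot _ (by linarith)] at h2
    exact h2.trans (le_of_eq (by ring))
  · rw [abs_sub_comm, abs_of_nonneg (by linarith)] at hx ⊢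
    have h1 : ∀ s ∈ Icc x h₀, -d 1 s ≤ √E * √(h₀ - s) := by
      intro s hs
      have := (le_abs_self _).trans (hcs s h₀ hs.2 (by linarith [hs.1]))
      rwa [p1.integral_eq, hcr, zero_sub] at this
    have hc1 : Continuous fun s : ℝ => √E * √(h₀ - s) := by fun_prop
    have h2 := intervalIntegral.integral_mono_on hle (p0.intervalIntegrable x h₀).neg
      (hc1.intervalIntegrable _ _) h1
    have h3 : ∫ u in x..h₀, (-d (0 + 1)) u = -(d 0 h₀ - d 0 x) := by
      rw [← p0.integral_eq, ← intervalIntegral.integral_neg]; rfl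
    rw [h3, intervalIntegral.integral_const_mul,
      intervalIntegral.integral_comp_sub_left (fun s => √s), sub_self,
      hroot _ (by linarith)] at h2
    linarith

end PerChain

/-- The elementary core of the lower bound: the radius `r = 1/2` serves for
`E < 8/L²`, and `r = 4/(EL²)` beyond. -/
theorem lowerJ_le_of_forall {L E m : ℝ} (hL : 0 < L) (hE : 0 ≤ E)
    (h : ∀ r, 0 < r → r ≤ 1 / 2 → 2 * r ≤ L * (m + 2 / 3 * √E * (r * √r))) : lowerJ L E ≤ m := by
  have hs2 : √(2 : ℝ) ^ 2 = 2 := Real.sq_sqrt (by norm_num)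
  have hs20 : 0 < √(2 : ℝ) := by positivity
  have hsE : √E ^ 2 = E := Real.sq_sqrt hE
  have hsE0 : 0 ≤ √E := Real.sqrt_nonneg E
  have hhalf : 1 / L - √E / (3 * √2) ≤ m := by
    have h1 := h (1 / 2) (by norm_num) le_rfl
    have h2 : √(1 / 2 : ℝ) = 1 / √2 := by rw [Real.sqrt_div zero_le_one, Real.sqrt_one]
    rw [h2] at h1
    have h3 : 2 / 3 * √E * (1 / 2 * (1 / √2)) = √E / (3 * √2) := by field_simp
    rw [h3] at h1
    have h4 : 1 / L ≤ m + √E / (3 * √2) := by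
      rw [div_le_iff₀ hL]; linarith
    linarith
  unfold lowerJ
  split_ifs with hcase
  · have hEpos : 0 < E := lt_of_lt_of_le (by positivity) hcase
    have hsEpos : 0 < √E := Real.sqrt_pos.2 hEpos
    rcases le_or_gt (8 / L ^ 2) E with h8 | h8
    · have hr : 4 / (E * L ^ 2) ≤ 1 / 2 := by
        rw [div_le_iff₀ (by positivity)] at h8 ⊢
        linarith
      have h1 := h (4 / (E * L ^ 2)) (by positivity) hr
      have h2 : √(4 / (E * L ^ 2)) = 2 / (√E * L) := by
        rw [Real.sqrt_eq_iff_mul_self_eq (by positivity) (by positivity)]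
        have h3 : 2 / (√E * L) * (2 / (√E * L)) = 4 / (√E ^ 2 * L ^ 2) := by field_simp; norm_num
        rw [h3, hsE]
      rw [h2] at h1
      have h3 : 2 / 3 * √E * (4 / (E * L ^ 2) * (2 / (√E * L))) = 16 / (3 * (E * L ^ 3)) := by
        field_simp; norm_num
      rw [h3] at h1
      have h4 : L * (8 / (3 * (E * L ^ 3)) - m) ≤ 0 := by
        have : L * (8 / (3 * (E * L ^ 3))) = 2 * (4 / (E * L ^ 2)) - L * (16 / (3 * (E * L ^ 3))) := by
          field_simp; norm_num
        nlinarith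
      have h5 : 8 / (3 * (E * L ^ 3)) ≤ m := by
        by_contra hcon
        exact absurd (mul_pos hL (sub_pos.2 (not_le.1 hcon))) (not_lt.2 h4)
      refine le_trans ?_ h5
      rw [div_le_div_iff₀ (by positivity) (by positivity)]
      have : 0 < E * L ^ 3 := by positivity
      nlinarith
    · have h1 : √E ≤ 2 * √2 / L := by
        rw [Real.sqrt_le_left (by positivity)]
        rw [div_pow, mul_pow, hs2]
        linarith
      have h2 : √E / (3 * √2) ≤ 2 / (3 * L) := by
        rw [div_le_div_iff₀ (by positivity) (by positivity)]
        rw [le_div_iff₀ hL] at h1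
        nlinarith
      have h3 : 1 / (3 * L ^ 3 * E) ≤ 1 / (6 * L) := by
        apply one_div_le_one_div_of_le (by positivity)
        rw [div_le_iff₀ (by positivity)] at hcase
        nlinarith
      have h4 : 1 / (6 * L) = 1 / L - 5 / (6 * L) := by field_simp; norm_num
      have h5 : 2 / (3 * L) = 4 / (6 * L) := by field_simp; norm_num
      have h6 : 4 / (6 * L) ≤ 5 / (6 * L) := by gcongr; norm_num
      linarith
  · have : 1 / (2 * L) ≤ 1 / L := one_div_le_one_div_of_le hL (by linarith)
    linarith

/-- The lower bound for a positive periodic function `q` that grows away from the minimum point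
`h₀` of `d 0` no faster than `d 0` does. Within distance `r` of `h₀` it is at most
`m + 2/3 √E r^{3/2}`, which bounds its reciprocal, and so `L`, from below. -/
theorem lowerJ_le {d : ℕ → ℝ → ℝ} (hd : PerChain 2 d) {L E m h₀ : ℝ} {q : ℝ → ℝ} (hL : 0 < L)
    (hE : ∫ t in (0 : ℝ)..1, d 2 t ^ 2 ≤ E) (hmin : ∀ x, d 0 h₀ ≤ d 0 x) (hq : ∀ x, 0 < q x)
    (hqp : Function.Periodic q 1) (hqc : Continuous q)
    (hqL : ∫ x in (0 : ℝ)..1, (q x)⁻¹ ≤ L) (hqm : ∀ x, q x ≤ m + (d 0 x - d 0 h₀)) :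
    lowerJ L E ≤ m := by
  have hE0 : 0 ≤ E := le_trans (intervalIntegral.integral_nonneg zero_le_one
    fun t _ => sq_nonneg _) hE
  have hcr : d 1 h₀ = 0 := by
    have h1 := (hd.prim 0 (by norm_num)).hasDerivAt (hd.continuous (j := 1) (by norm_num)) h₀
    exact IsLocalMin.hasDerivAt_eq_zero (Eventually.of_forall hmin) h1
  have hm : 0 < m := by
    have := hqm h₀
    rw [sub_self, add_zero] at this
    exact (hq h₀).trans_le this
  refine lowerJ_le_of_forall hL hE0 fun r hr hr2 => ?_
  set A := m + 2 / 3 * √E * (r * √r) with hA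
  have hA0 : 0 < A := by positivity
  have hic : Continuous fun x => (q x)⁻¹ := hqc.inv₀ fun x => (hq x).ne'
  have hip : Function.Periodic (fun x => (q x)⁻¹) 1 := fun x => by simp [hqp x]
  have h1 : ∫ x in (h₀ - r)..(h₀ + r), (q x)⁻¹ ≤ ∫ x in (h₀ - r)..(h₀ - r + 1), (q x)⁻¹ :=
    intervalIntegral.integral_mono_interval le_rfl (by linarith) (by linarith)
      (Eventually.of_forall fun x => (inv_pos.2 (hq x)).le) (hic.intervalIntegrable _ _)
  rw [hip.intervalIntegral_add_eq (h₀ - r) 0, zero_add] at h1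
  have h2 : ∫ x in (h₀ - r)..(h₀ + r), A⁻¹ ≤ ∫ x in (h₀ - r)..(h₀ + r), (q x)⁻¹ := by
    refine intervalIntegral.integral_mono_on (by linarith) (by simp)
      (hic.intervalIntegrable _ _) fun x hx => ?_
    refine inv_anti₀ (hq x) ((hqm x).trans ?_)
    have hxr : |x - h₀| ≤ r := abs_le.2 ⟨by linarith [hx.1], by linarith [hx.2]⟩
    have h3 := hd.sub_le_of_critical hE hcr (x := x) (by linarith)
    have h4 : |x - h₀| * √|x - h₀| ≤ r * √r :=
      mul_le_mul hxr (Real.sqrt_le_sqrt hxr) (Real.sqrt_nonneg _) hr.le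
    have h5 : 2 / 3 * √E * (|x - h₀| * √|x - h₀|) ≤ 2 / 3 * √E * (r * √r) :=
      mul_le_mul_of_nonneg_left h4 (by positivity)
    linarith
  rw [intervalIntegral.integral_const, smul_eq_mul] at h2
  have h3 : (h₀ + r - (h₀ - r)) * A⁻¹ ≤ L := h2.trans (h1.trans hqL)
  rw [← div_eq_mul_inv, div_le_iff₀ hA0] at h3
  linarith

theorem lowerInit_pos {L E : ℝ} (hL : 0 < L) (hE : 0 ≤ E) : 0 < lowerInit L E := by
  unfold lowerInit
  split_ifs with h
  · positivity
  · have : 0 < E := lt_of_le_of_ne hE (Ne.symm h)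
    exact lt_min (by positivity) (by positivity)

theorem sixth_le_of_lt {L E : ℝ} (hL : 0 < L) (h : E < 2 / L ^ 2) :
    1 / (6 * L) ≤ 1 / (2 * L) - √E / (3 * √2) := by
  have hs2 : √(2 : ℝ) ^ 2 = 2 := Real.sq_sqrt (by norm_num)
  have h1 : √E ≤ √2 / L := by
    rw [Real.sqrt_le_left (by positivity), div_pow, hs2]
    exact h.le
  have h2 : √E / (3 * √2) ≤ 1 / (3 * L) := by
    rw [div_le_div_iff₀ (by positivity) (by positivity)]
    rw [le_div_iff₀ hL] at h1
    nlinarith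
  have h3 : 1 / (6 * L) = 1 / (2 * L) - 1 / (3 * L) := by field_simp; norm_num
  linarith

theorem lowerInit_le_lowerJ {L E E₀ : ℝ} (hL : 0 < L) (h : E ≤ E₀) :
    lowerInit L E₀ ≤ lowerJ L E := by
  unfold lowerJ
  split_ifs with hc
  · have hEp : 0 < E := lt_of_lt_of_le (by positivity) hc
    rw [lowerInit, if_neg (by linarith)]
    refine (min_le_left _ _).trans ?_
    apply one_div_le_one_div_of_le (by positivity)
    gcongr
  · refine le_trans ?_ (sixth_le_of_lt hL (not_le.1 hc))
    unfold lowerInit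
    split_ifs
    · exact le_rfl
    · exact min_le_right _ _

theorem lowerMin_le_lowerJ {L E : ℝ} (hL : 0 < L) : lowerMin L E ≤ lowerJ L E := by
  unfold lowerJ lowerMin
  split_ifs with h1 h2 h2
  · rw [h1] at h2
    exact absurd h2 (not_le.2 (by positivity))
  · exact le_rfl
  · exact min_le_left _ _
  · exact min_le_right _ _

/-! ### An abstract evolution problem in Hilbert space -/

section Hilbert

variable {X : Type*} [NormedAddCommGroup X] [InnerProductSpace ℝ X] {ι : Type*}

theorem norm_sq_sum_of_orthogonal {y : ι → X} (h : ∀ i j, i ≠ j → inner ℝ (y i) (y j) = 0)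
    (t : Finset ι) : ‖∑ i ∈ t, y i‖ ^ 2 = ∑ i ∈ t, ‖y i‖ ^ 2 := by
  classical
  rw [← real_inner_self_eq_norm_sq, sum_inner]
  refine Finset.sum_congr rfl fun i hi => ?_
  rw [inner_sum, Finset.sum_eq_single i (fun j _ hj => h i j hj.symm) (fun h' => absurd hi h'),
    real_inner_self_eq_norm_sq]

theorem summable_of_orthogonal [CompleteSpace X] {y : ι → X}
    (h : ∀ i j, i ≠ j → inner ℝ (y i) (y j) = 0) (hs : Summable fun i => ‖y i‖ ^ 2) :
    Summable y := by
  rw [summable_iff_vanishing_norm] at hs ⊢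
  intro ε hε
  obtain ⟨s, hs⟩ := hs (ε ^ 2) (by positivity)
  refine ⟨s, fun t ht => ?_⟩
  have h1 := hs t ht
  rw [← norm_sq_sum_of_orthogonal h, Real.norm_of_nonneg (sq_nonneg _)] at h1
  exact lt_of_pow_lt_pow_left₀ 2 hε.le h1

theorem norm_sq_le_of_hasSum_orthogonal {y : ι → X} {x : X} {K : ℝ}
    (h : ∀ i j, i ≠ j → inner ℝ (y i) (y j) = 0) (hx : HasSum y x)
    (hK : ∀ t : Finset ι, ∑ i ∈ t, ‖y i‖ ^ 2 ≤ K) : ‖x‖ ^ 2 ≤ K := by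
  refine le_of_tendsto ((hx.norm).pow 2) (Eventually.of_forall fun t => ?_)
  rw [norm_sq_sum_of_orthogonal h]
  exact hK t

/-- The image of a closed ball under a bounded operator between Hilbert spaces is closed, in
sequential form. This rests on the weak compactness of balls. -/
theorem exists_eq_of_tendsto_of_norm_le [CompleteSpace X] (J : X →L[ℝ] X) {R : ℝ} {x : ℕ → X}
    {y : X} (hx : ∀ n, ‖x n‖ ≤ R) (hy : Tendsto (fun n => J (x n)) atTop (𝓝 y)) :
    ∃ η, J η = y := by
  let D := InnerProductSpace.toDual ℝ X
  let ℓ : ℕ → WeakDual ℝ X := fun n => StrongDual.toWeakDual (D (x n))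
  have hc := WeakDual.isCompact_closedBall (𝕜 := ℝ) (E := X) 0 R
  have hmem : ∀ n, ℓ n ∈ WeakDual.toStrongDual ⁻¹' Metric.closedBall (0 : StrongDual ℝ X) R := by
    intro n
    rw [mem_preimage, mem_closedBall_zero_iff]
    change ‖D (x n)‖ ≤ R
    rw [LinearIsometryEquiv.norm_map]
    exact hx n
  let U : Ultrafilter ℕ := Ultrafilter.of atTop
  have hU : (U : Filter ℕ) ≤ atTop := Ultrafilter.of_le atTop
  obtain ⟨l, -, hl⟩ := isCompact_iff_ultrafilter_le_nhds.1 hc (U.map ℓ) (by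
    rw [Ultrafilter.coe_map, le_principal_iff, mem_map]
    exact univ_mem' hmem)
  have hl' : Tendsto ℓ U (𝓝 l) := hl
  let L : StrongDual ℝ X := WeakDual.toStrongDual l
  refine ⟨D.symm L, ?_⟩
  refine ext_inner_right ℝ fun ψ => ?_
  have h1 : Tendsto (fun n => inner ℝ (J (x n)) ψ) U (𝓝 (inner ℝ y ψ)) :=
    ((hy.mono_left hU).inner tendsto_const_nhds)
  have h2 : Tendsto (fun n => ℓ n (ContinuousLinearMap.adjoint J ψ)) U
      (𝓝 (l (ContinuousLinearMap.adjoint J ψ))) :=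
    ((WeakDual.eval_continuous _).tendsto l).comp hl'
  have h3 : ∀ n, ℓ n (ContinuousLinearMap.adjoint J ψ) = inner ℝ (J (x n)) ψ := by
    intro n
    change D (x n) (ContinuousLinearMap.adjoint J ψ) = _
    rw [InnerProductSpace.toDual_apply_apply, ContinuousLinearMap.adjoint_inner_right]
  simp only [h3] at h2
  rw [← ContinuousLinearMap.adjoint_inner_right, InnerProductSpace.toDual_symm_apply]
  exact tendsto_nhds_unique h2 h1

/-- For an accretive bounded operator `J` the resolvent `(1 + aJ)⁻¹`, `a ≥ 0`, exists. -/
theorem exists_resolvent [CompleteSpace X] {J : X →L[ℝ] X} (hJ : ∀ x, 0 ≤ inner ℝ (J x) x) {a : ℝ}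
    (ha : 0 ≤ a) : ∃ R : X →L[ℝ] X, (∀ x, R x + a • J (R x) = x) ∧ ∀ x, R (x + a • J x) = x := by
  have hu : IsUnit (1 + a • J) := by
    refine ContinuousLinearMap.isUnit_of_forall_le_norm_inner_map _ (c := 1) one_pos fun x => ?_
    have h1 : inner ℝ ((1 + a • J) x) x = ‖x‖ ^ 2 + a * inner ℝ (J x) x := by
      simp [inner_add_left, inner_smul_left]
    rw [h1]
    have := mul_nonneg ha (hJ x)
    rw [Real.norm_of_nonneg (by positivity)]
    simpa using this
  obtain ⟨u, hu⟩ := hu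
  refine ⟨(u⁻¹ : (X →L[ℝ] X)ˣ), fun x => ?_, fun x => ?_⟩
  · have h := congrArg (fun A : X →L[ℝ] X => A x) u.mul_inv
    simp only [hu] at h
    simpa using h
  · have h := congrArg (fun A : X →L[ℝ] X => A x) u.inv_mul
    simp only [hu] at h
    simpa using h

theorem norm_le_of_accretive {J : X →L[ℝ] X} (hJ : ∀ x, 0 ≤ inner ℝ (J x) x) {a : ℝ} (ha : 0 ≤ a)
    (z : X) : ‖a • J z‖ ≤ ‖z + a • J z‖ := by
  have h1 : ‖z + a • J z‖ ^ 2 = ‖z‖ ^ 2 + 2 * (a * inner ℝ (J z) z) + ‖a • J z‖ ^ 2 := by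
    rw [norm_add_sq_real, inner_smul_right, real_inner_comm]
  have h2 := mul_nonneg ha (hJ z)
  refine (pow_le_pow_iff_left₀ (norm_nonneg _) (norm_nonneg _) two_ne_zero).1 ?_
  rw [h1]
  nlinarith [sq_nonneg ‖z‖]

theorem eq_of_resolvent {J : X →L[ℝ] X} (hJ : ∀ x, 0 ≤ inner ℝ (J x) x) {a : ℝ} (ha : 0 ≤ a)
    {x y : X} (h : x + a • J x = y + a • J y) : x = y := by
  have h1 : (x - y) + a • J (x - y) = 0 := by
    rw [map_sub, smul_sub]
    have := sub_eq_zero.2 h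
    rw [← this]; abel
  have h2 := norm_le_of_accretive hJ ha (x - y)
  rw [h1, norm_zero, norm_le_zero_iff] at h2
  rw [h2, add_zero] at h1
  exact sub_eq_zero.1 h1

/-- A family of mutually orthogonal projections commuting with the operator `J`. -/
structure ModeSystem (J : X →L[ℝ] X) (P : ι → X →L[ℝ] X) : Prop where
  accretive : ∀ x, 0 ≤ inner ℝ (J x) x
  symm : ∀ i x y, inner ℝ (P i x) y = inner ℝ x (P i y)
  idem : ∀ i x, P i (P i x) = P i x
  zero : ∀ i j x, i ≠ j → P i (P j x) = 0
  comm : ∀ i x, P i (J x) = J (P i x)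

theorem ModeSystem.orth {J : X →L[ℝ] X} {P : ι → X →L[ℝ] X} (h : ModeSystem J P) (i j : ι) (x y : X)
    (hij : i ≠ j) : inner ℝ (P i x) (P j y) = 0 := by
  rw [h.symm, h.zero i j y hij, inner_zero_right]

theorem ModeSystem.bessel {J : X →L[ℝ] X} {P : ι → X →L[ℝ] X} (h : ModeSystem J P) (x : X)
    (t : Finset ι) : ∑ i ∈ t, ‖P i x‖ ^ 2 ≤ ‖x‖ ^ 2 := by
  have h1 : inner ℝ x (∑ i ∈ t, P i x) = ∑ i ∈ t, ‖P i x‖ ^ 2 := by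
    rw [inner_sum]
    refine Finset.sum_congr rfl fun i _ => ?_
    rw [← real_inner_self_eq_norm_sq, h.symm, h.idem]
  have h2 := norm_sub_sq_real x (∑ i ∈ t, P i x)
  rw [h1, norm_sq_sum_of_orthogonal fun i j hij => h.orth i j x x hij] at h2
  nlinarith [sq_nonneg ‖x - ∑ i ∈ t, P i x‖]

/-- The solution operator `S` of the linear problem `z + Cμᵢ J z = μᵢ J x` in the `i`-th mode. By the
accretivity of `J` it satisfies the maximal regularity bound `C‖S x‖ ≤ ‖x‖`, uniformly in `μ`. -/
theorem ModeSystem.exists_solution_operator [CompleteSpace X] {J : X →L[ℝ] X} {P : ι → X →L[ℝ] X}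
    (h : ModeSystem J P) {C : ℝ} (hC : 0 < C) {μ : ι → ℝ} (hμ : ∀ i, 0 ≤ μ i) :
    ∃ S : X →L[ℝ] X, (∀ x, ‖S x‖ ≤ C⁻¹ * ‖x‖) ∧ (∀ x, S (J x) = J (S x)) ∧
      (∀ i x, P i (S x) + (C * μ i) • J (P i (S x)) = μ i • J (P i x)) ∧
      ∀ x (s : ι → X), (∀ i, s i + (C * μ i) • J (s i) = μ i • J (P i x)) → HasSum s (S x) := by
  have ha : ∀ i, 0 ≤ C * μ i := fun i => mul_nonneg hC.le (hμ i)
  choose R hR1 hR2 using fun i => exists_resolvent h.accretive (ha i)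
  -- the `i`-th mode of the solution
  let y : X → ι → X := fun x i => μ i • J (R i (P i x))
  have hJR : ∀ i x, J (R i x) = R i (J x) := fun i x => by
    conv_rhs => rw [← hR1 i x, map_add, map_smul, hR2]
  have hPR : ∀ j i x, P j (R i x) = R i (P j x) := fun j i x => by
    conv_rhs => rw [← hR1 i x, map_add, map_smul, h.comm, hR2]
  have hy : ∀ x i, y x i + (C * μ i) • J (y x i) = μ i • J (P i x) := by
    intro x i
    have := congrArg (fun z => μ i • J z) (hR1 i (P i x))
    simp only [map_add, map_smul, smul_add] at this
    simp only [y, map_smul]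
    rw [← this, smul_comm]
  have hPy : ∀ x i, P i (y x i) = y x i := fun x i => by
    simp only [y, map_smul, h.comm, hPR, h.idem]
  have hPy0 : ∀ x i j, j ≠ i → P j (y x i) = 0 := fun x i j hij => by
    simp only [y, map_smul, h.comm, hPR, h.zero j i _ hij, map_zero, smul_zero]
  have horth : ∀ x i j, i ≠ j → inner ℝ (y x i) (y x j) = 0 := fun x i j hij => by
    rw [← hPy x i, ← hPy x j]; exact h.orth i j _ _ hij
  have hnorm : ∀ x i, ‖y x i‖ ≤ C⁻¹ * ‖P i x‖ := by
    intro x i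
    have h1 := norm_le_of_accretive h.accretive (ha i) (R i (P i x))
    rw [hR1, mul_smul, norm_smul, Real.norm_of_nonneg hC.le] at h1
    rw [inv_mul_eq_div, le_div_iff₀ hC, mul_comm]
    exact h1
  have hsq : ∀ x i, ‖y x i‖ ^ 2 ≤ C⁻¹ ^ 2 * ‖P i x‖ ^ 2 := fun x i => by
    rw [← mul_pow]
    exact pow_le_pow_left₀ (norm_nonneg _) (hnorm x i) 2
  have hfin : ∀ x, ∀ t : Finset ι, ∑ i ∈ t, ‖y x i‖ ^ 2 ≤ (C⁻¹ * ‖x‖) ^ 2 := fun x t => by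
    refine (Finset.sum_le_sum fun i _ => hsq x i).trans ?_
    rw [← Finset.mul_sum, mul_pow]
    exact mul_le_mul_of_nonneg_left (h.bessel x t) (by positivity)
  have hsum : ∀ x, Summable (y x) := fun x => summable_of_orthogonal (horth x)
    (summable_of_sum_le (fun i => by positivity) (hfin x))
  let S₀ : X →ₗ[ℝ] X :=
    { toFun := fun x => ∑' i, y x i
      map_add' := fun a b => by
        rw [← (hsum a).tsum_add (hsum b)]
        congr 1; funext i; simp [y]
      map_smul' := fun c a => by
        rw [RingHom.id_apply, ← (hsum a).tsum_const_smul]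
        congr 1; funext i; simp only [y, map_smul, smul_comm (μ i) c] }
  have hS₀ : ∀ x, ‖S₀ x‖ ≤ C⁻¹ * ‖x‖ := fun x =>
    (pow_le_pow_iff_left₀ (norm_nonneg _) (by positivity) two_ne_zero).1
      (norm_sq_le_of_hasSum_orthogonal (horth x) (hsum x).hasSum (hfin x))
  let S := S₀.mkContinuous C⁻¹ hS₀
  have hS : ∀ x, HasSum (y x) (S x) := fun x => (hsum x).hasSum
  have hPS : ∀ i x, P i (S x) = y x i := by
    classical
    intro i x
    have h1 := (hS x).mapL (P i)
    refine h1.unique ?_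
    have h2 : (fun j => P i (y x j)) = fun j => if j = i then y x i else 0 := by
      funext j
      split_ifs with hj
      · rw [hj, hPy]
      · exact hPy0 x j i (Ne.symm hj)
    rw [h2]
    exact hasSum_ite_eq i _
  refine ⟨S, hS₀, fun x => ?_, fun i x => ?_, fun x s hs => ?_⟩
  · have h1 := (hS x).mapL J
    refine (hS (J x)).unique ?_
    convert h1 using 2 with i
    simp only [y, map_smul, h.comm, hJR]
  · rw [hPS]; exact hy x i
  · have : s = y x := funext fun i => eq_of_resolvent h.accretive (ha i)
      ((hs i).trans (hy x i).symm)
    rw [this]; exact hS x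

/-- Abstract solvability: for a nonlinearity `N` with Lipschitz constant `κ < C` that preserves the
form "constant plus `J`-primitive", the equation `Pᵢ η = μᵢ Pᵢ (N (J η) - C J η)` has a solution,
provided the solution `∑ aᵢ` of the linear problem with the datum `N 0` exists. The function `J η` is
the fixed point of the contraction `S ∘ N`; the hypothesis on `N` keeps the iterates in the image under
`J` of a ball, so that the limit lies in the range of `J`. -/
theorem ModeSystem.exists_solution [CompleteSpace X] {J : X →L[ℝ] X} {P : ι → X →L[ℝ] X}
    (h : ModeSystem J P) (hinj : Function.Injective J) {C κ : ℝ} (hκ : 0 ≤ κ) (hκC : κ < C)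
    {μ : ι → ℝ} (hμ : ∀ i, 0 ≤ μ i) {N : X → X} (hN : ∀ x y, ‖N x - N y‖ ≤ κ * ‖x - y‖)
    (hNJ : ∀ η, ∃ γ, ‖γ‖ ≤ κ * ‖η‖ ∧ N (J η) = N 0 + J γ) {a : ι → X}
    (ha : ∀ i, a i + (C * μ i) • J (a i) = μ i • P i (N 0))
    (haorth : ∀ i j, i ≠ j → inner ℝ (a i) (a j) = 0) (hasum : Summable fun i => ‖a i‖ ^ 2) :
    ∃ η, ∀ i, P i η = μ i • P i (N (J η) - C • J η) := by
  have hC : 0 < C := hκ.trans_lt hκC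
  obtain ⟨S, hS1, hS2, hS3, hS4⟩ := h.exists_solution_operator hC hμ
  have hasum' := summable_of_orthogonal haorth hasum
  set A := ∑' i, a i with hA
  have hSA : S (N 0) = J A := by
    have h1 := hS4 (N 0) (fun i => J (a i)) fun i => by
      rw [← map_smul, ← map_add, ha, map_smul]
    exact h1.unique (hasum'.hasSum.mapL J)
  have hq : C⁻¹ * κ < 1 := by rw [inv_mul_eq_div, div_lt_one hC]; exact hκC
  have hq0 : 0 ≤ C⁻¹ * κ := by positivity
  let T : X → X := fun x => S (N x)
  have hT : ContractingWith (C⁻¹ * κ).toNNReal T := by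
    refine ⟨by rwa [Real.toNNReal_lt_one], LipschitzWith.of_dist_le_mul fun x y => ?_⟩
    rw [dist_eq_norm, dist_eq_norm, ← map_sub, Real.coe_toNNReal _ hq0]
    refine (hS1 _).trans ?_
    rw [mul_assoc]
    exact mul_le_mul_of_nonneg_left (hN x y) (by positivity)
  have : Nonempty X := ⟨0⟩
  -- `R` is the radius of the ball that `γ ↦ A + S γ` maps into itself when `‖γ‖ ≤ κ R`
  set R := ‖A‖ / (1 - C⁻¹ * κ) with hR
  have hR' : ‖A‖ + C⁻¹ * κ * R = R := by
    have h1 : R * (1 - C⁻¹ * κ) = ‖A‖ := div_mul_cancel₀ _ (by linarith)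
    linarith
  have hR0 : 0 ≤ R := div_nonneg (norm_nonneg _) (by linarith)
  have hiter : ∀ n, ∃ η, ‖η‖ ≤ R ∧ T^[n] 0 = J η := by
    intro n
    induction n with
    | zero => exact ⟨0, by simpa using hR0, by simp⟩
    | succ n ih =>
      obtain ⟨η, hη, hn⟩ := ih
      obtain ⟨γ, hγ, hNγ⟩ := hNJ η
      refine ⟨A + S γ, ?_, ?_⟩
      · refine (norm_add_le _ _).trans ?_
        rw [← hR', mul_assoc]
        refine add_le_add le_rfl ((hS1 γ).trans ?_)
        exact mul_le_mul_of_nonneg_left (hγ.trans (mul_le_mul_of_nonneg_left hη hκ))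
          (by positivity)
      · rw [Function.iterate_succ_apply', hn]
        simp only [T]
        rw [hNγ, map_add, hSA, hS2, map_add]
  choose η hηR hη using hiter
  have hlim := hT.tendsto_iterate_fixedPoint 0
  have hfix : T hT.fixedPoint = hT.fixedPoint := hT.fixedPoint_isFixedPt
  set x := hT.fixedPoint with hx
  simp only [hη] at hlim
  obtain ⟨η', hη'⟩ := exists_eq_of_tendsto_of_norm_le J hηR hlim
  refine ⟨η', fun i => hinj ?_⟩
  have h1 := hS3 i (N x)
  have h2 : S (N x) = x := hfix
  rw [h2] at h1
  rw [← h.comm, hη', map_smul, map_sub, map_smul, map_sub, map_smul, smul_sub, smul_smul,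
    mul_comm (μ i) C, ← h1]
  abel

end Hilbert

/-! ### Time integration and Fourier modes on the cylinder -/

theorem sq_lintegral_le {α : Type*} [MeasurableSpace α] {μ : Measure α} {g : α → ℝ≥0∞}
    (hg : AEMeasurable g μ) : (∫⁻ x, g x ∂μ) ^ 2 ≤ μ univ * ∫⁻ x, g x ^ 2 ∂μ := by
  have h := ENNReal.lintegral_mul_le_Lp_mul_Lq μ Real.HolderConjugate.two_two
    (aemeasurable_const (b := (1 : ℝ≥0∞))) hg
  have e : ∀ x : ℝ≥0∞, (x ^ (1 / 2 : ℝ)) ^ 2 = x := fun x => by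
    rw [← ENNReal.rpow_natCast, ← ENNReal.rpow_mul]; simp
  have h2 := pow_le_pow_left₀ zero_le h 2
  simpa [mul_pow, ← one_div, e] using h2

theorem memLp_two_iff_lintegral {α : Type*} [MeasurableSpace α] {μ : Measure α} {f : α → ℝ}
    (hf : AEStronglyMeasurable f μ) : MemLp f 2 μ ↔ ∫⁻ x, ‖f x‖ₑ ^ 2 ∂μ < ⊤ := by
  have h := eLpNorm_lt_top_iff_lintegral_rpow_enorm_lt_top (μ := μ) (f := f) (p := 2)
    two_ne_zero (by norm_num)
  simp only [ENNReal.toReal_ofNat, ENNReal.rpow_two] at h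
  exact ⟨fun h' => h.1 h'.2, fun h' => ⟨hf, h.2 h'⟩⟩

theorem eLpNorm_two_eq {α : Type*} [MeasurableSpace α] {μ : Measure α} (f : α → ℝ) :
    eLpNorm f 2 μ = (∫⁻ x, ‖f x‖ₑ ^ 2 ∂μ) ^ (1 / 2 : ℝ) := by
  rw [eLpNorm_eq_lintegral_rpow_enorm_toReal two_ne_zero (by norm_num)]
  simp

/-- A map on square integrable functions that is linear and bounded up to null sets induces a
bounded operator on `L²`. -/
theorem exists_clm_of_bounded {α : Type*} [MeasurableSpace α] {μ : Measure α}
    (A : (α → ℝ) → α → ℝ) {c : ℝ≥0∞} (hc : c ≠ ⊤)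
    (hm : ∀ f, StronglyMeasurable f → MemLp f 2 μ → AEStronglyMeasurable (A f) μ)
    (hb : ∀ f, StronglyMeasurable f → MemLp f 2 μ →
      ∫⁻ x, ‖A f x‖ₑ ^ 2 ∂μ ≤ c * ∫⁻ x, ‖f x‖ₑ ^ 2 ∂μ)
    (hl : ∀ f g, StronglyMeasurable f → MemLp f 2 μ → StronglyMeasurable g → MemLp g 2 μ →
      ∀ a : ℝ, A (fun x => f x + a * g x) =ᵐ[μ] fun x => A f x + a * A g x) :
    ∃ L : Lp ℝ 2 μ →L[ℝ] Lp ℝ 2 μ, ∀ (f : Lp ℝ 2 μ) (g : α → ℝ), StronglyMeasurable g →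
      f =ᵐ[μ] g → L f =ᵐ[μ] A g := by
  have hL : ∀ f, StronglyMeasurable f → MemLp f 2 μ → MemLp (A f) 2 μ := fun f h1 h2 => by
    rw [memLp_two_iff_lintegral (hm f h1 h2)]
    refine (hb f h1 h2).trans_lt (ENNReal.mul_lt_top hc.lt_top ?_)
    exact (memLp_two_iff_lintegral h2.1).1 h2
  have hsub : ∀ f g : α → ℝ, StronglyMeasurable f → MemLp f 2 μ → StronglyMeasurable g →
      f =ᵐ[μ] g → A f =ᵐ[μ] A g := by
    intro f g h1 h2 h3 h4
    have h5 : MemLp g 2 μ := h2.ae_eq h4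
    have h6 : StronglyMeasurable fun x => f x + (-1) * g x := h1.add (h3.const_mul (-1))
    have h7 : MemLp (fun x => f x + (-1) * g x) 2 μ := h2.add (h5.const_mul (-1))
    have h8 := hb _ h6 h7
    have h9 : ∫⁻ x, ‖f x + (-1) * g x‖ₑ ^ 2 ∂μ = 0 := by
      rw [lintegral_eq_zero_iff' (h7.1.enorm.pow_const 2)]
      filter_upwards [h4] with x hx
      simp [hx]
    rw [h9, mul_zero, nonpos_iff_eq_zero,
      lintegral_eq_zero_iff' ((hm _ h6 h7).enorm.pow_const 2)] at h8
    filter_upwards [h8, hl f g h1 h2 h3 h5 (-1)] with x hx hx'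
    have : A (fun x => f x + (-1) * g x) x = 0 := by simpa using hx
    rw [this] at hx'
    linarith
  let L₀ : Lp ℝ 2 μ →ₗ[ℝ] Lp ℝ 2 μ :=
    { toFun := fun f => (hL f (Lp.stronglyMeasurable f) (Lp.memLp f)).toLp
      map_add' := fun f g => by
        refine Lp.ext ?_
        refine (MemLp.coeFn_toLp _).trans ?_
        refine EventuallyEq.trans ?_ (Lp.coeFn_add _ _).symm
        have h1 := hl f g (Lp.stronglyMeasurable f) (Lp.memLp f) (Lp.stronglyMeasurable g)
          (Lp.memLp g) 1
        have h2 := hsub (f + g : Lp ℝ 2 μ) (fun x => f x + 1 * g x) (Lp.stronglyMeasurable _)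
          (Lp.memLp _) ((Lp.stronglyMeasurable f).add ((Lp.stronglyMeasurable g).const_mul 1))
          (by filter_upwards [Lp.coeFn_add f g] with x hx; rw [one_mul]; exact hx)
        filter_upwards [h1, h2, (hL f (Lp.stronglyMeasurable f) (Lp.memLp f)).coeFn_toLp,
          (hL g (Lp.stronglyMeasurable g) (Lp.memLp g)).coeFn_toLp] with x h1 h2 h3 h4
        rw [h2, h1, Pi.add_apply, h3, h4, one_mul]
      map_smul' := fun a g => by
        refine Lp.ext ?_
        refine (MemLp.coeFn_toLp _).trans ?_
        refine EventuallyEq.trans ?_ (Lp.coeFn_smul _ _).symm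
        have hz : MemLp (fun _ : α => (0 : ℝ)) 2 μ := MemLp.zero
        have hz' : StronglyMeasurable (fun _ : α => (0 : ℝ)) := stronglyMeasurable_const
        have h0 := hl _ _ hz' hz hz' hz (-1)
        have h1 := hl (fun _ => (0 : ℝ)) g hz' hz (Lp.stronglyMeasurable g)
          (Lp.memLp g) a
        have h2 := hsub (a • g : Lp ℝ 2 μ) (fun x => 0 + a * g x) (Lp.stronglyMeasurable _)
          (Lp.memLp _) (hz'.add ((Lp.stronglyMeasurable g).const_mul a))
          (by filter_upwards [Lp.coeFn_smul a g] with x hx; simp [hx])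
        filter_upwards [h0, h1, h2, (hL g (Lp.stronglyMeasurable g) (Lp.memLp g)).coeFn_toLp]
          with x h0 h1 h2 h4
        simp only [mul_zero, add_zero] at h0
        rw [h2, h1, Pi.smul_apply, RingHom.id_apply, h4, h0]
        simp }
  have hbound : ∀ f, ‖L₀ f‖ ≤ (c ^ (1 / 2 : ℝ)).toReal * ‖f‖ := by
    intro f
    have h1 : ‖L₀ f‖ = (eLpNorm (A f) 2 μ).toReal :=
      Lp.norm_toLp _ (hL f (Lp.stronglyMeasurable f) (Lp.memLp f))
    have hct : c ^ (1 / 2 : ℝ) ≠ ⊤ := ENNReal.rpow_ne_top_of_nonneg (by norm_num) hc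
    rw [h1, Lp.norm_def, ← ENNReal.toReal_mul]
    refine ENNReal.toReal_mono (ENNReal.mul_ne_top hct (Lp.memLp f).eLpNorm_ne_top) ?_
    rw [eLpNorm_two_eq, eLpNorm_two_eq, ← ENNReal.mul_rpow_of_nonneg _ _ (by norm_num)]
    exact ENNReal.rpow_le_rpow (hb f (Lp.stronglyMeasurable f) (Lp.memLp f)) (by norm_num)
  refine ⟨L₀.mkContinuous _ hbound, fun f g hg hfg => ?_⟩
  exact (hL f (Lp.stronglyMeasurable f) (Lp.memLp f)).coeFn_toLp.trans
    (hsub f g (Lp.stronglyMeasurable f) (Lp.memLp f) hg hfg)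

/-- Lebesgue measure on `[0,T]`. -/
abbrev timeMeasure (T : ℝ) : Measure ℝ := volume.restrict (Icc 0 T)

theorem cylMeasure_eq (T : ℝ) : cylMeasure T = (timeMeasure T).prod unitMeasure := rfl

instance (T : ℝ) : IsFiniteMeasure (cylMeasure T) := by rw [cylMeasure_eq]; infer_instance

instance (T : ℝ) : SFinite (cylMeasure T) := inferInstance

/-- The time primitive `∫_0^t f(s,h) ds` of a function on the cylinder `[0,T] × [0,1]`; values of
`f` at times outside `[0,T]` do not enter. -/
def timePrim (T : ℝ) (f : ℝ × ℝ → ℝ) (p : ℝ × ℝ) : ℝ :=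
  ∫ s, (if s ≤ p.1 then f (s, p.2) else 0) ∂timeMeasure T

/-- The projection of a function on the cylinder to the mode `cas k`. -/
def modeProj (k : ℤ) (f : ℝ × ℝ → ℝ) (p : ℝ × ℝ) : ℝ := cas k p.2 * fcoef (fun h => f (p.1, h)) k

theorem fcoef_eq_integral_unitMeasure (f : ℝ → ℝ) (k : ℤ) :
    fcoef f k = ∫ h, f h * cas k h ∂unitMeasure := (integral_unitMeasure _).symm

theorem stronglyMeasurable_timePrim {T : ℝ} {f : ℝ × ℝ → ℝ} (hf : StronglyMeasurable f) :
    StronglyMeasurable (timePrim T f) := by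
  have h1 : StronglyMeasurable fun q : (ℝ × ℝ) × ℝ =>
      if q.2 ≤ q.1.1 then f (q.2, q.1.2) else 0 := by
    refine StronglyMeasurable.ite (measurableSet_le measurable_snd (by fun_prop)) ?_
      stronglyMeasurable_const
    exact hf.comp_measurable (by fun_prop)
  exact h1.integral_prod_right

theorem stronglyMeasurable_fcoef {f : ℝ × ℝ → ℝ} (hf : StronglyMeasurable f) (k : ℤ) :
    StronglyMeasurable fun t => fcoef (fun h => f (t, h)) k := by
  have h1 : StronglyMeasurable fun q : ℝ × ℝ => f q * cas k q.2 :=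
    hf.mul ((continuous_cas k).stronglyMeasurable.comp_measurable measurable_snd)
  simp only [fcoef_eq_integral_unitMeasure]
  exact h1.integral_prod_right

theorem stronglyMeasurable_modeProj {f : ℝ × ℝ → ℝ} (hf : StronglyMeasurable f) (k : ℤ) :
    StronglyMeasurable (modeProj k f) :=
  ((continuous_cas k).stronglyMeasurable.comp_measurable measurable_snd).mul
    ((stronglyMeasurable_fcoef hf k).comp_measurable measurable_fst)

theorem isPrim_timePrim {T : ℝ} {f : ℝ × ℝ → ℝ} {h : ℝ}
    (hf : Integrable (fun t => f (t, h)) (timeMeasure T)) :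
    IsPrim (fun t => timePrim T f (t, h)) ((Icc 0 T).indicator fun t => f (t, h)) := by
  have hi : Integrable ((Icc 0 T).indicator fun t => f (t, h)) :=
    (integrable_indicator_iff measurableSet_Icc).2 hf
  have h1 : ∀ t, timePrim T f (t, h) = ∫ s in Iic t, (Icc 0 T).indicator (fun t => f (t, h)) s := by
    intro t
    simp only [timePrim]
    rw [← integral_indicator measurableSet_Icc, ← integral_indicator measurableSet_Iic]
    congr 1; funext s
    by_cases hs : s ≤ t <;> by_cases hs' : s ∈ Icc 0 T <;> simp [indicator, hs, hs']
  refine ⟨hi.locallyIntegrable, fun t => ?_⟩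
  rw [h1, h1, ← intervalIntegral.integral_Iic_sub_Iic hi.integrableOn hi.integrableOn]
  ring

theorem timePrim_zero {T : ℝ} (f : ℝ × ℝ → ℝ) {t : ℝ} (ht : t ≤ 0) (h : ℝ) :
    timePrim T f (t, h) = 0 := by
  refine integral_eq_zero_of_ae ?_
  filter_upwards [ae_restrict_mem measurableSet_Icc,
    ae_restrict_of_ae (compl_mem_ae_iff.2 (measure_singleton (μ := (volume : Measure ℝ)) 0))]
    with s hs hs0
  have : ¬ s ≤ t := fun h' => hs0 (le_antisymm (h'.trans ht) hs.1)
  simp [this]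

theorem integrable_of_memLp {T : ℝ} {f : ℝ × ℝ → ℝ} (hf : MemLp f 2 (cylMeasure T)) :
    Integrable f (cylMeasure T) := hf.integrable (by norm_num)

theorem ae_integrable_time {T : ℝ} {f : ℝ × ℝ → ℝ} (hf : Integrable f (cylMeasure T)) :
    ∀ᵐ h ∂unitMeasure, Integrable (fun t => f (t, h)) (timeMeasure T) := hf.prod_left_ae

/-- A slice at a fixed time of a square integrable function is square integrable. -/
theorem ae_memLp_slice {T : ℝ} {f : ℝ × ℝ → ℝ} (hf : MemLp f 2 (cylMeasure T)) :
    ∀ᵐ t ∂timeMeasure T, MemLp (fun h => f (t, h)) 2 unitMeasure := by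
  have h1 : Integrable (fun p => f p ^ 2) (cylMeasure T) := hf.integrable_sq
  have h2 : ∀ᵐ t ∂timeMeasure T, AEStronglyMeasurable (fun h => f (t, h)) unitMeasure :=
    hf.1.prodMk_left
  filter_upwards [h1.prod_right_ae, h2] with t ht ht'
  exact (memLp_two_iff_integrable_sq ht').2 ht

theorem lintegral_cyl {T : ℝ} {g : ℝ × ℝ → ℝ≥0∞} (hg : Measurable g) :
    ∫⁻ p, g p ∂cylMeasure T = ∫⁻ t, ∫⁻ h, g (t, h) ∂unitMeasure ∂timeMeasure T :=
  lintegral_prod _ hg.aemeasurable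

theorem lintegral_cyl_symm {T : ℝ} {g : ℝ × ℝ → ℝ≥0∞} (hg : Measurable g) :
    ∫⁻ p, g p ∂cylMeasure T = ∫⁻ h, ∫⁻ t, g (t, h) ∂timeMeasure T ∂unitMeasure :=
  lintegral_prod_symm _ hg.aemeasurable

theorem enorm_timePrim_sq_le {T : ℝ} {f : ℝ × ℝ → ℝ} (hf : StronglyMeasurable f) (p : ℝ × ℝ) :
    ‖timePrim T f p‖ₑ ^ 2 ≤ timeMeasure T univ * ∫⁻ s, ‖f (s, p.2)‖ₑ ^ 2 ∂timeMeasure T := by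
  have h1 : ‖timePrim T f p‖ₑ ≤ ∫⁻ s, ‖f (s, p.2)‖ₑ ∂timeMeasure T := by
    refine (enorm_integral_le_lintegral_enorm _).trans (lintegral_mono fun s => ?_)
    split_ifs <;> simp
  refine (pow_le_pow_left₀ zero_le h1 2).trans (sq_lintegral_le ?_)
  exact (hf.measurable.comp (by fun_prop : Measurable fun s : ℝ => (s, p.2))).enorm.aemeasurable

theorem lintegral_timePrim_le {T : ℝ} {f : ℝ × ℝ → ℝ} (hf : StronglyMeasurable f) :
    ∫⁻ p, ‖timePrim T f p‖ₑ ^ 2 ∂cylMeasure T ≤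
      (timeMeasure T univ * timeMeasure T univ) * ∫⁻ p, ‖f p‖ₑ ^ 2 ∂cylMeasure T := by
  rw [lintegral_cyl_symm ((stronglyMeasurable_timePrim hf).measurable.enorm.pow_const 2),
    lintegral_cyl_symm (hf.measurable.enorm.pow_const 2)]
  have hm : Measurable fun h => ∫⁻ s, ‖f (s, h)‖ₑ ^ 2 ∂timeMeasure T :=
    (hf.measurable.enorm.pow_const 2).lintegral_prod_left'
  rw [← lintegral_const_mul _ hm]
  refine lintegral_mono fun h => ?_
  refine (lintegral_mono fun t => enorm_timePrim_sq_le hf (t, h)).trans ?_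
  simp only [lintegral_const]
  exact le_of_eq (by ring)

theorem lintegral_modeProj_le {T : ℝ} {f : ℝ × ℝ → ℝ} (hf : StronglyMeasurable f) (k : ℤ) :
    ∫⁻ p, ‖modeProj k f p‖ₑ ^ 2 ∂cylMeasure T ≤ 16 * ∫⁻ p, ‖f p‖ₑ ^ 2 ∂cylMeasure T := by
  have hcas : ∀ x, ‖cas k x‖ₑ ≤ 2 := fun x => by
    rw [Real.enorm_eq_ofReal_abs]
    exact (ENNReal.ofReal_le_ofReal (abs_cas_le k x)).trans (by simp)
  have hpt : ∀ p : ℝ × ℝ, ‖modeProj k f p‖ₑ ^ 2 ≤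
      16 * ∫⁻ h, ‖f (p.1, h)‖ₑ ^ 2 ∂unitMeasure := by
    intro p
    have hmeas : AEMeasurable (fun h => ‖f (p.1, h)‖ₑ) unitMeasure :=
      (hf.measurable.comp (by fun_prop : Measurable fun h : ℝ => (p.1, h))).enorm.aemeasurable
    have h1 : ‖modeProj k f p‖ₑ ≤ 4 * ∫⁻ h, ‖f (p.1, h)‖ₑ ∂unitMeasure := by
      rw [modeProj, enorm_mul, fcoef_eq_integral_unitMeasure, show (4 : ℝ≥0∞) = 2 * 2 by norm_num,
        mul_assoc]
      refine mul_le_mul' (hcas _) ((enorm_integral_le_lintegral_enorm _).trans ?_)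
      rw [← lintegral_const_mul'' _ hmeas]
      refine lintegral_mono fun h => ?_
      rw [enorm_mul, mul_comm]
      exact mul_le_mul' (hcas _) le_rfl
    refine (pow_le_pow_left₀ zero_le h1 2).trans ?_
    rw [mul_pow, show (4 : ℝ≥0∞) ^ 2 = 16 by norm_num]
    refine mul_le_mul' le_rfl ((sq_lintegral_le hmeas).trans ?_)
    simp
  rw [lintegral_cyl ((stronglyMeasurable_modeProj hf k).measurable.enorm.pow_const 2),
    lintegral_cyl (hf.measurable.enorm.pow_const 2)]
  have hm : Measurable fun t => ∫⁻ h, ‖f (t, h)‖ₑ ^ 2 ∂unitMeasure :=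
    (hf.measurable.enorm.pow_const 2).lintegral_prod_right'
  rw [← lintegral_const_mul _ hm]
  refine lintegral_mono fun t => ?_
  refine (lintegral_mono fun h => hpt (t, h)).trans ?_
  simp

theorem ae_cyl_of_ae_unit {T : ℝ} {q : ℝ → Prop} (h : ∀ᵐ x ∂unitMeasure, q x) :
    ∀ᵐ p ∂cylMeasure T, q p.2 := Measure.quasiMeasurePreserving_snd.ae h

theorem ae_cyl_of_ae_time {T : ℝ} {q : ℝ → Prop} (h : ∀ᵐ t ∂timeMeasure T, q t) :
    ∀ᵐ p ∂cylMeasure T, q p.1 := Measure.quasiMeasurePreserving_fst.ae h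

theorem exists_timePrim_clm (T : ℝ) : ∃ L : Lp ℝ 2 (cylMeasure T) →L[ℝ] Lp ℝ 2 (cylMeasure T),
    ∀ (f : Lp ℝ 2 (cylMeasure T)) (g : ℝ × ℝ → ℝ), StronglyMeasurable g →
      f =ᵐ[cylMeasure T] g → L f =ᵐ[cylMeasure T] timePrim T g := by
  refine exists_clm_of_bounded (timePrim T) (c := timeMeasure T univ * timeMeasure T univ)
    (ENNReal.mul_ne_top (measure_ne_top _ _) (measure_ne_top _ _))
    (fun f hf _ => (stronglyMeasurable_timePrim hf).aestronglyMeasurable)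
    (fun f hf _ => lintegral_timePrim_le hf) fun f g hf hf2 hg hg2 a => ?_
  filter_upwards [ae_cyl_of_ae_unit (ae_integrable_time (integrable_of_memLp hf2)),
    ae_cyl_of_ae_unit (ae_integrable_time (integrable_of_memLp hg2))] with p hp1 hp2
  have hms : MeasurableSet {s : ℝ | s ≤ p.1} := measurableSet_Iic
  have i1 : Integrable (fun s => if s ≤ p.1 then f (s, p.2) else 0) (timeMeasure T) :=
    hp1.indicator hms
  have i2 : Integrable (fun s => if s ≤ p.1 then g (s, p.2) else 0) (timeMeasure T) :=
    hp2.indicator hms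
  simp only [timePrim]
  rw [← integral_const_mul, ← integral_add i1 (i2.const_mul a)]
  congr 1; funext s; split_ifs <;> simp

theorem exists_modeProj_clm (T : ℝ) (k : ℤ) :
    ∃ L : Lp ℝ 2 (cylMeasure T) →L[ℝ] Lp ℝ 2 (cylMeasure T),
    ∀ (f : Lp ℝ 2 (cylMeasure T)) (g : ℝ × ℝ → ℝ), StronglyMeasurable g →
      f =ᵐ[cylMeasure T] g → L f =ᵐ[cylMeasure T] modeProj k g := by
  -- the constant is `2² * 2²`, as `|cas k| ≤ 2` is used twice
  refine exists_clm_of_bounded (modeProj k) (c := 16) (by norm_num)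
    (fun f hf _ => (stronglyMeasurable_modeProj hf k).aestronglyMeasurable)
    (fun f hf _ => lintegral_modeProj_le hf k) fun f g hf hf2 hg hg2 a => ?_
  filter_upwards [ae_cyl_of_ae_time (ae_memLp_slice hf2),
    ae_cyl_of_ae_time (ae_memLp_slice hg2)] with p hp1 hp2
  have i1 := memLp_mul_intervalIntegrable hp1 (memLp_cas k)
  have i2 := memLp_mul_intervalIntegrable hp2 (memLp_cas k)
  simp only [modeProj, fcoef, add_mul, mul_assoc]
  rw [intervalIntegral.integral_add i1 (i2.const_mul a), intervalIntegral.integral_const_mul]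
  ring

/-- Time integration as a bounded operator on `L²([0,T] × [0,1])`. -/
def timeOp (T : ℝ) : Lp ℝ 2 (cylMeasure T) →L[ℝ] Lp ℝ 2 (cylMeasure T) :=
  (exists_timePrim_clm T).choose

/-- The projections to the modes `cas k` as bounded operators on `L²([0,T] × [0,1])`. -/
def modeOp (T : ℝ) (k : ℤ) : Lp ℝ 2 (cylMeasure T) →L[ℝ] Lp ℝ 2 (cylMeasure T) :=
  (exists_modeProj_clm T k).choose

theorem timeOp_ae_eq {T : ℝ} {f : Lp ℝ 2 (cylMeasure T)} {g : ℝ × ℝ → ℝ} (hg : StronglyMeasurable g)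
    (h : f =ᵐ[cylMeasure T] g) : timeOp T f =ᵐ[cylMeasure T] timePrim T g :=
  (exists_timePrim_clm T).choose_spec f g hg h

theorem modeOp_ae_eq {T : ℝ} {k : ℤ} {f : Lp ℝ 2 (cylMeasure T)} {g : ℝ × ℝ → ℝ}
    (hg : StronglyMeasurable g) (h : f =ᵐ[cylMeasure T] g) :
    modeOp T k f =ᵐ[cylMeasure T] modeProj k g :=
  (exists_modeProj_clm T k).choose_spec f g hg h

/-! ### The mode system on the cylinder -/

theorem inner_cyl {T : ℝ} {x y : Lp ℝ 2 (cylMeasure T)} {f g : ℝ × ℝ → ℝ}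
    (hf : x =ᵐ[cylMeasure T] f) (hg : y =ᵐ[cylMeasure T] g) :
    inner ℝ x y = ∫ p, f p * g p ∂cylMeasure T := by
  rw [L2.inner_def]
  refine integral_congr_ae ?_
  filter_upwards [hf, hg] with p h1 h2
  rw [h1, h2]; simp [mul_comm]

theorem memLp_timePrim {T : ℝ} {f : ℝ × ℝ → ℝ} (hf : StronglyMeasurable f)
    (hf2 : MemLp f 2 (cylMeasure T)) : MemLp (timePrim T f) 2 (cylMeasure T) :=
  (Lp.memLp _).ae_eq (timeOp_ae_eq hf hf2.coeFn_toLp)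

theorem memLp_modeProj {T : ℝ} {f : ℝ × ℝ → ℝ} (hf : StronglyMeasurable f)
    (hf2 : MemLp f 2 (cylMeasure T)) (k : ℤ) : MemLp (modeProj k f) 2 (cylMeasure T) :=
  (Lp.memLp _).ae_eq (modeOp_ae_eq hf hf2.coeFn_toLp)

theorem fcoef_const_mul_cas (c : ℝ) (j k : ℤ) :
    fcoef (fun h => cas j h * c) k = if j = k then c else 0 := by
  simp only [fcoef, mul_right_comm _ c]
  rw [intervalIntegral.integral_mul_const, integral_cas_mul_cas]
  split_ifs <;> simp

theorem integral_cyl {T : ℝ} {f : ℝ × ℝ → ℝ} (hf : Integrable f (cylMeasure T)) :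
    ∫ p, f p ∂cylMeasure T = ∫ t, ∫ h, f (t, h) ∂unitMeasure ∂timeMeasure T := integral_prod f hf

theorem integral_cyl_symm {T : ℝ} {f : ℝ × ℝ → ℝ} (hf : Integrable f (cylMeasure T)) :
    ∫ p, f p ∂cylMeasure T = ∫ h, ∫ t, f (t, h) ∂timeMeasure T ∂unitMeasure :=
  integral_prod_symm f hf

theorem integral_modeProj_mul {T : ℝ} {f g : ℝ × ℝ → ℝ} (hf : StronglyMeasurable f)
    (hf2 : MemLp f 2 (cylMeasure T)) (hg2 : MemLp g 2 (cylMeasure T)) (k : ℤ) :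
    ∫ p, modeProj k f p * g p ∂cylMeasure T =
      ∫ t, fcoef (fun h => f (t, h)) k * fcoef (fun h => g (t, h)) k ∂timeMeasure T := by
  refine (integral_cyl ((memLp_modeProj hf hf2 k).integrable_mul hg2)).trans ?_
  congr 1; funext t
  simp only [modeProj, Pi.mul_apply]
  rw [fcoef_eq_integral_unitMeasure (fun h => g (t, h)), ← integral_const_mul]
  congr 1; funext h; ring

/-- Fubini's theorem for the coefficients of a time primitive. -/
theorem fcoef_timePrim {T : ℝ} {f : ℝ × ℝ → ℝ} (hi : Integrable f (cylMeasure T)) (k : ℤ) (t : ℝ) :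
    fcoef (fun h => timePrim T f (t, h)) k =
      ∫ s, (if s ≤ t then fcoef (fun h => f (s, h)) k else 0) ∂timeMeasure T := by
  have hi2 : Integrable (fun p : ℝ × ℝ => (if p.1 ≤ t then f p else 0) * cas k p.2)
      (cylMeasure T) := by
    have h1 : Integrable (fun p : ℝ × ℝ => if p.1 ≤ t then f p else 0) (cylMeasure T) :=
      hi.indicator (measurableSet_le measurable_fst measurable_const : MeasurableSet {p : ℝ × ℝ | p.1 ≤ t})
    refine h1.mul_bdd (c := 2) ?_ ?_
    · exact ((continuous_cas k).comp continuous_snd).aestronglyMeasurable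
    · exact Eventually.of_forall fun p => abs_cas_le k p.2
  have h2 := (integral_cyl_symm hi2).symm.trans (integral_cyl hi2)
  have h3 : ∀ h, (∫ s, (if s ≤ t then f (s, h) else 0) * cas k h ∂timeMeasure T) =
      timePrim T f (t, h) * cas k h := fun h => by rw [integral_mul_const]; rfl
  have h4 : ∀ s, (∫ h, (if s ≤ t then f (s, h) else 0) * cas k h ∂unitMeasure) =
      if s ≤ t then fcoef (fun h => f (s, h)) k else 0 := fun s => by
    split_ifs
    · rw [fcoef_eq_integral_unitMeasure]
    · simp
  simp only [h3, h4] at h2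
  rw [fcoef_eq_integral_unitMeasure, h2]

theorem timeOp_inner_nonneg (T : ℝ) (x : Lp ℝ 2 (cylMeasure T)) : 0 ≤ inner ℝ (timeOp T x) x := by
  have hx := Lp.stronglyMeasurable x
  have hx2 := Lp.memLp x
  rw [inner_cyl (timeOp_ae_eq hx (EventuallyEq.refl _ _)) (EventuallyEq.refl _ _),
    show (∫ p, timePrim T x p * x p ∂cylMeasure T) = _ from
      integral_cyl_symm ((memLp_timePrim hx hx2).integrable_mul hx2)]
  refine integral_nonneg_of_ae ?_
  filter_upwards [ae_integrable_time (integrable_of_memLp hx2)] with h hh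
  have hp := isPrim_timePrim hh
  rcases lt_or_ge T 0 with hT | hT
  · simp [timeMeasure, Icc_eq_empty (not_le.2 hT)]
  have h1 := hp.sq.integral_eq 0 T
  rw [timePrim_zero _ le_rfl, intervalIntegral.integral_of_le hT,
    restrict_Ioc_eq_restrict_Icc] at h1
  have h2 : ∫ t, timePrim T x (t, h) * x (t, h) ∂timeMeasure T =
      (1 / 2) * timePrim T x (T, h) ^ 2 := by
    have h3 : ∫ t in Icc 0 T, 2 * timePrim T x (t, h) * (Icc 0 T).indicator (fun t => x (t, h)) t =
        ∫ t in Icc 0 T, 2 * (timePrim T x (t, h) * x (t, h)) := by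
      refine setIntegral_congr_fun measurableSet_Icc fun t ht => ?_
      simp only [indicator_of_mem ht]; ring
    rw [h3, integral_const_mul] at h1
    linarith
  change 0 ≤ ∫ t, timePrim T x (t, h) * x (t, h) ∂timeMeasure T
  rw [h2]; positivity

theorem IsPrim.ae_eq_zero {f g : ℝ → ℝ} (h : IsPrim f g) {a b : ℝ}
    (hf : ∀ᵐ t ∂volume.restrict (Icc a b), f t = 0) : ∀ᵐ t ∂volume.restrict (Icc a b), g t = 0 := by
  have h0 : ∀ t ∈ Ioo a b, f t = 0 := by
    intro t ht
    by_contra hne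
    have h1 : {s | f s ≠ 0} ∩ Ioo a b ∈ 𝓝 t :=
      inter_mem ((h.continuous.isOpen_preimage _ isOpen_ne).mem_nhds hne) (Ioo_mem_nhds ht.1 ht.2)
    have h2 : 0 < volume ({s | f s ≠ 0} ∩ Ioo a b) := by
      refine IsOpen.measure_pos _ ?_ ⟨t, mem_of_mem_nhds h1⟩
      exact (h.continuous.isOpen_preimage _ isOpen_ne).inter isOpen_Ioo
    rw [ae_restrict_iff' measurableSet_Icc] at hf
    refine h2.ne' (measure_mono_null (fun s hs => ?_) hf)
    simp only [mem_compl_iff, mem_ofPred_eq, Classical.not_imp]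
    exact ⟨Ioo_subset_Icc_self hs.2, hs.1⟩
  rw [← restrict_Ioo_eq_restrict_Icc]
  filter_upwards [ae_restrict_mem measurableSet_Ioo, ae_restrict_of_ae h.ae_hasDerivAt] with t ht hd
  have h3 : f =ᶠ[𝓝 t] fun _ => 0 :=
    Filter.eventually_of_mem (Ioo_mem_nhds ht.1 ht.2) h0
  exact hd.unique ((hasDerivAt_const t (0 : ℝ)).congr_of_eventuallyEq h3)

theorem ae_ae_of_ae_cyl_symm {T : ℝ} {q : ℝ × ℝ → Prop} (h : ∀ᵐ p ∂cylMeasure T, q p) :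
    ∀ᵐ h ∂unitMeasure, ∀ᵐ t ∂timeMeasure T, q (t, h) := by
  have h1 : ∀ᵐ p ∂(unitMeasure.prod (timeMeasure T)), q p.swap :=
    Measure.measurePreserving_swap.quasiMeasurePreserving.ae h
  exact Measure.ae_ae_of_ae_prod h1

theorem ae_ae_of_ae_cyl {T : ℝ} {q : ℝ × ℝ → Prop} (h : ∀ᵐ p ∂cylMeasure T, q p) :
    ∀ᵐ t ∂timeMeasure T, ∀ᵐ h ∂unitMeasure, q (t, h) := Measure.ae_ae_of_ae_prod h

theorem timeOp_injective (T : ℝ) : Function.Injective (timeOp T) := by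
  rw [injective_iff_map_eq_zero]
  intro x hx
  have hm := Lp.stronglyMeasurable x
  have hx2 := Lp.memLp x
  have h1 : timePrim T x =ᵐ[cylMeasure T] 0 := by
    refine (timeOp_ae_eq hm (EventuallyEq.refl _ _)).symm.trans ?_
    rw [hx]; exact Lp.coeFn_zero _ _ _
  refine (Lp.eq_zero_iff_ae_eq_zero).2 ?_
  have h2 : ∀ᵐ h ∂unitMeasure, ∀ᵐ t ∂timeMeasure T, x (t, h) = 0 := by
    filter_upwards [ae_ae_of_ae_cyl_symm h1, ae_integrable_time (integrable_of_memLp hx2)]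
      with h hh hi
    filter_upwards [(isPrim_timePrim hi).ae_eq_zero hh, ae_restrict_mem measurableSet_Icc]
      with t ht htm
    rwa [indicator_of_mem htm] at ht
  have h3 : MeasurableSet {p : ℝ × ℝ | x p.swap = 0} :=
    (hm.measurable.comp measurable_swap) (measurableSet_singleton 0)
  have h4 : ∀ᵐ p ∂(unitMeasure.prod (timeMeasure T)), x p.swap = 0 :=
    (Measure.ae_prod_iff_ae_ae h3).2 h2
  have h5 := (Measure.measurePreserving_swap (μ := timeMeasure T)
    (ν := unitMeasure)).quasiMeasurePreserving.ae h4
  simp only [Prod.swap_swap] at h5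
  exact h5

theorem modeSystem_cyl (T : ℝ) : ModeSystem (timeOp T) (modeOp T) where
  accretive := timeOp_inner_nonneg T
  symm k x y := by
    have hx := Lp.stronglyMeasurable x
    have hy := Lp.stronglyMeasurable y
    rw [inner_cyl (modeOp_ae_eq hx (EventuallyEq.refl _ _)) (EventuallyEq.refl _ _),
      inner_cyl (EventuallyEq.refl _ _) (modeOp_ae_eq hy (EventuallyEq.refl _ _)),
      integral_modeProj_mul hx (Lp.memLp x) (Lp.memLp y)]
    simp only [mul_comm (x _)]
    rw [integral_modeProj_mul hy (Lp.memLp y) (Lp.memLp x)]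
    simp only [mul_comm]
  idem k x := by
    have hx := Lp.stronglyMeasurable x
    have h1 := modeOp_ae_eq (k := k) hx (EventuallyEq.refl _ _)
    refine Lp.ext ((modeOp_ae_eq (stronglyMeasurable_modeProj hx k) h1).trans ?_)
    refine EventuallyEq.trans (Eventually.of_forall fun p => ?_) h1.symm
    simp only [modeProj]
    rw [fcoef_const_mul_cas, if_pos rfl]
  zero j k x hjk := by
    have hx := Lp.stronglyMeasurable x
    have h1 := modeOp_ae_eq (k := k) hx (EventuallyEq.refl _ _)
    refine (Lp.eq_zero_iff_ae_eq_zero).2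
      ((modeOp_ae_eq (stronglyMeasurable_modeProj hx k) h1).trans (Eventually.of_forall fun p => ?_))
    simp only [modeProj]
    rw [fcoef_const_mul_cas, if_neg hjk.symm, mul_zero]
    rfl
  comm k x := by
    have hx := Lp.stronglyMeasurable x
    have h1 := modeOp_ae_eq (k := k) hx (EventuallyEq.refl _ _)
    have h2 := timeOp_ae_eq hx (EventuallyEq.refl _ _)
    refine Lp.ext ((modeOp_ae_eq (stronglyMeasurable_timePrim hx) h2).trans ?_)
    refine EventuallyEq.trans (Eventually.of_forall fun p => ?_)
      (timeOp_ae_eq (stronglyMeasurable_modeProj hx k) h1).symm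
    simp only [modeProj]
    rw [fcoef_timePrim (integrable_of_memLp (Lp.memLp x)), ← integral_const_mul, timePrim]
    congr 1; funext s
    simp only [modeProj]
    split_ifs <;> simp

/-! ### Solvability for bilipschitz nonlinearities -/

theorem timePrim_eq {T : ℝ} (f : ℝ × ℝ → ℝ) {t : ℝ} (ht : t ∈ Icc 0 T) (h : ℝ) :
    timePrim T f (t, h) = ∫ s in (0 : ℝ)..t, f (s, h) := by
  rw [intervalIntegral.integral_of_le ht.1, restrict_Ioc_eq_restrict_Icc, timePrim,
    ← integral_indicator measurableSet_Icc, ← integral_indicator measurableSet_Icc]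
  congr 1; funext s
  by_cases hs : s ≤ t
  · have : s ≤ T := hs.trans ht.2
    simp [indicator, hs, this]
  · simp [indicator, hs]

theorem ae_cyl_mem (T : ℝ) : ∀ᵐ p ∂cylMeasure T, p.1 ∈ Icc 0 T :=
  ae_cyl_of_ae_time (ae_restrict_mem measurableSet_Icc)

/-- The function `f` is `C¹` with derivative `f'` between `-C` and `-c`, where `c > 0`. -/
structure DecreasingBilipschitz (f f' : ℝ → ℝ) (c C : ℝ) : Prop where
  hasDerivAt : ∀ x, HasDerivAt f (f' x) x
  continuous_deriv : Continuous f'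
  pos : 0 < c
  le : ∀ x, f' x ≤ -c
  ge : ∀ x, -C ≤ f' x

namespace DecreasingBilipschitz

variable {f f' : ℝ → ℝ} {c C : ℝ}

theorem continuous (h : DecreasingBilipschitz f f' c C) : Continuous f :=
  continuous_iff_continuousAt.2 fun x => (h.hasDerivAt x).continuousAt

theorem abs_deriv_add_le (h : DecreasingBilipschitz f f' c C) (x : ℝ) : |f' x + C| ≤ C - c := by
  rw [abs_le]
  constructor <;> linarith [h.le x, h.ge x, h.pos]

theorem abs_sub_le (h : DecreasingBilipschitz f f' c C) (x y : ℝ) :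
    |(f x + C * x) - (f y + C * y)| ≤ (C - c) * |x - y| := by
  have := Convex.norm_image_sub_le_of_norm_hasDerivWithin_le (f := fun x => f x + C * x)
    (f' := fun x => f' x + C) (s := univ) (C := C - c) (x := y) (y := x)
    (fun z _ => ((h.hasDerivAt z).fun_add (by
      simpa using (hasDerivAt_id z).const_mul C)).hasDerivWithinAt)
    (fun z _ => h.abs_deriv_add_le z) convex_univ (mem_univ _) (mem_univ _)
  simpa using this

end DecreasingBilipschitz

/-- The profile `a = μ v exp (-Cμt) cas k`, with `μ = (2πk)⁴`, which solves the linear equation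
`a + Cμ ∫₀ᵗ a = μ v cas k` in the mode `k`. -/
def relaxation (C : ℝ) (k : ℤ) (v : ℝ) (p : ℝ × ℝ) : ℝ :=
  freq k ^ 4 * v * Real.exp (-(C * freq k ^ 4 * p.1)) * cas k p.2

theorem continuous_relaxation (C : ℝ) (k : ℤ) (v : ℝ) : Continuous (relaxation C k v) := by
  have := continuous_cas k
  unfold relaxation
  fun_prop

theorem memLp_relaxation {T C : ℝ} (hC : 0 < C) (k : ℤ) (v : ℝ) :
    MemLp (relaxation C k v) 2 (cylMeasure T) := by
  refine MemLp.of_bound (continuous_relaxation C k v).aestronglyMeasurable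
    (|freq k ^ 4 * v| * 1 * 2) ?_
  filter_upwards [ae_cyl_mem T] with p hp
  rw [relaxation, Real.norm_eq_abs, abs_mul, abs_mul, Real.abs_exp]
  have h1 : Real.exp (-(C * freq k ^ 4 * p.1)) ≤ 1 := by
    rw [Real.exp_le_one_iff]
    have := hp.1
    have : 0 ≤ C * freq k ^ 4 * p.1 := by positivity
    linarith
  gcongr
  exact abs_cas_le k p.2

theorem integral_mul_exp (a t : ℝ) :
    ∫ s in (0 : ℝ)..t, a * Real.exp (-(a * s)) = 1 - Real.exp (-(a * t)) := by
  have h : ∀ s ∈ uIcc 0 t, HasDerivAt (fun s => -Real.exp (-(a * s))) (a * Real.exp (-(a * s))) s := by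
    intro s _
    have h1 : HasDerivAt (fun s => -(a * s)) (-a) s := by
      simpa using ((hasDerivAt_id s).const_mul a).fun_neg
    have := h1.exp.fun_neg
    refine this.congr_deriv (by ring)
  rw [intervalIntegral.integral_eq_sub_of_hasDerivAt h
    ((by fun_prop : Continuous fun s => a * Real.exp (-(a * s))).intervalIntegrable _ _)]
  simp; ring

theorem relaxation_add_timePrim {T C : ℝ} (k : ℤ) (v : ℝ) {t : ℝ} (ht : t ∈ Icc 0 T) (h : ℝ) :
    relaxation C k v (t, h) + C * freq k ^ 4 * timePrim T (relaxation C k v) (t, h) =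
      freq k ^ 4 * (cas k h * v) := by
  rw [timePrim_eq _ ht, ← intervalIntegral.integral_const_mul]
  have e : ∀ s, C * freq k ^ 4 * relaxation C k v (s, h) =
      (freq k ^ 4 * v * cas k h) *
        ((C * freq k ^ 4) * Real.exp (-(C * freq k ^ 4 * s))) := fun s => by
    simp only [relaxation]; ring
  simp only [e]
  rw [intervalIntegral.integral_const_mul, integral_mul_exp, relaxation]
  ring

theorem integral_relaxation_sq_le {T C : ℝ} (hT : 0 ≤ T) (hC : 0 < C) (k : ℤ) (v : ℝ) :
    ∫ p, relaxation C k v p * relaxation C k v p ∂cylMeasure T ≤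
      (2 * C)⁻¹ * (freq k ^ 4 * v ^ 2) := by
  have h1 := integral_cyl (T := T) ((memLp_relaxation hC k v).integrable_mul
    (memLp_relaxation hC k v))
  simp only [Pi.mul_apply] at h1
  rw [h1]
  have h2 : ∀ t, ∫ h, relaxation C k v (t, h) * relaxation C k v (t, h) ∂unitMeasure =
      (freq k ^ 4 * v ^ 2 * (2 * C)⁻¹) *
        ((2 * C * freq k ^ 4) * Real.exp (-(2 * C * freq k ^ 4 * t))) := by
    intro t
    have e : ∀ h, relaxation C k v (t, h) * relaxation C k v (t, h) =
        (freq k ^ 4 * v * Real.exp (-(C * freq k ^ 4 * t))) ^ 2 * (cas k h * cas k h) := fun h => by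
      simp only [relaxation]; ring
    simp only [e]
    rw [integral_const_mul, integral_unitMeasure, integral_cas_mul_cas, if_pos rfl, mul_pow,
      ← Real.exp_nat_mul]
    have h3 : ((2 : ℕ) : ℝ) * -(C * freq k ^ 4 * t) = -(2 * C * freq k ^ 4 * t) := by
      push_cast; ring
    rw [h3]
    field_simp
  simp only [h2]
  rw [integral_const_mul, timeMeasure, ← restrict_Ioc_eq_restrict_Icc, ← intervalIntegral.integral_of_le hT,
    integral_mul_exp]
  have h4 : 0 < Real.exp (-(2 * C * freq k ^ 4 * T)) := Real.exp_pos _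
  have h5 : 0 ≤ freq k ^ 4 * v ^ 2 * (2 * C)⁻¹ := by positivity
  nlinarith

/-- Solvability of `w_t = ∂⁴ f(w)` on `[0,T] × [0,1]` with `w_t ∈ L²`, in terms of coefficients,
for nonlinearities that are globally bilipschitz. -/
theorem exists_weak_solution {T : ℝ} (hT : 0 ≤ T) {f f' : ℝ → ℝ} {c C : ℝ}
    (hf : DecreasingBilipschitz f f' c C) {w₀ : ℝ → ℝ} (hw₀ : Continuous w₀)
    (hsum : Summable fun k => freq k ^ 4 * fcoef (fun h => f (w₀ h)) k ^ 2) :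
    ∃ η : ℝ × ℝ → ℝ, StronglyMeasurable η ∧ MemLp η 2 (cylMeasure T) ∧
      ∀ᵐ t ∂timeMeasure T, ∀ k, fcoef (fun h => η (t, h)) k =
        freq k ^ 4 * fcoef (fun h => f (w₀ h + timePrim T η (t, h))) k := by
  have hκ : 0 ≤ C - c := (abs_nonneg _).trans (hf.abs_deriv_add_le 0)
  have hC : 0 < C := by linarith [hf.pos]
  -- the nonlinearity as a map on functions and on `L²`
  let n : (ℝ × ℝ → ℝ) → ℝ × ℝ → ℝ := fun x p => f (w₀ p.2 + x p) + C * x p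
  have hnm : ∀ x, StronglyMeasurable x → StronglyMeasurable (n x) := fun x hx =>
    (hf.continuous.comp_stronglyMeasurable
      ((hw₀.stronglyMeasurable.comp_measurable measurable_snd).add hx)).add (hx.const_mul C)
  have hnsub : ∀ x y p, |n x p - n y p| ≤ (C - c) * |x p - y p| := by
    intro x y p
    have := hf.abs_sub_le (w₀ p.2 + x p) (w₀ p.2 + y p)
    simp only [n]
    ring_nf at this ⊢
    exact this
  have hn0 : MemLp (n 0) 2 (cylMeasure T) := by
    obtain ⟨B, hB⟩ := (isCompact_Icc (a := (0 : ℝ)) (b := 1)).exists_bound_of_continuousOn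
      (hf.continuous.comp hw₀).continuousOn
    refine MemLp.of_bound (hnm 0 stronglyMeasurable_const).aestronglyMeasurable B ?_
    have : ∀ᵐ h ∂unitMeasure, ‖f (w₀ h)‖ ≤ B :=
      (ae_restrict_iff' measurableSet_Icc).2 (Eventually.of_forall hB)
    filter_upwards [ae_cyl_of_ae_unit this] with p hp
    simpa [n] using hp
  have hnL : ∀ x, StronglyMeasurable x → MemLp x 2 (cylMeasure T) →
      MemLp (n x) 2 (cylMeasure T) := by
    intro x hx hx2
    have h1 : MemLp (fun p => n x p - n 0 p) 2 (cylMeasure T) := by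
      refine hx2.of_le_mul (c := C - c)
        ((hnm x hx).sub (hnm 0 stronglyMeasurable_const)).aestronglyMeasurable
        (Eventually.of_forall fun p => ?_)
      simpa using hnsub x 0 p
    refine (h1.add hn0).ae_eq (Eventually.of_forall fun p => ?_)
    simp
  let N : Lp ℝ 2 (cylMeasure T) → Lp ℝ 2 (cylMeasure T) := fun x =>
    (hnL x (Lp.stronglyMeasurable x) (Lp.memLp x)).toLp
  have hNae : ∀ (x : Lp ℝ 2 (cylMeasure T)) (g : ℝ × ℝ → ℝ), x =ᵐ[cylMeasure T] g →
      N x =ᵐ[cylMeasure T] n g := by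
    intro x g hg
    refine (hnL x (Lp.stronglyMeasurable x) (Lp.memLp x)).coeFn_toLp.trans ?_
    filter_upwards [hg] with p hp
    simp only [n, hp]
  have hN : ∀ x y, ‖N x - N y‖ ≤ (C - c) * ‖x - y‖ := by
    intro x y
    refine Lp.norm_le_mul_norm_of_ae_le_mul ?_
    filter_upwards [Lp.coeFn_sub (N x) (N y), Lp.coeFn_sub x y, hNae x x (EventuallyEq.refl _ _),
      hNae y y (EventuallyEq.refl _ _)] with p h1 h2 h3 h4
    rw [h1, h2, Pi.sub_apply, Pi.sub_apply, h3, h4]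
    exact hnsub x y p
  have hN0 : N 0 =ᵐ[cylMeasure T] n 0 := hNae 0 0 (Lp.coeFn_zero _ _ _)
  -- the nonlinearity maps time primitives to time primitives
  have hNJ : ∀ η, ∃ γ, ‖γ‖ ≤ (C - c) * ‖η‖ ∧ N (timeOp T η) = N 0 + timeOp T γ := by
    intro η
    have hη := Lp.stronglyMeasurable η
    have hη2 := Lp.memLp η
    let w : ℝ × ℝ → ℝ := fun p => w₀ p.2 + timePrim T η p
    have hw : StronglyMeasurable w := (hw₀.stronglyMeasurable.comp_measurable measurable_snd).add
      (stronglyMeasurable_timePrim hη)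
    let γ : ℝ × ℝ → ℝ := fun p => (f' (w p) + C) * η p
    have hγ : StronglyMeasurable γ :=
      ((hf.continuous_deriv.comp_stronglyMeasurable hw).add stronglyMeasurable_const).mul hη
    have hγle : ∀ p, ‖γ p‖ ≤ (C - c) * ‖η p‖ := fun p => by
      simp only [γ, norm_mul]
      exact mul_le_mul_of_nonneg_right (hf.abs_deriv_add_le _) (norm_nonneg _)
    have hγ2 : MemLp γ 2 (cylMeasure T) :=
      hη2.of_le_mul hγ.aestronglyMeasurable (Eventually.of_forall hγle)
    refine ⟨hγ2.toLp, ?_, Lp.ext ?_⟩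
    · refine Lp.norm_le_mul_norm_of_ae_le_mul ?_
      filter_upwards [hγ2.coeFn_toLp] with p hp
      rw [hp]; exact hγle p
    · have h1 := hNae _ _ (timeOp_ae_eq hη (EventuallyEq.refl _ _))
      have h2 := timeOp_ae_eq hγ hγ2.coeFn_toLp
      filter_upwards [h1, h2, hN0, Lp.coeFn_add (N 0) (timeOp T hγ2.toLp), ae_cyl_mem T,
        ae_cyl_of_ae_unit (ae_integrable_time (integrable_of_memLp hη2)),
        ae_cyl_of_ae_unit (ae_integrable_time (integrable_of_memLp hγ2))]
        with p h1 h2 h3 h4 hp hpi hpγ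
      rw [h1, h4, Pi.add_apply, h2, h3]
      obtain ⟨t, h⟩ := p
      have hprim := isPrim_timePrim hpi
      have hw' : IsPrim (fun t => w (t, h)) ((Icc 0 T).indicator fun t => η (t, h)) :=
        ⟨hprim.locInt, fun t => by simp only [w]; rw [hprim.eq t]; ring⟩
      have hcomp : IsPrim (fun t => f (w (t, h)))
          (fun t => f' (w (t, h)) * (Icc 0 T).indicator (fun t => η (t, h)) t) :=
        hw'.comp (fun t => hf.hasDerivAt _) (hf.continuous_deriv.comp hw'.continuous)
      have h5 := (hcomp.add (hprim.const_mul C)).eq t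
      have h6 := (isPrim_timePrim hpγ).eq t
      have h7 : (fun t => f' (w (t, h)) * (Icc 0 T).indicator (fun t => η (t, h)) t +
          C * (Icc 0 T).indicator (fun t => η (t, h)) t) =
          (Icc 0 T).indicator fun t => γ (t, h) := by
        funext s
        by_cases hs : s ∈ Icc 0 T
        · simp only [indicator_of_mem hs, γ]; ring
        · simp only [indicator_of_notMem hs]; ring
      rw [h7] at h5
      simp only [timePrim_zero _ le_rfl, zero_add, mul_zero, add_zero, w] at h5 h6
      simp only [n, Pi.zero_apply, add_zero, mul_zero]
      linarith
  -- the linear evolution of the datum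
  let v₀ : ℝ → ℝ := fun h => f (w₀ h)
  let a : ℤ → Lp ℝ 2 (cylMeasure T) := fun k =>
    (memLp_relaxation (T := T) hC k (fcoef v₀ k)).toLp
  have hn0m : StronglyMeasurable (n 0) := hnm 0 stronglyMeasurable_const
  have haae : ∀ k, a k =ᵐ[cylMeasure T] relaxation C k (fcoef v₀ k) := fun k =>
    (memLp_relaxation (T := T) hC k (fcoef v₀ k)).coeFn_toLp
  have ham : ∀ k, StronglyMeasurable (relaxation C k (fcoef v₀ k)) := fun k =>
    (continuous_relaxation C k _).stronglyMeasurable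
  have ha : ∀ k, a k + (C * freq k ^ 4) • timeOp T (a k) = freq k ^ 4 • modeOp T k (N 0) := by
    intro k
    refine Lp.ext ?_
    filter_upwards [haae k, timeOp_ae_eq (ham k) (haae k), modeOp_ae_eq (k := k) hn0m hN0,
      Lp.coeFn_add (a k) ((C * freq k ^ 4) • timeOp T (a k)),
      Lp.coeFn_smul (C * freq k ^ 4) (timeOp T (a k)),
      Lp.coeFn_smul (freq k ^ 4) (modeOp T k (N 0)), ae_cyl_mem T] with p h1 h2 h3 h4 h5 h6 hp
    rw [h4, h6, Pi.add_apply, h5, Pi.smul_apply, Pi.smul_apply, h1, h2, h3, smul_eq_mul,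
      smul_eq_mul]
    obtain ⟨t, h⟩ := p
    rw [relaxation_add_timePrim k _ hp]
    simp [modeProj, n, v₀]
  have hPa : ∀ k, modeOp T k (a k) = a k := by
    intro k
    refine Lp.ext ((modeOp_ae_eq (ham k) (haae k)).trans
      (EventuallyEq.trans (Eventually.of_forall fun p => ?_) (haae k).symm))
    have e : (fun h => relaxation C k (fcoef v₀ k) (p.1, h)) = fun h => cas k h *
        (freq k ^ 4 * fcoef v₀ k * Real.exp (-(C * freq k ^ 4 * p.1))) := by
      funext h; simp only [relaxation]; ring
    simp only [modeProj]
    rw [e, fcoef_const_mul_cas, if_pos rfl, relaxation]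
    ring
  have hms := modeSystem_cyl T
  have haorth : ∀ i j, i ≠ j → inner ℝ (a i) (a j) = 0 := fun i j hij => by
    rw [← hPa i, ← hPa j]; exact hms.orth i j _ _ hij
  have hasum : Summable fun k => ‖a k‖ ^ 2 := by
    refine Summable.of_nonneg_of_le (fun k => sq_nonneg _) (fun k => ?_)
      (hsum.mul_left (2 * C)⁻¹)
    rw [← real_inner_self_eq_norm_sq, inner_cyl (haae k) (haae k)]
    exact integral_relaxation_sq_le hT hC k _
  obtain ⟨η, hη⟩ := hms.exists_solution (timeOp_injective T) hκ (by linarith [hf.pos])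
    (μ := fun k => freq k ^ 4) (fun k => by positivity) hN hNJ ha haorth hasum
  have hηm := Lp.stronglyMeasurable η
  refine ⟨η, hηm, Lp.memLp η, ?_⟩
  rw [ae_all_iff]
  intro k
  have hJ := timeOp_ae_eq hηm (EventuallyEq.refl _ _)
  have hNC : (N (timeOp T η) - C • timeOp T η : Lp ℝ 2 (cylMeasure T)) =ᵐ[cylMeasure T]
      fun p => f (w₀ p.2 + timePrim T η p) := by
    filter_upwards [hNae _ _ hJ, hJ, Lp.coeFn_sub (N (timeOp T η)) (C • timeOp T η),
      Lp.coeFn_smul C (timeOp T η)] with p h1 h2 h3 h4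
    rw [h3, Pi.sub_apply, h4, Pi.smul_apply, h1, h2]
    simp [n]
  have hfm : StronglyMeasurable fun p : ℝ × ℝ => f (w₀ p.2 + timePrim T η p) :=
    hf.continuous.comp_stronglyMeasurable ((hw₀.stronglyMeasurable.comp_measurable
      measurable_snd).add (stronglyMeasurable_timePrim hηm))
  have h1 : ∀ᵐ p ∂cylMeasure T, modeProj k η p =
      freq k ^ 4 * modeProj k (fun p => f (w₀ p.2 + timePrim T η p)) p := by
    have h2 := modeOp_ae_eq (k := k) hηm (EventuallyEq.refl (ae (cylMeasure T)) η)
    rw [hη k] at h2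
    filter_upwards [h2, Lp.coeFn_smul (freq k ^ 4) (modeOp T k (N (timeOp T η) - C • timeOp T η)),
      modeOp_ae_eq (k := k) hfm hNC] with p h2 h3 h4
    rw [← h2, h3, Pi.smul_apply, h4, smul_eq_mul]
  filter_upwards [ae_ae_of_ae_cyl h1] with t ht
  have h3 := fcoef_congr ht k
  simp only [modeProj] at h3
  have e : (fun h => freq k ^ 4 * (cas k h *
      fcoef (fun h => f (w₀ h + timePrim T η (t, h))) k)) = fun h => cas k h *
      (freq k ^ 4 * fcoef (fun h => f (w₀ h + timePrim T η (t, h))) k) := by funext h; ring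
  rw [e, fcoef_const_mul_cas, fcoef_const_mul_cas, if_pos rfl, if_pos rfl] at h3
  exact h3

/-! ### The nonlinearity and its truncation -/

/-- The nonlinearity `u³ + u`. -/
def cubic (x : ℝ) : ℝ := x ^ 3 + x

theorem cubic_strictMono : StrictMono cubic := by
  intro x y hxy
  simp only [cubic]
  nlinarith [sq_nonneg (x + y), sq_nonneg (x - y), sq_nonneg x, sq_nonneg y]

theorem contDiff_cubic : ContDiff ℝ ∞ cubic := by
  unfold cubic; fun_prop

theorem hasDerivAt_cubic (x : ℝ) : HasDerivAt cubic (3 * x ^ 2 + 1) x := by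
  have h : HasDerivAt (fun x : ℝ => x ^ 3 + x) _ x :=
    (hasDerivAt_pow 3 x).fun_add (hasDerivAt_id x)
  exact h.congr_deriv (by norm_num)

theorem cubic_surjective : Function.Surjective cubic := by
  refine contDiff_cubic.continuous.surjective ?_ ?_
  · refine tendsto_atTop_mono' _ ?_ tendsto_id
    filter_upwards [eventually_ge_atTop 0] with x hx
    simp only [cubic, id]
    have : 0 ≤ x ^ 3 := by positivity
    linarith
  · refine tendsto_atBot_mono' _ ?_ tendsto_id
    filter_upwards [eventually_le_atBot 0] with x hx
    simp only [cubic, id]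
    have : 0 ≤ (-x) ^ 3 := by have : 0 ≤ -x := by linarith
                              positivity
    nlinarith

/-- `u³ + u` as a homeomorphism of the line. -/
def cubicHomeo : ℝ ≃ₜ ℝ := (cubic_strictMono.orderIsoOfSurjective cubic cubic_surjective).toHomeomorph

/-- The inverse function of `u³ + u`. -/
def cubicInv : ℝ → ℝ := cubicHomeo.symm

theorem cubic_cubicInv (y : ℝ) : cubic (cubicInv y) = y := cubicHomeo.apply_symm_apply y

theorem cubicInv_cubic (x : ℝ) : cubicInv (cubic x) = x := cubicHomeo.symm_apply_apply x

theorem contDiff_cubicInv : ContDiff ℝ ∞ cubicInv :=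
  cubicHomeo.contDiff_symm_deriv (f' := fun x => 3 * x ^ 2 + 1) (fun x => by positivity)
    hasDerivAt_cubic contDiff_cubic

theorem cubicInv_le_iff {x y : ℝ} : cubicInv y ≤ x ↔ y ≤ cubic x := by
  rw [← cubic_strictMono.le_iff_le, cubic_cubicInv]

theorem le_cubicInv_iff {x y : ℝ} : x ≤ cubicInv y ↔ cubic x ≤ y := by
  rw [← cubic_strictMono.le_iff_le, cubic_cubicInv]

theorem sub_le_cubic_sub {x y : ℝ} (h : x ≤ y) : y - x ≤ cubic y - cubic x := by
  simp only [cubic]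
  have : x ^ 3 ≤ y ^ 3 := (Odd.strictMono_pow (by decide : Odd 3)).monotone h
  linarith

/-- The derivative of `w ↦ w⁻³ + w⁻¹`, evaluated at the nearest point of `[a,b]`. -/
def truncDeriv (a b s : ℝ) : ℝ :=
  -(3 * (max a (min b s))⁻¹ ^ 4 + (max a (min b s))⁻¹ ^ 2)

/-- The function `w ↦ w⁻³ + w⁻¹` on `[a,b]`, extended affinely as a `C¹` function. -/
def truncF (a b w : ℝ) : ℝ := cubic a⁻¹ + ∫ s in a..w, truncDeriv a b s

theorem hasDerivAt_cubic_inv {w : ℝ} (hw : w ≠ 0) :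
    HasDerivAt (fun w => cubic w⁻¹) (-(3 * w⁻¹ ^ 4 + w⁻¹ ^ 2)) w := by
  refine ((hasDerivAt_cubic w⁻¹).comp w (hasDerivAt_inv hw)).congr_deriv ?_
  field_simp

theorem continuous_truncDeriv {a b : ℝ} (ha : 0 < a) : Continuous (truncDeriv a b) := by
  have h1 : Continuous fun s => max a (min b s) := by fun_prop
  have h2 : Continuous fun s => (max a (min b s))⁻¹ :=
    h1.inv₀ fun s => (lt_of_lt_of_le ha (le_max_left _ _)).ne'
  unfold truncDeriv
  fun_prop

theorem truncF_eq {a b w : ℝ} (ha : 0 < a) (hw : w ∈ Icc a b) : truncF a b w = cubic w⁻¹ := by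
  have h1 : ∫ s in a..w, truncDeriv a b s = ∫ s in a..w, -(3 * s⁻¹ ^ 4 + s⁻¹ ^ 2) := by
    refine intervalIntegral.integral_congr fun s hs => ?_
    rw [uIcc_of_le hw.1] at hs
    have : max a (min b s) = s := by
      rw [min_eq_right (hs.2.trans hw.2), max_eq_right hs.1]
    simp only [truncDeriv, this]
  have hpos : ∀ s ∈ uIcc a w, s ≠ 0 := fun s hs => by
    rw [uIcc_of_le hw.1] at hs
    exact (ha.trans_le hs.1).ne'
  rw [truncF, h1, intervalIntegral.integral_eq_sub_of_hasDerivAt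
    (fun s hs => hasDerivAt_cubic_inv (hpos s hs))]
  · ring
  · refine ContinuousOn.intervalIntegrable ?_
    have h2 : ContinuousOn (fun s : ℝ => s⁻¹) (uIcc a w) := continuousOn_id.inv₀ hpos
    fun_prop

theorem decreasingBilipschitz_truncF {a b : ℝ} (ha : 0 < a) (hab : a ≤ b) :
    DecreasingBilipschitz (truncF a b) (truncDeriv a b) (3 * b⁻¹ ^ 4 + b⁻¹ ^ 2)
      (3 * a⁻¹ ^ 4 + a⁻¹ ^ 2) := by
  have hb : 0 < b := ha.trans_le hab
  have hm : ∀ s, a ≤ max a (min b s) ∧ max a (min b s) ≤ b := fun s =>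
    ⟨le_max_left _ _, max_le hab (min_le_left _ _)⟩
  refine ⟨fun x => ?_, continuous_truncDeriv ha, by positivity, fun x => ?_, fun x => ?_⟩
  · exact ((continuous_truncDeriv ha).integral_hasStrictDerivAt a x).hasDerivAt.const_add _
  · obtain ⟨h1, h2⟩ := hm x
    have h3 : b⁻¹ ≤ (max a (min b x))⁻¹ := inv_anti₀ (ha.trans_le h1) h2
    have h4 := pow_le_pow_left₀ (inv_nonneg.2 hb.le) h3 4
    have h5 := pow_le_pow_left₀ (inv_nonneg.2 hb.le) h3 2
    simp only [truncDeriv]; linarith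
  · obtain ⟨h1, h2⟩ := hm x
    have h3 : (max a (min b x))⁻¹ ≤ a⁻¹ := inv_anti₀ ha h1
    have h0 : 0 ≤ (max a (min b x))⁻¹ := inv_nonneg.2 (ha.le.trans h1)
    have h4 := pow_le_pow_left₀ h0 h3 4
    have h5 := pow_le_pow_left₀ h0 h3 2
    simp only [truncDeriv]; linarith

theorem DecreasingBilipschitz.strictAnti {f f' : ℝ → ℝ} {c C : ℝ}
    (h : DecreasingBilipschitz f f' c C) : StrictAnti f :=
  strictAnti_of_deriv_neg fun x => by
    rw [(h.hasDerivAt x).deriv]; linarith [h.le x, h.pos]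

theorem PerChain.abs_sub_le {d : ℕ → ℝ → ℝ} {E : ℝ} (h : PerChain 2 d)
    (hE : ∫ t in (0 : ℝ)..1, d 2 t ^ 2 ≤ E) (x y : ℝ) : |d 0 x - d 0 y| ≤ √E := by
  refine Real.abs_le_sqrt (le_trans ?_ hE)
  exact ((h.prim 0 (by norm_num)).sq_sub_le (h.per 0 (by norm_num)) (h.memLp_of_le (by norm_num))
    x y).trans (h.integral_sq_le (j := 0) (by norm_num))

theorem PerChain.exists_min {m : ℕ} {d : ℕ → ℝ → ℝ} (h : PerChain m d) (hm : 0 < m) :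
    ∃ h₀, ∀ x, d 0 h₀ ≤ d 0 x := by
  obtain ⟨h₀, -, hh⟩ := (isCompact_Icc (a := (0 : ℝ)) (b := 1)).exists_isMinOn (by simp)
    (h.continuous hm).continuousOn
  refine ⟨h₀, fun x => ?_⟩
  have h1 := (h.per 0 (Nat.zero_le _)).sub_int_mul_eq (x := x) ⌊x⌋
  rw [mul_one] at h1
  rw [← h1]
  exact hh ⟨Int.fract_nonneg x, (Int.fract_lt_one x).le⟩

/-- The a priori bounds that make the truncation inactive: if `v = f(w)` has `∫ (v_hh)² ≤ E` and
`∫ w = L`, then `v` takes its values in the range where `f` is the original nonlinearity. -/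
theorem mem_range_of_bounds {d : ℕ → ℝ → ℝ} (hd : PerChain 2 d) {L E a b : ℝ} (hL : 0 < L)
    (hE : ∫ t in (0 : ℝ)..1, d 2 t ^ 2 ≤ E) (ha : 0 < a) (haL : a ≤ L) (hLb : L ≤ b)
    (haE : cubic L⁻¹ + √E ≤ cubic a⁻¹) (hbE : b⁻¹ < lowerInit L E) {w : ℝ → ℝ}
    (hw : IntervalIntegrable w volume 0 1) (hwL : ∫ x in (0 : ℝ)..1, w x = L)
    (hdw : d 0 =ᵐ[unitMeasure] fun x => truncF a b (w x)) (x : ℝ) :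
    d 0 x ∈ Icc (cubic b⁻¹) (cubic a⁻¹) := by
  have hab : a ≤ b := haL.trans hLb
  have hb : 0 < b := ha.trans_le hab
  have hf := decreasingBilipschitz_truncF ha hab
  -- as `w` has mean `L`, somewhere `w ≥ L`, that is `v ≤ f(L)`; the oscillation of `v` is at most `√E`
  have hup : ∀ x, d 0 x ≤ cubic a⁻¹ := by
    obtain ⟨y, hy1, hy2⟩ : ∃ y, L ≤ w y ∧ d 0 y = truncF a b (w y) := by
      by_contra! hcon
      have h1 : ∀ᵐ y ∂unitMeasure, w y < L := by
        filter_upwards [hdw] with y hy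
        by_contra h2
        exact hcon y (not_lt.1 h2) hy
      have hwi : Integrable w unitMeasure :=
        (intervalIntegrable_iff_integrableOn_Icc_of_le zero_le_one).1 hw
      have h2 : ∫ y, (L - w y) ∂unitMeasure = 0 := by
        rw [integral_sub (integrable_const L) hwi, integral_unitMeasure w, hwL]
        simp
      have h2 := (integral_eq_zero_iff_of_nonneg_ae (f := fun y => L - w y)
        (h1.mono fun y hy => by simpa using hy.le) ((integrable_const L).sub hwi)).1 h2
      have h3 : ∀ᵐ y ∂unitMeasure, False := by
        filter_upwards [h1, h2] with y h1 h2
        simp only [Pi.zero_apply] at h2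
        linarith
      exact h3.exists.elim fun _ => id
    intro x
    have h1 := abs_le.1 (hd.abs_sub_le hE x y)
    have h2 : truncF a b (w y) ≤ truncF a b L := hf.strictAnti.antitone hy1
    rw [truncF_eq ha ⟨haL, hLb⟩] at h2
    linarith [h1.2]
  have hwa : ∀ᵐ y ∂unitMeasure, a ≤ w y := by
    filter_upwards [hdw] with y hy
    by_contra hcon
    have h1 := hf.strictAnti (not_le.1 hcon)
    rw [← hy, truncF_eq ha ⟨le_rfl, hab⟩] at h1
    exact absurd (hup y) (not_le.2 h1)
  refine ⟨?_, hup x⟩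
  obtain ⟨h₀, hmin⟩ := hd.exists_min (by norm_num)
  refine le_trans ?_ (hmin x)
  by_contra hcon
  rw [not_le] at hcon
  have hbi : 0 < b⁻¹ := inv_pos.2 hb
  -- if `v` falls below `f(b)`, the static bound applied to `max u b⁻¹`, whose minimum is `b⁻¹`,
  -- contradicts the choice of `b`
  have hJ : lowerJ L E ≤ b⁻¹ := by
    refine lowerJ_le hd hL hE hmin (q := fun x => max (cubicInv (d 0 x)) b⁻¹)
      (fun x => hbi.trans_le (le_max_right _ _)) (fun x => by simp [hd.per 0 (by norm_num) x])
      ((contDiff_cubicInv.continuous.comp (hd.continuous (by norm_num))).max continuous_const)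
      ?_ fun x => ?_
    · rw [← hwL]
      have hqc : Continuous fun x => (max (cubicInv (d 0 x)) b⁻¹)⁻¹ :=
        ((contDiff_cubicInv.continuous.comp (hd.continuous (by norm_num))).max
          continuous_const).inv₀ fun x => (hbi.trans_le (le_max_right _ _)).ne'
      refine intervalIntegral.integral_mono_ae_restrict zero_le_one
        (hqc.intervalIntegrable _ _) hw ?_
      filter_upwards [hdw, hwa] with y hy hya
      have hwy : 0 < w y := ha.trans_le hya
      rcases le_or_gt (w y) b with hyb | hyb
      · rw [truncF_eq ha ⟨hya, hyb⟩] at hy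
        rw [hy, cubicInv_cubic]
        exact (inv_anti₀ (inv_pos.2 hwy) (le_max_left _ _)).trans_eq (inv_inv _)
      · exact ((inv_anti₀ hbi (le_max_right _ _)).trans_eq (inv_inv _)).trans hyb.le
    · refine max_le ?_ (by linarith [hmin x])
      rcases le_total (cubicInv (d 0 x)) b⁻¹ with h1 | h1
      · linarith [hmin x]
      · have h2 := sub_le_cubic_sub h1
        rw [cubic_cubicInv] at h2
        linarith
  have h1 : lowerInit L E ≤ lowerJ L E := lowerInit_le_lowerJ hL le_rfl
  linarith

/-! ### Regularity of weak solutions -/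

theorem eq_of_ae_eq_of_periodic {f g : ℝ → ℝ} (h : f =ᵐ[unitMeasure] g) (hf : Continuous f)
    (hg : Continuous g) (hfp : Function.Periodic f 1) (hgp : Function.Periodic g 1) : f = g := by
  have h1 := Measure.eqOn_Icc_of_ae_eq volume zero_ne_one h hf.continuousOn hg.continuousOn
  funext x
  have h2 := hfp.sub_int_mul_eq (x := x) ⌊x⌋
  have h3 := hgp.sub_int_mul_eq (x := x) ⌊x⌋
  rw [mul_one] at h2 h3
  rw [← h2, ← h3]
  exact h1 ⟨Int.fract_nonneg x, (Int.fract_lt_one x).le⟩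

/-- `∫₀ᵗ g` for a function of time alone, with `g` extended by zero outside `[0,T]`. -/
def tPrim (T : ℝ) (g : ℝ → ℝ) (t : ℝ) : ℝ := ∫ s, (if s ≤ t then g s else 0) ∂timeMeasure T

theorem isPrim_tPrim {T : ℝ} {g : ℝ → ℝ} (hg : Integrable g (timeMeasure T)) :
    IsPrim (tPrim T g) ((Icc 0 T).indicator g) :=
  isPrim_timePrim (f := fun q => g q.1) (h := 0) hg

theorem tPrim_zero (T : ℝ) (g : ℝ → ℝ) {t : ℝ} (ht : t ≤ 0) : tPrim T g t = 0 :=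
  timePrim_zero (fun q => g q.1) ht 0

theorem tPrim_eq {T : ℝ} (g : ℝ → ℝ) {t : ℝ} (ht : t ∈ Icc 0 T) :
    tPrim T g t = ∫ s in (0 : ℝ)..t, g s := timePrim_eq (fun q => g q.1) ht 0

theorem integrable_ite_le {T : ℝ} {g : ℝ → ℝ} (hg : Integrable g (timeMeasure T)) (t : ℝ) :
    Integrable (fun s => if s ≤ t then g s else 0) (timeMeasure T) :=
  (hg.indicator measurableSet_Iic (s := Iic t)).congr (Eventually.of_forall fun s => by
    simp [indicator])

theorem fcoef_timePrim_eq_tPrim {T : ℝ} {f : ℝ × ℝ → ℝ} (hi : Integrable f (cylMeasure T)) (k : ℤ) (t : ℝ) :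
    fcoef (fun h => timePrim T f (t, h)) k = tPrim T (fun s => fcoef (fun h => f (s, h)) k) t :=
  fcoef_timePrim hi k t

section ParsevalInTime

variable {T : ℝ} {x y : ℝ × ℝ → ℝ}

theorem integrable_integral_mul (hx : MemLp x 2 (cylMeasure T)) (hy : MemLp y 2 (cylMeasure T)) :
    Integrable (fun t => ∫ h in (0 : ℝ)..1, x (t, h) * y (t, h)) (timeMeasure T) := by
  have h1 : Integrable (fun p => x p * y p) (cylMeasure T) := hx.integrable_mul hy
  refine h1.integral_prod_left.congr (Eventually.of_forall fun t => ?_)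
  exact integral_unitMeasure _

theorem fcoef_sq_le {f : ℝ → ℝ} (hf : MemLp f 2 unitMeasure) (k : ℤ) :
    fcoef f k ^ 2 ≤ ∫ h in (0 : ℝ)..1, f h * f h := by
  have h1 := hasSum_fcoef_mul_fcoef hf hf
  rw [sq]
  exact le_hasSum h1 k fun j _ => mul_self_nonneg _

theorem integrable_fcoef_sq (hx : StronglyMeasurable x) (hx2 : MemLp x 2 (cylMeasure T)) (k : ℤ) :
    Integrable (fun t => fcoef (fun h => x (t, h)) k ^ 2) (timeMeasure T) := by
  refine (integrable_integral_mul hx2 hx2).mono'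
    ((stronglyMeasurable_fcoef hx k).pow 2).aestronglyMeasurable ?_
  filter_upwards [ae_memLp_slice hx2] with t ht
  rw [Real.norm_eq_abs, abs_of_nonneg (sq_nonneg _)]
  exact fcoef_sq_le ht k

theorem summable_integral_fcoef_sq (hx : StronglyMeasurable x) (hx2 : MemLp x 2 (cylMeasure T)) :
    Summable fun k => ∫ t, fcoef (fun h => x (t, h)) k ^ 2 ∂timeMeasure T := by
  refine summable_of_sum_le (c := ∫ t, (∫ h in (0 : ℝ)..1, x (t, h) * x (t, h)) ∂timeMeasure T)
    (fun k => integral_nonneg fun t => sq_nonneg _) fun s => ?_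
  rw [← integral_finsetSum _ fun k _ => integrable_fcoef_sq hx hx2 k]
  have h1 : Integrable (fun t => ∑ k ∈ s, fcoef (fun h => x (t, h)) k ^ 2) (timeMeasure T) :=
    integrable_finsetSum s fun k _ => integrable_fcoef_sq hx hx2 k
  refine integral_mono_ae h1 (integrable_integral_mul hx2 hx2) ?_
  filter_upwards [ae_memLp_slice hx2] with t ht
  have := sum_le_hasSum s (fun j _ => mul_self_nonneg _) (hasSum_fcoef_mul_fcoef ht ht)
  simpa only [sq] using this

theorem abs_mul_le_sq_add_sq (a b : ℝ) : |a * b| ≤ a ^ 2 + b ^ 2 := by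
  rw [abs_le]; constructor <;> nlinarith [sq_nonneg (a + b), sq_nonneg (a - b)]

theorem integrable_fcoef_mul (hx : StronglyMeasurable x) (hx2 : MemLp x 2 (cylMeasure T))
    (hy : StronglyMeasurable y) (hy2 : MemLp y 2 (cylMeasure T)) (k : ℤ) :
    Integrable (fun t => fcoef (fun h => x (t, h)) k * fcoef (fun h => y (t, h)) k)
      (timeMeasure T) :=
  ((integrable_fcoef_sq hx hx2 k).add (integrable_fcoef_sq hy hy2 k)).mono'
    ((stronglyMeasurable_fcoef hx k).mul (stronglyMeasurable_fcoef hy k)).aestronglyMeasurable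
    (Eventually.of_forall fun _ => abs_mul_le_sq_add_sq _ _)

theorem summable_integral_abs_fcoef_mul (hx : StronglyMeasurable x)
    (hx2 : MemLp x 2 (cylMeasure T)) (hy : StronglyMeasurable y) (hy2 : MemLp y 2 (cylMeasure T)) :
    Summable fun k => ∫ t, |fcoef (fun h => x (t, h)) k * fcoef (fun h => y (t, h)) k|
      ∂timeMeasure T := by
  refine Summable.of_nonneg_of_le (fun k => integral_nonneg fun t => abs_nonneg _) (fun k => ?_)
    ((summable_integral_fcoef_sq hx hx2).add (summable_integral_fcoef_sq hy hy2))
  rw [← integral_add (integrable_fcoef_sq hx hx2 k) (integrable_fcoef_sq hy hy2 k)]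
  exact integral_mono (integrable_fcoef_mul hx hx2 hy hy2 k).abs
    ((integrable_fcoef_sq hx hx2 k).add (integrable_fcoef_sq hy hy2 k))
    fun t => abs_mul_le_sq_add_sq _ _

/-- Parseval's identity in `h`, integrated over `[0,t]`. -/
theorem hasSum_tPrim_fcoef_mul (hx : StronglyMeasurable x) (hx2 : MemLp x 2 (cylMeasure T))
    (hy : StronglyMeasurable y) (hy2 : MemLp y 2 (cylMeasure T)) (t : ℝ) :
    HasSum (fun k => tPrim T (fun s => fcoef (fun h => x (s, h)) k * fcoef (fun h => y (s, h)) k) t)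
      (tPrim T (fun s => ∫ h in (0 : ℝ)..1, x (s, h) * y (s, h)) t) := by
  let F : ℤ → ℝ → ℝ := fun k s =>
    if s ≤ t then fcoef (fun h => x (s, h)) k * fcoef (fun h => y (s, h)) k else 0
  have hF : Summable fun k => ∫ s, ‖F k s‖ ∂timeMeasure T := ?_
  · have h1 := hasSum_integral_of_summable_integral_norm
      (fun k => integrable_ite_le (integrable_fcoef_mul hx hx2 hy hy2 k) t) hF
    have e : ∫ s, (∑' k, F k s) ∂timeMeasure T =
        tPrim T (fun s => ∫ h in (0 : ℝ)..1, x (s, h) * y (s, h)) t := ?_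
    · rw [← e]; exact h1
    refine integral_congr_ae ?_
    filter_upwards [ae_memLp_slice hx2, ae_memLp_slice hy2] with s hsx hsy
    simp only [F]
    split_ifs with hs
    · exact (hasSum_fcoef_mul_fcoef hsx hsy).tsum_eq
    · simp
  · refine Summable.of_nonneg_of_le (fun k => integral_nonneg fun t => norm_nonneg _) (fun k => ?_)
      (summable_integral_abs_fcoef_mul hx hx2 hy hy2)
    refine integral_mono (integrable_ite_le (integrable_fcoef_mul hx hx2 hy hy2 k) t).norm
      (integrable_fcoef_mul hx hx2 hy hy2 k).abs fun s => ?_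
    simp only [F]
    split_ifs
    · exact le_rfl
    · rw [norm_zero]; exact abs_nonneg _

end ParsevalInTime

theorem memLp_timePrim_slice {T : ℝ} {p : ℝ × ℝ → ℝ} (hp : StronglyMeasurable p)
    (hp2 : MemLp p 2 (cylMeasure T)) (t : ℝ) :
    MemLp (fun h => timePrim T p (t, h)) 2 unitMeasure := by
  have hm : Measurable fun h => ∫⁻ s, ‖p (s, h)‖ₑ ^ 2 ∂timeMeasure T :=
    (hp.measurable.enorm.pow_const 2).lintegral_prod_left'
  refine (memLp_two_iff_lintegral ((stronglyMeasurable_timePrim hp).measurable.comp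
    (by fun_prop : Measurable fun h : ℝ => (t, h))).aestronglyMeasurable).2 ?_
  refine (lintegral_mono fun h => enorm_timePrim_sq_le hp (t, h)).trans_lt ?_
  rw [lintegral_const_mul _ hm, ← lintegral_cyl_symm (hp.measurable.enorm.pow_const 2)]
  exact ENNReal.mul_lt_top (measure_lt_top _ _)
    ((memLp_two_iff_lintegral hp.aestronglyMeasurable).1 hp2)

theorem PerChain.hasSum_freq_mul_sq {d : ℕ → ℝ → ℝ} (hd : PerChain 2 d) :
    HasSum (fun k => freq k ^ 4 * fcoef (d 0) k ^ 2) (∫ h in (0 : ℝ)..1, d 2 h ^ 2) := by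
  convert hasSum_fcoef_sq hd.memLp using 2 with k
  rw [hd.fcoef_even (n := 1)]
  ring

/-- A solution `w = w₀ + ∫₀ᵗ η` of `w_t = ∂⁴ f(w)` in the sense of coefficients, with datum `w₀`
for which `f ∘ w₀` has the derivatives `d₀`. -/
structure WeakSol (T : ℝ) (f f' : ℝ → ℝ) (c C : ℝ) (w₀ : ℝ → ℝ) (d₀ : ℕ → ℝ → ℝ)
    (η : ℝ × ℝ → ℝ) : Prop where
  nonlin : DecreasingBilipschitz f f' c C
  cont : Continuous w₀
  chain : PerChain 2 d₀
  datum : ∀ h, d₀ 0 h = f (w₀ h)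
  meas : StronglyMeasurable η
  sqInt : MemLp η 2 (cylMeasure T)
  eqn : ∀ᵐ t ∂timeMeasure T, ∀ k, fcoef (fun h => η (t, h)) k =
    freq k ^ 4 * fcoef (fun h => f (w₀ h + timePrim T η (t, h))) k

namespace WeakSol

variable {T : ℝ} {f f' : ℝ → ℝ} {c C : ℝ} {w₀ : ℝ → ℝ} {d₀ : ℕ → ℝ → ℝ} {η : ℝ × ℝ → ℝ}

/-- The time derivative of `f(w)`. -/
def rate (T : ℝ) (f' w₀ : ℝ → ℝ) (η : ℝ × ℝ → ℝ) (q : ℝ × ℝ) : ℝ :=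
  f' (w₀ q.2 + timePrim T η q) * η q

/-- The Fourier coefficients of `f(w)`. -/
def vcoef (T : ℝ) (f w₀ : ℝ → ℝ) (η : ℝ × ℝ → ℝ) (k : ℤ) (t : ℝ) : ℝ :=
  fcoef (fun h => f (w₀ h + timePrim T η (t, h))) k

/-- The energy `∫ (f(w)_hh)²` at time `t`, computed from its dissipation. -/
def energy (T : ℝ) (f' w₀ : ℝ → ℝ) (d₀ : ℕ → ℝ → ℝ) (η : ℝ × ℝ → ℝ) (t : ℝ) : ℝ :=
  (∫ h in (0 : ℝ)..1, d₀ 2 h ^ 2) +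
    2 * tPrim T (fun s => ∫ h in (0 : ℝ)..1, η (s, h) * rate T f' w₀ η (s, h)) t

theorem meas_w (sol : WeakSol T f f' c C w₀ d₀ η) :
    StronglyMeasurable fun q : ℝ × ℝ => w₀ q.2 + timePrim T η q :=
  (sol.cont.stronglyMeasurable.comp_measurable measurable_snd).add
    (stronglyMeasurable_timePrim sol.meas)

theorem meas_rate (sol : WeakSol T f f' c C w₀ d₀ η) : StronglyMeasurable (rate T f' w₀ η) :=
  (sol.nonlin.continuous_deriv.comp_stronglyMeasurable sol.meas_w).mul sol.meas

theorem sqInt_rate (sol : WeakSol T f f' c C w₀ d₀ η) :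
    MemLp (rate T f' w₀ η) 2 (cylMeasure T) := by
  refine sol.sqInt.of_le_mul (c := C) sol.meas_rate.aestronglyMeasurable
    (Eventually.of_forall fun q => ?_)
  rw [rate, norm_mul]
  refine mul_le_mul_of_nonneg_right ?_ (norm_nonneg _)
  rw [Real.norm_eq_abs, abs_le]
  have := sol.nonlin.pos
  have h1 := sol.nonlin.le (w₀ q.2 + timePrim T η q)
  have h2 := sol.nonlin.ge (w₀ q.2 + timePrim T η q)
  constructor <;> linarith

theorem isPrim_w (sol : WeakSol T f f' c C w₀ d₀ η) : ∀ᵐ h ∂unitMeasure,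
    IsPrim (fun t => w₀ h + timePrim T η (t, h)) ((Icc 0 T).indicator fun t => η (t, h)) := by
  filter_upwards [ae_integrable_time (integrable_of_memLp sol.sqInt)] with h hh
  have hp := isPrim_timePrim hh
  exact ⟨hp.locInt, fun t => by rw [hp.eq t]; ring⟩

/-- The chain rule in time: `f(w) = f(w₀) + ∫₀ᵗ f'(w) η`. -/
theorem nonlin_eq (sol : WeakSol T f f' c C w₀ d₀ η) : ∀ᵐ h ∂unitMeasure, ∀ t,
    f (w₀ h + timePrim T η (t, h)) = d₀ 0 h + timePrim T (rate T f' w₀ η) (t, h) := by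
  filter_upwards [sol.isPrim_w, ae_integrable_time (integrable_of_memLp sol.sqInt_rate)]
    with h hw hr t
  have h1 := (hw.comp (Φ := f) (Φ' := f') (fun _ => sol.nonlin.hasDerivAt _)
    (sol.nonlin.continuous_deriv.comp hw.continuous)).eq t
  have h2 := (isPrim_timePrim hr).eq t
  have h3 : (fun t => f' (w₀ h + timePrim T η (t, h)) * (Icc 0 T).indicator (fun t => η (t, h)) t)
      = (Icc 0 T).indicator fun t => rate T f' w₀ η (t, h) := by
    funext s
    by_cases hs : s ∈ Icc 0 T
    · simp only [indicator_of_mem hs, rate]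
    · simp only [indicator_of_notMem hs, mul_zero]
  rw [h3] at h1
  simp only [timePrim_zero _ le_rfl, add_zero, zero_add] at h1 h2
  rw [h1, h2, sol.datum]

theorem memLp_v (sol : WeakSol T f f' c C w₀ d₀ η) (t : ℝ) :
    MemLp (fun h => f (w₀ h + timePrim T η (t, h))) 2 unitMeasure := by
  refine ((sol.chain.memLp_of_le (Nat.zero_le _)).add
    (memLp_timePrim_slice sol.meas_rate sol.sqInt_rate t)).ae_eq ?_
  filter_upwards [sol.nonlin_eq] with h hh
  exact (hh t).symm

theorem vcoef_eq (sol : WeakSol T f f' c C w₀ d₀ η) (k : ℤ) (t : ℝ) :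
    vcoef T f w₀ η k t = fcoef (d₀ 0) k +
      tPrim T (fun s => fcoef (fun h => rate T f' w₀ η (s, h)) k) t := by
  have h1 : fcoef (fun h => timePrim T (rate T f' w₀ η) (t, h)) k =
      vcoef T f w₀ η k t - fcoef (d₀ 0) k := by
    rw [vcoef, ← fcoef_sub (memLp_intervalIntegrable (sol.memLp_v t))
      (memLp_intervalIntegrable (sol.chain.memLp_of_le (Nat.zero_le _)))]
    refine fcoef_congr ?_ k
    filter_upwards [sol.nonlin_eq] with h hh
    rw [hh t]; ring
  rw [← fcoef_timePrim_eq_tPrim (integrable_of_memLp sol.sqInt_rate), h1]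
  ring

theorem integrable_rate_fcoef (sol : WeakSol T f f' c C w₀ d₀ η) (k : ℤ) :
    Integrable (fun s => fcoef (fun h => rate T f' w₀ η (s, h)) k) (timeMeasure T) := by
  refine MemLp.integrable (q := 2) (by norm_num) ?_
  rw [memLp_two_iff_integrable_sq (stronglyMeasurable_fcoef sol.meas_rate k).aestronglyMeasurable]
  exact integrable_fcoef_sq sol.meas_rate sol.sqInt_rate k

theorem isPrim_vcoef (sol : WeakSol T f f' c C w₀ d₀ η) (k : ℤ) :
    IsPrim (vcoef T f w₀ η k)
      ((Icc 0 T).indicator fun s => fcoef (fun h => rate T f' w₀ η (s, h)) k) := by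
  have h1 := isPrim_tPrim (sol.integrable_rate_fcoef k)
  refine ⟨h1.locInt, fun t => ?_⟩
  rw [sol.vcoef_eq, sol.vcoef_eq k 0, h1.eq t]
  ring

/-- The balance of energy in a single mode: the time derivative of `μ v_k²` is `2 μ v_k (v_k)_t`, and
`μ v_k = η_k` by the equation. -/
theorem freq_mul_vcoef_sq (sol : WeakSol T f f' c C w₀ d₀ η) (k : ℤ) (t : ℝ) :
    freq k ^ 4 * vcoef T f w₀ η k t ^ 2 = freq k ^ 4 * fcoef (d₀ 0) k ^ 2 +
      2 * tPrim T (fun s => fcoef (fun h => η (s, h)) k *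
        fcoef (fun h => rate T f' w₀ η (s, h)) k) t := by
  have h1 := ((sol.isPrim_vcoef k).sq.const_mul (freq k ^ 4)).eq t
  have h2 := ((isPrim_tPrim (integrable_fcoef_mul sol.meas sol.sqInt sol.meas_rate
    sol.sqInt_rate k)).const_mul 2).eq t
  have h3 := sol.vcoef_eq k 0
  rw [tPrim_zero _ _ le_rfl, add_zero] at h3
  rw [h1, h2, tPrim_zero _ _ le_rfl, h3, mul_zero, zero_add]
  congr 1
  refine intervalIntegral.integral_congr_ae ?_
  have h4 := (ae_restrict_iff' measurableSet_Icc).1 sol.eqn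
  filter_upwards [h4] with s hs _
  by_cases hsT : s ∈ Icc 0 T
  · simp only [indicator_of_mem hsT]
    rw [hs hsT k, vcoef]
    ring
  · simp only [indicator_of_notMem hsT, mul_zero]

theorem hasSum_datum (sol : WeakSol T f f' c C w₀ d₀ η) :
    HasSum (fun k => freq k ^ 4 * fcoef (d₀ 0) k ^ 2) (∫ h in (0 : ℝ)..1, d₀ 2 h ^ 2) :=
  sol.chain.hasSum_freq_mul_sq

theorem hasSum_vcoef (sol : WeakSol T f f' c C w₀ d₀ η) (t : ℝ) :
    HasSum (fun k => freq k ^ 4 * vcoef T f w₀ η k t ^ 2) (energy T f' w₀ d₀ η t) := by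
  simp only [sol.freq_mul_vcoef_sq]
  exact sol.hasSum_datum.add
    ((hasSum_tPrim_fcoef_mul sol.meas sol.sqInt sol.meas_rate sol.sqInt_rate t).mul_left 2)

theorem energy_le (sol : WeakSol T f f' c C w₀ d₀ η) (t : ℝ) :
    energy T f' w₀ d₀ η t ≤ ∫ h in (0 : ℝ)..1, d₀ 2 h ^ 2 := by
  have : tPrim T (fun s => ∫ h in (0 : ℝ)..1, η (s, h) * rate T f' w₀ η (s, h)) t ≤ 0 := by
    refine integral_nonpos fun s => ?_
    simp only
    split_ifs
    · rw [← integral_unitMeasure]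
      refine integral_nonpos fun h => ?_
      have h1 : f' (w₀ h + timePrim T η (s, h)) ≤ 0 :=
        (sol.nonlin.le _).trans (neg_nonpos.2 sol.nonlin.pos.le)
      simp only [rate, Pi.zero_apply]
      nlinarith [mul_self_nonneg (η (s, h))]
    · exact le_rfl
  rw [energy]
  linarith

/-- A summable majorant for `freq k ^ 4 * vcoef k t ^ 2`, uniform in time. -/
theorem exists_bound (sol : WeakSol T f f' c C w₀ d₀ η) : ∃ B : ℤ → ℝ, Summable B ∧
    ∀ k t, freq k ^ 4 * vcoef T f w₀ η k t ^ 2 ≤ B k := by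
  refine ⟨_, sol.hasSum_datum.summable.add ((summable_integral_abs_fcoef_mul sol.meas sol.sqInt
    sol.meas_rate sol.sqInt_rate).mul_left 2), fun k t => ?_⟩
  rw [sol.freq_mul_vcoef_sq]
  have hi := integrable_fcoef_mul sol.meas sol.sqInt sol.meas_rate sol.sqInt_rate k
  refine add_le_add le_rfl (mul_le_mul_of_nonneg_left ?_ (by norm_num))
  refine integral_mono (integrable_ite_le hi t) hi.abs fun s => ?_
  simp only
  split_ifs
  · exact le_abs_self _
  · exact abs_nonneg _

theorem exists_chain (sol : WeakSol T f f' c C w₀ d₀ η) (t : ℝ) : ∃ d, PerChain 2 d ∧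
    d 0 =ᵐ[unitMeasure] fun h => f (w₀ h + timePrim T η (t, h)) := by
  obtain ⟨y, hy, hyk⟩ := exists_fcoef_eq (c := fun k => -freq k ^ 2 * vcoef T f w₀ η k t)
    ((sol.hasSum_vcoef t).summable.congr fun k => by ring)
  obtain ⟨d, hd, -, hd0⟩ := exists_perChain_of_fcoef (n := 1) le_rfl (sol.memLp_v t) hy
    fun k => by rw [hyk, pow_one, vcoef]
  exact ⟨d, hd, hd0⟩

/-- The derivatives in `h` of the continuous representative of `f(w)` at time `t`. -/
def derivs (sol : WeakSol T f f' c C w₀ d₀ η) (t : ℝ) : ℕ → ℝ → ℝ := (sol.exists_chain t).choose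

theorem perChain_derivs (sol : WeakSol T f f' c C w₀ d₀ η) (t : ℝ) : PerChain 2 (sol.derivs t) :=
  (sol.exists_chain t).choose_spec.1

theorem derivs_zero_ae (sol : WeakSol T f f' c C w₀ d₀ η) (t : ℝ) :
    sol.derivs t 0 =ᵐ[unitMeasure] fun h => f (w₀ h + timePrim T η (t, h)) :=
  (sol.exists_chain t).choose_spec.2

theorem fcoef_derivs_zero (sol : WeakSol T f f' c C w₀ d₀ η) (t : ℝ) (k : ℤ) :
    fcoef (sol.derivs t 0) k = vcoef T f w₀ η k t := fcoef_congr (sol.derivs_zero_ae t) k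

theorem integral_derivs_two_sq (sol : WeakSol T f f' c C w₀ d₀ η) (t : ℝ) :
    ∫ h in (0 : ℝ)..1, sol.derivs t 2 h ^ 2 = energy T f' w₀ d₀ η t := by
  refine (sol.perChain_derivs t).hasSum_freq_mul_sq.unique ?_
  simpa only [sol.fcoef_derivs_zero] using sol.hasSum_vcoef t

theorem tendsto_integral_two (sol : WeakSol T f f' c C w₀ d₀ η) (t : ℝ) :
    Tendsto (fun s => ∫ h in (0 : ℝ)..1, (sol.derivs s 2 h - sol.derivs t 2 h) ^ 2) (𝓝 t) (𝓝 0) := by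
  obtain ⟨B, hB, hBk⟩ := sol.exists_bound
  have hs : ∀ s, HasSum (fun k => freq k ^ 4 * (vcoef T f w₀ η k s - vcoef T f w₀ η k t) ^ 2)
      (∫ h in (0 : ℝ)..1, (sol.derivs s 2 h - sol.derivs t 2 h) ^ 2) := by
    intro s
    have hc := (sol.perChain_derivs s).sub (sol.perChain_derivs t)
    convert hasSum_fcoef_sq hc.memLp using 2 with k
    rw [hc.fcoef_even (n := 1), fcoef_sub, sol.fcoef_derivs_zero, sol.fcoef_derivs_zero]
    · ring
    · exact memLp_intervalIntegrable ((sol.perChain_derivs s).memLp_of_le (Nat.zero_le _))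
    · exact memLp_intervalIntegrable ((sol.perChain_derivs t).memLp_of_le (Nat.zero_le _))
  have h1 := tendsto_tsum_of_dominated_convergence (𝓕 := 𝓝 t) (g := fun _ : ℤ => (0 : ℝ))
    (f := fun s k => freq k ^ 4 * (vcoef T f w₀ η k s - vcoef T f w₀ η k t) ^ 2)
    (hB.mul_left 4) (fun k => ?_) (Eventually.of_forall fun s k => ?_)
  · simpa only [(hs _).tsum_eq, tsum_zero] using h1
  · have h2 : Continuous fun s => freq k ^ 4 * (vcoef T f w₀ η k s - vcoef T f w₀ η k t) ^ 2 := by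
      have := (sol.isPrim_vcoef k).continuous
      fun_prop
    simpa using h2.tendsto t
  · have h3 : 0 ≤ freq k ^ 4 := by positivity
    rw [Real.norm_eq_abs, abs_of_nonneg (by positivity)]
    nlinarith [hBk k s, hBk k t, mul_nonneg h3 (sq_nonneg (vcoef T f w₀ η k s + vcoef T f w₀ η k t))]

/-- Continuity in `L²` of `f(w)`: every mode but the mean is controlled by the second derivative. -/
theorem tendsto_integral_zero (sol : WeakSol T f f' c C w₀ d₀ η) (t : ℝ) :
    Tendsto (fun s => ∫ h in (0 : ℝ)..1, (sol.derivs s 0 h - sol.derivs t 0 h) ^ 2) (𝓝 t) (𝓝 0) := by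
  have h0 : Tendsto (fun s => (vcoef T f w₀ η 0 s - vcoef T f w₀ η 0 t) ^ 2) (𝓝 t) (𝓝 0) := by
    have h2 : Continuous fun s => (vcoef T f w₀ η 0 s - vcoef T f w₀ η 0 t) ^ 2 := by
      have := (sol.isPrim_vcoef 0).continuous
      fun_prop
    simpa using h2.tendsto t
  have h1 := (sol.tendsto_integral_two t).add h0
  rw [add_zero] at h1
  refine squeeze_zero (fun s => intervalIntegral.integral_nonneg zero_le_one fun h _ =>
    sq_nonneg _) (fun s => ?_) h1
  have hc := (sol.perChain_derivs s).sub (sol.perChain_derivs t)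
  have e0 : fcoef (fun h => sol.derivs s 0 h - sol.derivs t 0 h) 0 =
      vcoef T f w₀ η 0 s - vcoef T f w₀ η 0 t := by
    rw [fcoef_sub, sol.fcoef_derivs_zero, sol.fcoef_derivs_zero]
    · exact memLp_intervalIntegrable ((sol.perChain_derivs s).memLp_of_le (Nat.zero_le _))
    · exact memLp_intervalIntegrable ((sol.perChain_derivs t).memLp_of_le (Nat.zero_le _))
  rw [← e0]
  refine hasSum_le (fun k => ?_) (hasSum_fcoef_sq (hc.memLp_of_le (Nat.zero_le _)))
    ((hasSum_fcoef_sq hc.memLp).add (hasSum_ite_eq (0 : ℤ)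
      (fcoef (fun h => sol.derivs s 0 h - sol.derivs t 0 h) 0 ^ 2)))
  rcases eq_or_ne k 0 with rfl | hk
  · rw [if_pos rfl]
    exact le_add_of_nonneg_left (sq_nonneg _)
  · rw [if_neg hk, add_zero, hc.fcoef_even (n := 1), pow_one, mul_pow]
    refine le_mul_of_one_le_left (sq_nonneg _) ?_
    have h2 : (1 : ℝ) ≤ (k : ℝ) ^ 2 := by
      rw [one_le_sq_iff_one_le_abs]
      exact_mod_cast Int.one_le_abs hk
    have h3 : 1 ≤ freq k ^ 2 := by
      rw [freq, mul_pow]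
      nlinarith [Real.pi_gt_three]
    nlinarith

theorem tendsto_integral_one (sol : WeakSol T f f' c C w₀ d₀ η) (t : ℝ) :
    Tendsto (fun s => ∫ h in (0 : ℝ)..1, (sol.derivs s 1 h - sol.derivs t 1 h) ^ 2) (𝓝 t) (𝓝 0) :=
  squeeze_zero (fun s => intervalIntegral.integral_nonneg zero_le_one fun h _ => sq_nonneg _)
    (fun s => ((sol.perChain_derivs s).sub (sol.perChain_derivs t)).integral_sq_le (j := 0)
      (by norm_num)) (sol.tendsto_integral_two t)

theorem tendsto_integral (sol : WeakSol T f f' c C w₀ d₀ η) {j : ℕ} (hj : j ≤ 2) (t : ℝ) :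
    Tendsto (fun s => ∫ h in (0 : ℝ)..1, (sol.derivs s j h - sol.derivs t j h) ^ 2) (𝓝 t) (𝓝 0) := by
  interval_cases j
  exacts [sol.tendsto_integral_zero t, sol.tendsto_integral_one t, sol.tendsto_integral_two t]

/-- The continuous representatives of `f(w)` and of its first derivative in `h` are jointly
continuous, as convergence in `H²` is uniform. -/
theorem continuous_derivs (sol : WeakSol T f f' c C w₀ d₀ η) {j : ℕ} (hj : j < 2) :
    Continuous fun q : ℝ × ℝ => sol.derivs q.1 j q.2 := by
  rw [continuous_iff_continuousAt]
  rintro ⟨t, h⟩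
  have h1 : Tendsto (fun q : ℝ × ℝ => √(∫ h in (0 : ℝ)..1, (sol.derivs q.1 j h - sol.derivs t j h) ^ 2)
      + √(∫ h in (0 : ℝ)..1, (sol.derivs q.1 (j + 1) h - sol.derivs t (j + 1) h) ^ 2) +
      |sol.derivs t j q.2 - sol.derivs t j h|) (𝓝 (t, h)) (𝓝 0) := by
    have h2 := ((sol.tendsto_integral hj.le t).comp
      (continuous_fst.tendsto (t, h))).sqrt
    have h3 := ((sol.tendsto_integral (j := j + 1) hj t).comp
      (continuous_fst.tendsto (t, h))).sqrt
    have h4 : Continuous fun q : ℝ × ℝ => |sol.derivs t j q.2 - sol.derivs t j h| := by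
      have := (sol.perChain_derivs t).continuous hj
      fun_prop
    simpa using (h2.add h3).add (h4.tendsto (t, h))
  rw [ContinuousAt, tendsto_iff_dist_tendsto_zero]
  refine squeeze_zero (fun q => dist_nonneg) (fun q => ?_) h1
  have hc := (sol.perChain_derivs q.1).sub (sol.perChain_derivs t)
  have h5 := (hc.prim j hj).abs_le (hc.per j hj.le) (hc.memLp_of_le (j := j + 1) hj) q.2
  rw [Real.dist_eq]
  calc |sol.derivs q.1 j q.2 - sol.derivs t j h|
      ≤ |sol.derivs q.1 j q.2 - sol.derivs t j q.2| + |sol.derivs t j q.2 - sol.derivs t j h| :=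
        abs_sub_le _ _ _
    _ ≤ _ := add_le_add h5 le_rfl

/-- At almost every time `f(w)` belongs to `H⁴_per`, and `η` is its fourth derivative. -/
theorem ae_exists_perChain_four (sol : WeakSol T f f' c C w₀ d₀ η) : ∀ᵐ t ∂timeMeasure T,
    ∃ d, PerChain 4 d ∧ d 0 = sol.derivs t 0 ∧ (d 4 = fun x => η (t, Int.fract x)) := by
  filter_upwards [sol.eqn, ae_memLp_slice sol.sqInt] with t ht htm
  have hD := sol.perChain_derivs t
  obtain ⟨d, hd, h4, h0⟩ := exists_perChain_of_fcoef (n := 2) (by norm_num)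
    (hD.memLp_of_le (Nat.zero_le _)) htm fun k => by
      rw [ht k, fcoef_congr (sol.derivs_zero_ae t) k]; ring
  exact ⟨d, hd, eq_of_ae_eq_of_periodic h0 (hd.continuous (by norm_num))
    (hD.continuous (by norm_num)) (hd.per 0 (Nat.zero_le _)) (hD.per 0 (Nat.zero_le _)), h4⟩

/-- In the time integral of the dissipation of `∫ G(w)`, for `G' = -f`, the identity
`∫ f(w) w_t = ∫ (f(w)_hh)²` holds at almost every time. -/
theorem ae_integral_mul_eq_energy (sol : WeakSol T f f' c C w₀ d₀ η) : ∀ᵐ t ∂timeMeasure T,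
    ∫ h in (0 : ℝ)..1, f (w₀ h + timePrim T η (t, h)) * η (t, h) = energy T f' w₀ d₀ η t := by
  filter_upwards [sol.eqn, ae_memLp_slice sol.sqInt] with t ht htm
  refine (hasSum_fcoef_mul_fcoef (sol.memLp_v t) htm).unique ?_
  convert sol.hasSum_vcoef t using 2 with k
  rw [ht k, vcoef]
  ring

/-- The mean of `w` is conserved. -/
theorem integral_w (sol : WeakSol T f f' c C w₀ d₀ η) (t : ℝ) :
    ∫ h in (0 : ℝ)..1, (w₀ h + timePrim T η (t, h)) = ∫ h in (0 : ℝ)..1, w₀ h := by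
  rw [intervalIntegral.integral_add (sol.cont.intervalIntegrable _ _)
    (memLp_intervalIntegrable (memLp_timePrim_slice sol.meas sol.sqInt t))]
  have h1 := fcoef_timePrim (integrable_of_memLp sol.sqInt) 0 t
  have h2 : ∫ s, (if s ≤ t then fcoef (fun h => η (s, h)) 0 else 0) ∂timeMeasure T = 0 := by
    refine integral_eq_zero_of_ae ?_
    filter_upwards [sol.eqn] with s hs
    simp [hs 0, freq_zero]
  rw [h2] at h1
  simp only [fcoef, cas_zero, mul_one] at h1
  rw [h1, add_zero]

end WeakSol

/-! ### Composition in the norms of `H²` and `H⁴` -/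

theorem exists_bound_near {g : ℝ → ℝ → ℝ} (hg : Continuous fun q : ℝ × ℝ => g q.1 q.2) (t : ℝ) :
    ∃ M, ∀ᶠ s in 𝓝 t, ∀ h ∈ Icc (0 : ℝ) 1, |g s h| ≤ M := by
  obtain ⟨M, hM⟩ := ((isCompact_Icc (a := t - 1) (b := t + 1)).prod
    (isCompact_Icc (a := (0 : ℝ)) (b := 1))).exists_bound_of_continuousOn hg.continuousOn
  refine ⟨M, ?_⟩
  filter_upwards [Icc_mem_nhds (by linarith : t - 1 < t) (by linarith : t < t + 1)] with s hs h hh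
  exact hM (s, h) ⟨hs, hh⟩

theorem ae_unit_mem : ∀ᵐ h ∂unitMeasure, h ∈ Icc (0 : ℝ) 1 := ae_restrict_mem measurableSet_Icc

theorem integral_unit_mono {f g : ℝ → ℝ} (hf : IntervalIntegrable f volume 0 1)
    (hg : IntervalIntegrable g volume 0 1) (h : ∀ᵐ x ∂unitMeasure, f x ≤ g x) :
    ∫ x in (0 : ℝ)..1, f x ≤ ∫ x in (0 : ℝ)..1, g x :=
  intervalIntegral.integral_mono_ae_restrict zero_le_one hf hg h

theorem tendsto_integral_mul_sq_of_continuous {g : ℝ → ℝ → ℝ} {y : ℝ → ℝ}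
    (hg : Continuous fun q : ℝ × ℝ => g q.1 q.2) (hy : MemLp y 2 unitMeasure) {t : ℝ}
    (h0 : ∀ h, g t h = 0) :
    Tendsto (fun s => ∫ h in (0 : ℝ)..1, (g s h * y h) ^ 2) (𝓝 t) (𝓝 0) := by
  obtain ⟨M, hM⟩ := exists_bound_near hg t
  have hgs : ∀ s, Continuous (g s) := fun s => hg.comp (by fun_prop : Continuous fun h => (s, h))
  have h1 := tendsto_integral_filter_of_dominated_convergence (μ := unitMeasure)
    (F := fun s h => (g s h * y h) ^ 2) (l := 𝓝 t) (f := fun _ => 0)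
    (fun h => M ^ 2 * y h ^ 2)
    (Eventually.of_forall fun s => (((hgs s).aestronglyMeasurable).mul hy.1).pow 2) ?_
    ((hy.integrable_sq).const_mul _) ?_
  · simpa only [integral_zero, integral_unitMeasure] using h1
  · filter_upwards [hM] with s hs
    filter_upwards [ae_unit_mem] with h hh
    rw [Real.norm_eq_abs, abs_of_nonneg (sq_nonneg _), mul_pow]
    exact mul_le_mul_of_nonneg_right (sq_le_sq' (abs_le.1 (hs h hh)).1 (abs_le.1 (hs h hh)).2)
      (sq_nonneg _)
  · refine Eventually.of_forall fun h => ?_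
    have h2 : Continuous fun s => (g s h * y h) ^ 2 := by
      have : Continuous fun s => g s h := hg.comp (by fun_prop : Continuous fun s : ℝ => (s, h))
      fun_prop
    simpa [h0] using h2.tendsto t

theorem tendsto_integral_mul_sq_of_tendsto {g x : ℝ → ℝ → ℝ}
    (hg : Continuous fun q : ℝ × ℝ => g q.1 q.2) {t : ℝ} (hx : ∀ s, MemLp (x s) 2 unitMeasure)
    (hx0 : Tendsto (fun s => ∫ h in (0 : ℝ)..1, x s h ^ 2) (𝓝 t) (𝓝 0)) :
    Tendsto (fun s => ∫ h in (0 : ℝ)..1, (g s h * x s h) ^ 2) (𝓝 t) (𝓝 0) := by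
  obtain ⟨M, hM⟩ := exists_bound_near hg t
  have hgs : ∀ s, Continuous (g s) := fun s => hg.comp (by fun_prop : Continuous fun h => (s, h))
  have h1 := hx0.const_mul (M ^ 2)
  rw [mul_zero] at h1
  refine squeeze_zero' (Eventually.of_forall fun s => intervalIntegral.integral_nonneg zero_le_one
    fun h _ => sq_nonneg _) ?_ h1
  filter_upwards [hM] with s hs
  rw [← intervalIntegral.integral_const_mul]
  refine integral_unit_mono (memLp_sq_intervalIntegrable (memLp_continuous_mul (hgs s) (hx s)))
    ((memLp_sq_intervalIntegrable (hx s)).const_mul _) ?_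
  filter_upwards [ae_unit_mem] with h hh
  rw [mul_pow]
  exact mul_le_mul_of_nonneg_right (sq_le_sq' (abs_le.1 (hs h hh)).1 (abs_le.1 (hs h hh)).2)
    (sq_nonneg _)

theorem hperNorm_nonneg (m : ℕ) (f : ℝ → ℝ) : 0 ≤ hperNorm m f := Real.sqrt_nonneg _

/-- Composition with a smooth function preserves continuity in time with values in `H²`. -/
theorem tendsto_hperNorm_comp {D : ℝ → ℕ → ℝ → ℝ} (hD : ∀ t, PerChain 2 (D t))
    (h0 : Continuous fun q : ℝ × ℝ => D q.1 0 q.2) (h1 : Continuous fun q : ℝ × ℝ => D q.1 1 q.2)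
    {t : ℝ} (h2 : Tendsto (fun s => ∫ h in (0 : ℝ)..1, (D s 2 h - D t 2 h) ^ 2) (𝓝 t) (𝓝 0))
    {Φ : ℝ → ℝ} (hΦ : ContDiff ℝ ∞ Φ) :
    Tendsto (fun s => hperNorm 2 (fun h => Φ (D s 0 h) - Φ (D t 0 h))) (𝓝 t) (𝓝 0) := by
  have hi : ∀ i, Continuous (iteratedDeriv i Φ) := fun i =>
    (contDiff_iteratedDeriv_of_contDiff_infty hΦ i).continuous
  have hΦc := hΦ.continuous
  have hone : MemLp (fun _ : ℝ => (1 : ℝ)) 2 unitMeasure := memLp_const 1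
  have hDt0 := (hD t).continuous (j := 0) (by norm_num)
  have hDt1 := (hD t).continuous (j := 1) (by norm_num)
  let c := fun s => compChain Φ (D s)
  have hc : ∀ s, PerChain 2 (c s) := fun s => (hD s).comp (Or.inl rfl) hΦ
  have hcs : ∀ s, PerChain 2 (fun j x => c s j x - c t j x) := fun s => (hc s).sub (hc t)
  have t0 : Tendsto (fun s => ∫ h in (0 : ℝ)..1, (c s 0 h - c t 0 h) ^ 2) (𝓝 t) (𝓝 0) := by
    have := tendsto_integral_mul_sq_of_continuous (t := t)
      (g := fun s h => Φ (D s 0 h) - Φ (D t 0 h)) (by fun_prop) hone (by simp)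
    simp only [mul_one] at this
    exact this
  have t1 : Tendsto (fun s => ∫ h in (0 : ℝ)..1, (c s 1 h - c t 1 h) ^ 2) (𝓝 t) (𝓝 0) := by
    have hi1 := hi 1
    have := tendsto_integral_mul_sq_of_continuous (t := t)
      (g := fun s h => iteratedDeriv 1 Φ (D s 0 h) * D s 1 h - iteratedDeriv 1 Φ (D t 0 h) * D t 1 h)
      (by fun_prop) hone (by simp)
    simp only [mul_one] at this
    exact this
  have t2 : Tendsto (fun s => ∫ h in (0 : ℝ)..1, (c s 2 h - c t 2 h) ^ 2) (𝓝 t) (𝓝 0) := by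
    have hi1 := hi 1
    have hi2 := hi 2
    let A : ℝ → ℝ → ℝ := fun s h =>
      iteratedDeriv 2 Φ (D s 0 h) * D s 1 h ^ 2 - iteratedDeriv 2 Φ (D t 0 h) * D t 1 h ^ 2
    let A' : ℝ → ℝ → ℝ := fun s h => iteratedDeriv 1 Φ (D s 0 h) - iteratedDeriv 1 Φ (D t 0 h)
    let G : ℝ → ℝ → ℝ := fun s h => iteratedDeriv 1 Φ (D s 0 h)
    have hA : Continuous fun q : ℝ × ℝ => A q.1 q.2 := by fun_prop
    have hA' : Continuous fun q : ℝ × ℝ => A' q.1 q.2 := by fun_prop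
    have hG : Continuous fun q : ℝ × ℝ => G q.1 q.2 := by fun_prop
    have hx : ∀ s, MemLp (fun h => D s 2 h - D t 2 h) 2 unitMeasure := fun s =>
      ((hD s).sub (hD t)).memLp
    have a1 := tendsto_integral_mul_sq_of_continuous (t := t) hA hone (by simp [A])
    have a2 := tendsto_integral_mul_sq_of_tendsto hG hx h2
    have a3 := tendsto_integral_mul_sq_of_continuous (t := t) hA' (hD t).memLp (by simp [A'])
    have a4 := ((a1.add a2).add a3).const_mul 3
    simp only [add_zero, mul_zero] at a4
    refine squeeze_zero (fun s => intervalIntegral.integral_nonneg zero_le_one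
      fun h _ => sq_nonneg _) (fun s => ?_) a4
    have slice : ∀ {g : ℝ → ℝ → ℝ}, (Continuous fun q : ℝ × ℝ => g q.1 q.2) → Continuous (g s) :=
      fun hg => hg.comp (by fun_prop : Continuous fun h => (s, h))
    have b1 := memLp_sq_intervalIntegrable (memLp_continuous_mul (slice hA) hone)
    have b2 := memLp_sq_intervalIntegrable (memLp_continuous_mul (slice hG) (hx s))
    have b3 := memLp_sq_intervalIntegrable (memLp_continuous_mul (slice hA') (hD t).memLp)
    rw [← intervalIntegral.integral_add b1 b2, ← intervalIntegral.integral_add (b1.add b2) b3,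
      ← intervalIntegral.integral_const_mul]
    refine integral_unit_mono (memLp_sq_intervalIntegrable (hcs s).memLp)
      (((b1.add b2).add b3).const_mul 3) (Eventually.of_forall fun h => ?_)
    have e : c s 2 h - c t 2 h = A s h * 1 + G s h * (D s 2 h - D t 2 h) + A' s h * D t 2 h := by
      simp only [c, compChain, A, G, A']; ring
    rw [e]
    nlinarith [sq_nonneg (A s h * 1 - G s h * (D s 2 h - D t 2 h)),
      sq_nonneg (A s h * 1 - A' s h * D t 2 h),
      sq_nonneg (G s h * (D s 2 h - D t 2 h) - A' s h * D t 2 h)]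
  have hsq : ∀ s, hperNorm 2 (fun h => Φ (D s 0 h) - Φ (D t 0 h)) =
      √(∑ k ∈ Finset.range 3, ∫ x in (0 : ℝ)..1, (c s k x - c t k x) ^ 2) := fun s => by
    rw [← (hcs s).hperNorm_sq (by norm_num)]
    exact (Real.sqrt_sq (hperNorm_nonneg _ _)).symm
  simp only [hsq, Finset.sum_range_succ, Finset.sum_range_zero, zero_add]
  simpa using ((t0.add t1).add t2).sqrt

/-- The `H⁴` norm of a composition is controlled by the `L²` norm of the fourth derivative, given
bounds on the range and on the second derivative. -/
theorem exists_hperNorm_comp_le {Φ : ℝ → ℝ} (hΦ : ContDiff ℝ ∞ Φ) (α β E : ℝ) :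
    ∃ K : ℝ, 0 ≤ K ∧ ∀ d, PerChain 4 d → (∀ x, d 0 x ∈ Icc α β) →
      ∫ h in (0 : ℝ)..1, d 2 h ^ 2 ≤ E →
      hperNorm 4 (fun x => Φ (d 0 x)) ^ 2 ≤ K * (1 + ∫ h in (0 : ℝ)..1, d 4 h ^ 2) := by
  have hb : ∀ i, ∃ M, ∀ y ∈ Icc α β, |iteratedDeriv i Φ y| ≤ M := fun i =>
    isCompact_Icc.exists_bound_of_continuousOn
      (contDiff_iteratedDeriv_of_contDiff_infty hΦ i).continuous.continuousOn
  choose M hM using hb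
  let m : ℝ := ∑ i ∈ Finset.range 5, M i ^ 2
  have hm : 0 ≤ m := Finset.sum_nonneg fun i _ => sq_nonneg _
  have hMm : ∀ i < 5, ∀ y ∈ Icc α β, iteratedDeriv i Φ y ^ 2 ≤ m := fun i hi y hy =>
    (sq_le_sq' (abs_le.1 (hM i y hy)).1 (abs_le.1 (hM i y hy)).2).trans
      (Finset.single_le_sum (f := fun i => M i ^ 2) (fun i _ => sq_nonneg _)
        (Finset.mem_range.2 hi))
  -- the constants add up the bounds `b0`, …, `b4` below; `|E|` makes the bound meaningful for all `E`
  refine ⟨m * (11 + 153 * |E| + 182 * |E| ^ 2 + 3 * |E| ^ 3 + 5 * |E| ^ 4), by positivity,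
    fun d hd hr hE => ?_⟩
  have hE0 : 0 ≤ E := (intervalIntegral.integral_nonneg zero_le_one fun h _ => sq_nonneg _).trans hE
  rw [abs_of_nonneg hE0]
  set N := ∫ h in (0 : ℝ)..1, d 4 h ^ 2 with hN
  have hN0 : 0 ≤ N := intervalIntegral.integral_nonneg zero_le_one fun h _ => sq_nonneg _
  have h1 : ∀ x, d 1 x ^ 2 ≤ E := fun x => (hd.sq_le (j := 0) (by norm_num) x).trans hE
  have h3 : ∀ x, d 3 x ^ 2 ≤ N := fun x => hd.sq_le (j := 2) (by norm_num) x
  have h2 : ∀ x, d 2 x ^ 2 ≤ N := fun x => (hd.sq_le (j := 1) (by norm_num) x).trans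
    (hd.integral_sq_le (j := 2) (by norm_num))
  have hc := hd.comp (Or.inr rfl) hΦ
  have hφ : ∀ i < 5, ∀ x, iteratedDeriv i Φ (d 0 x) ^ 2 ≤ m := fun i hi x => hMm i hi _ (hr x)
  have ii : ∀ k ≤ 4, IntervalIntegrable (fun x => compChain Φ d k x ^ 2) volume 0 1 :=
    fun k hk => hc.sq_intervalIntegrable hk 0 1
  have of_const : ∀ k ≤ 4, ∀ B : ℝ, (∀ x, compChain Φ d k x ^ 2 ≤ B) →
      ∫ x in (0 : ℝ)..1, compChain Φ d k x ^ 2 ≤ B := by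
    intro k hk B hB
    have := integral_unit_mono (ii k hk) (by simp : IntervalIntegrable (fun _ : ℝ => B) volume 0 1)
      (Eventually.of_forall hB)
    simpa using this
  have b0 := of_const 0 (by norm_num) m fun x => by
    simpa [compChain, iteratedDeriv_zero] using hφ 0 (by norm_num) x
  have b1 := of_const 1 (by norm_num) (m * E) fun x => by
    simp only [compChain, mul_pow]
    exact mul_le_mul (hφ 1 (by norm_num) x) (h1 x) (sq_nonneg _) hm
  have b2 := of_const 2 (by norm_num) (2 * m * (E ^ 2 + N)) fun x => by
    have e1 : (iteratedDeriv 2 Φ (d 0 x) * d 1 x ^ 2) ^ 2 ≤ m * E ^ 2 := by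
      rw [mul_pow, ← pow_mul, mul_comm 2 2, pow_mul]
      exact mul_le_mul (hφ 2 (by norm_num) x) (pow_le_pow_left₀ (sq_nonneg _) (h1 x) 2)
        (by positivity) hm
    have e2 : (iteratedDeriv 1 Φ (d 0 x) * d 2 x) ^ 2 ≤ m * N := by
      rw [mul_pow]; exact mul_le_mul (hφ 1 (by norm_num) x) (h2 x) (sq_nonneg _) hm
    simp only [compChain]
    linarith [add_sq_le (a := iteratedDeriv 2 Φ (d 0 x) * d 1 x ^ 2)
      (b := iteratedDeriv 1 Φ (d 0 x) * d 2 x)]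
  have three : ∀ a b c : ℝ, (a + b + c) ^ 2 ≤ 3 * (a ^ 2 + b ^ 2 + c ^ 2) := fun a b c => by
    nlinarith [sq_nonneg (a - b), sq_nonneg (a - c), sq_nonneg (b - c)]
  have five : ∀ a b c e f : ℝ, (a + b + c + e + f) ^ 2 ≤
      5 * (a ^ 2 + b ^ 2 + c ^ 2 + e ^ 2 + f ^ 2) := fun a b c e f => by
    nlinarith [sq_nonneg (a - b), sq_nonneg (a - c), sq_nonneg (b - c), sq_nonneg (a - e),
      sq_nonneg (b - e), sq_nonneg (c - e), sq_nonneg (a - f), sq_nonneg (b - f),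
      sq_nonneg (c - f), sq_nonneg (e - f)]
  have b3 := of_const 3 (by norm_num) (3 * (m * E ^ 3 + 9 * (m * E * N) + m * N)) fun x => by
    have e1 : (iteratedDeriv 3 Φ (d 0 x) * d 1 x ^ 3) ^ 2 ≤ m * E ^ 3 := by
      rw [mul_pow, ← pow_mul, mul_comm 3 2, pow_mul]
      exact mul_le_mul (hφ 3 (by norm_num) x) (pow_le_pow_left₀ (sq_nonneg _) (h1 x) 3)
        (by positivity) hm
    have e2 : (iteratedDeriv 2 Φ (d 0 x) * d 1 x * d 2 x) ^ 2 ≤ m * E * N := by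
      rw [mul_pow, mul_pow]
      exact mul_le_mul (mul_le_mul (hφ 2 (by norm_num) x) (h1 x) (sq_nonneg _) hm) (h2 x)
        (sq_nonneg _) (by positivity)
    have e3 : (iteratedDeriv 1 Φ (d 0 x) * d 3 x) ^ 2 ≤ m * N := by
      rw [mul_pow]; exact mul_le_mul (hφ 1 (by norm_num) x) (h3 x) (sq_nonneg _) hm
    simp only [compChain]
    refine (three _ _ _).trans ?_
    rw [mul_pow 3]
    linarith
  have b4 : ∫ x in (0 : ℝ)..1, compChain Φ d 4 x ^ 2 ≤
      5 * (m * E ^ 4 + 36 * (m * E ^ 2 * N) + 9 * (m * N * E) + 16 * (m * E * N) + m * N) := by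
    have hi2 := hd.sq_intervalIntegrable (j := 2) (by norm_num) 0 1
    have hi4 := hd.sq_intervalIntegrable (j := 4) le_rfl 0 1
    obtain ⟨P, hP⟩ : ∃ P, P = 5 * (m * E ^ 4 + 36 * (m * E ^ 2 * N) + 16 * (m * E * N)) := ⟨_, rfl⟩
    have hPi : IntervalIntegrable (fun _ : ℝ => P) volume 0 1 := by simp
    have key := integral_unit_mono (ii 4 le_rfl)
      ((hPi.add (hi2.const_mul (45 * m * N))).add (hi4.const_mul (5 * m))) (Eventually.of_forall fun x => by
        have e1 : (iteratedDeriv 4 Φ (d 0 x) * d 1 x ^ 4) ^ 2 ≤ m * E ^ 4 := by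
          rw [mul_pow, ← pow_mul, mul_comm 4 2, pow_mul]
          exact mul_le_mul (hφ 4 (by norm_num) x) (pow_le_pow_left₀ (sq_nonneg _) (h1 x) 4)
            (by positivity) hm
        have e2 : (iteratedDeriv 3 Φ (d 0 x) * d 1 x ^ 2 * d 2 x) ^ 2 ≤ m * E ^ 2 * N := by
          rw [mul_pow, mul_pow, ← pow_mul (d 1 x), mul_comm 2 2, pow_mul]
          exact mul_le_mul (mul_le_mul (hφ 3 (by norm_num) x)
            (pow_le_pow_left₀ (sq_nonneg _) (h1 x) 2) (by positivity) hm) (h2 x)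
            (sq_nonneg _) (by positivity)
        have e3 : (iteratedDeriv 2 Φ (d 0 x) * d 2 x ^ 2) ^ 2 ≤ m * N * d 2 x ^ 2 := by
          rw [mul_pow, sq (d 2 x ^ 2), ← mul_assoc]
          exact mul_le_mul_of_nonneg_right (mul_le_mul (hφ 2 (by norm_num) x) (h2 x)
            (sq_nonneg _) hm) (sq_nonneg _)
        have e4 : (iteratedDeriv 2 Φ (d 0 x) * d 1 x * d 3 x) ^ 2 ≤ m * E * N := by
          rw [mul_pow, mul_pow]
          exact mul_le_mul (mul_le_mul (hφ 2 (by norm_num) x) (h1 x) (sq_nonneg _) hm) (h3 x)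
            (sq_nonneg _) (by positivity)
        have e5 : (iteratedDeriv 1 Φ (d 0 x) * d 4 x) ^ 2 ≤ m * d 4 x ^ 2 := by
          rw [mul_pow]; exact mul_le_mul_of_nonneg_right (hφ 1 (by norm_num) x) (sq_nonneg _)
        simp only [compChain]
        refine (five _ _ _ _ _).trans ?_
        rw [mul_pow 6, mul_pow 3, mul_pow 4]
        linarith)
    refine key.trans ?_
    rw [intervalIntegral.integral_add (hPi.add (hi2.const_mul _)) (hi4.const_mul _),
      intervalIntegral.integral_add hPi (hi2.const_mul _),
      intervalIntegral.integral_const_mul, intervalIntegral.integral_const_mul, ← hN,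
      intervalIntegral.integral_const]
    have : 45 * m * N * ∫ x in (0 : ℝ)..1, d 2 x ^ 2 ≤ 45 * m * N * E :=
      mul_le_mul_of_nonneg_left hE (by positivity)
    simp only [sub_zero, one_smul]
    linarith
  rw [show (fun x => Φ (d 0 x)) = compChain Φ d 0 from rfl, hc.hperNorm_sq (by norm_num)]
  simp only [Finset.sum_range_succ, Finset.sum_range_zero, zero_add]
  have q1 : 0 ≤ m * N := by positivity
  have q2 : 0 ≤ m * E := by positivity
  have q3 : 0 ≤ m * E * N := by positivity
  have q4 : 0 ≤ m * E ^ 2 := by positivity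
  have q5 : 0 ≤ m * E ^ 2 * N := by positivity
  have q6 : 0 ≤ m * E ^ 3 * N := by positivity
  have q7 : 0 ≤ m * E ^ 4 * N := by positivity
  linarith

/-! ### The strong solution and its energies -/

/-- A solution of the truncated equation for `w = 1/u`, with a truncation to `[a,b]` so generous
that the a priori bounds exclude its being active. -/
structure TruncSol (T L a b : ℝ) (u₀ : ℝ → ℝ) (d₀ : ℕ → ℝ → ℝ) (η : ℝ × ℝ → ℝ) : Prop where
  sol : WeakSol T (truncF a b) (truncDeriv a b) (3 * b⁻¹ ^ 4 + b⁻¹ ^ 2) (3 * a⁻¹ ^ 4 + a⁻¹ ^ 2)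
    (fun h => (u₀ h)⁻¹) d₀ η
  time_pos : 0 < T
  mass_pos : 0 < L
  low_pos : 0 < a
  low_le : a ≤ L
  le_high : L ≤ b
  low_energy : cubic L⁻¹ + √(∫ h in (0 : ℝ)..1, d₀ 2 h ^ 2) ≤ cubic a⁻¹
  high_energy : b⁻¹ < lowerInit L (∫ h in (0 : ℝ)..1, d₀ 2 h ^ 2)
  mass : ∫ h in (0 : ℝ)..1, (u₀ h)⁻¹ = L
  datum_mem : ∀ h, (u₀ h)⁻¹ ∈ Icc a b

namespace TruncSol

variable {T L a b : ℝ} {u₀ : ℝ → ℝ} {d₀ : ℕ → ℝ → ℝ} {η : ℝ × ℝ → ℝ}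

/-- The solution `u`, recovered from the continuous representative of `u³ + u`. -/
def u (S : TruncSol T L a b u₀ d₀ η) (t h : ℝ) : ℝ := cubicInv (S.sol.derivs t 0 h)

theorem integral_derivs_le (S : TruncSol T L a b u₀ d₀ η) (t : ℝ) :
    ∫ h in (0 : ℝ)..1, S.sol.derivs t 2 h ^ 2 ≤ ∫ h in (0 : ℝ)..1, d₀ 2 h ^ 2 :=
  (S.sol.integral_derivs_two_sq t).trans_le (S.sol.energy_le t)

theorem high_pos (S : TruncSol T L a b u₀ d₀ η) : 0 < b := S.mass_pos.trans_le S.le_high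

theorem derivs_mem (S : TruncSol T L a b u₀ d₀ η) (t x : ℝ) :
    S.sol.derivs t 0 x ∈ Icc (cubic b⁻¹) (cubic a⁻¹) :=
  mem_range_of_bounds (S.sol.perChain_derivs t) S.mass_pos (S.integral_derivs_le t) S.low_pos
    S.low_le S.le_high S.low_energy S.high_energy
    ((S.sol.cont.intervalIntegrable _ _).add
      (memLp_intervalIntegrable (memLp_timePrim_slice S.sol.meas S.sol.sqInt t)))
    ((S.sol.integral_w t).trans S.mass) (S.sol.derivs_zero_ae t) x

theorem u_mem (S : TruncSol T L a b u₀ d₀ η) (t x : ℝ) : S.u t x ∈ Icc b⁻¹ a⁻¹ :=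
  ⟨le_cubicInv_iff.2 (S.derivs_mem t x).1, cubicInv_le_iff.2 (S.derivs_mem t x).2⟩

theorem u_pos (S : TruncSol T L a b u₀ d₀ η) (t x : ℝ) : 0 < S.u t x :=
  (inv_pos.2 S.high_pos).trans_le (S.u_mem t x).1

theorem u_inv_mem (S : TruncSol T L a b u₀ d₀ η) (t x : ℝ) : (S.u t x)⁻¹ ∈ Icc a b :=
  ⟨le_inv_of_le_inv₀ (S.u_pos t x) (S.u_mem t x).2,
    inv_le_of_inv_le₀ S.high_pos (S.u_mem t x).1⟩

theorem cubic_u (S : TruncSol T L a b u₀ d₀ η) (t : ℝ) :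
    (fun x => S.u t x ^ 3 + S.u t x) = S.sol.derivs t 0 := by
  funext x; exact cubic_cubicInv _

theorem continuous_u (S : TruncSol T L a b u₀ d₀ η) : Continuous fun q : ℝ × ℝ => S.u q.1 q.2 :=
  contDiff_cubicInv.continuous.comp (S.sol.continuous_derivs (by norm_num))

theorem continuous_u_left (S : TruncSol T L a b u₀ d₀ η) (h : ℝ) : Continuous fun t => S.u t h :=
  Continuous.comp (g := fun q : ℝ × ℝ => S.u q.1 q.2) (f := fun t : ℝ => (t, h)) S.continuous_u
    (by fun_prop)

theorem continuous_u_right (S : TruncSol T L a b u₀ d₀ η) (t : ℝ) : Continuous (S.u t) :=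
  Continuous.comp (g := fun q : ℝ × ℝ => S.u q.1 q.2) (f := fun h : ℝ => (t, h)) S.continuous_u
    (by fun_prop)

theorem periodic_u (S : TruncSol T L a b u₀ d₀ η) (t : ℝ) : Function.Periodic (S.u t) 1 :=
  fun x => congrArg cubicInv ((S.sol.perChain_derivs t).per 0 (Nat.zero_le _) x)

/-- `w = 1/u`, for almost every `h` at all times. -/
theorem w_eq (S : TruncSol T L a b u₀ d₀ η) : ∀ᵐ h ∂unitMeasure, ∀ t,
    (u₀ h)⁻¹ + timePrim T η (t, h) = (S.u t h)⁻¹ := by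
  -- rational times first, so that there is one null set for all of them; then continuity in time
  have h1 : ∀ᵐ h ∂unitMeasure, ∀ t : ℚ,
      (u₀ h)⁻¹ + timePrim T η ((t : ℝ), h) = (S.u t h)⁻¹ := by
    rw [ae_all_iff]
    intro t
    filter_upwards [S.sol.derivs_zero_ae t] with h hh
    refine S.sol.nonlin.strictAnti.injective ?_
    rw [← hh, truncF_eq S.low_pos (S.u_inv_mem t h), inv_inv, u, cubic_cubicInv]
  filter_upwards [h1, S.sol.isPrim_w] with h h1 h2
  have h3 := Rat.denseRange_cast.equalizer h2.continuous
    ((S.continuous_u_left h).inv₀ fun t => (S.u_pos t h).ne') (funext h1)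
  exact fun t => congrFun h3 t

theorem isPrim_inv (S : TruncSol T L a b u₀ d₀ η) : ∀ᵐ h ∂unitMeasure,
    IsPrim (fun t => (S.u t h)⁻¹) ((Icc 0 T).indicator fun t => η (t, h)) := by
  filter_upwards [S.w_eq, S.sol.isPrim_w] with h h1 h2
  simpa only [h1] using h2

theorem u_zero (S : TruncSol T L a b u₀ d₀ η) : S.u 0 = u₀ := by
  have h1 : S.sol.derivs 0 0 = d₀ 0 := by
    refine eq_of_ae_eq_of_periodic ?_ ((S.sol.perChain_derivs 0).continuous (by norm_num))
      (S.sol.chain.continuous (by norm_num)) ((S.sol.perChain_derivs 0).per 0 (by norm_num))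
      (S.sol.chain.per 0 (by norm_num))
    filter_upwards [S.sol.derivs_zero_ae 0] with h hh
    rw [hh, timePrim_zero _ le_rfl, add_zero, S.sol.datum]
  funext h
  rw [u, h1, S.sol.datum, truncF_eq S.low_pos (S.datum_mem h), inv_inv, cubicInv_cubic]

theorem ae_flux (S : TruncSol T L a b u₀ d₀ η) : ∀ᵐ t ∂timeMeasure T,
    flux (S.u t) =ᵐ[volume] fun x => η (t, Int.fract x) := by
  filter_upwards [S.sol.ae_exists_perChain_four] with t ⟨d, hd, hd0, hd4⟩
  rw [flux, S.cubic_u, ← hd0, ← hd4]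
  exact hd.weakDeriv_ae_eq (by norm_num) le_rfl

theorem ae_fract_eq : ∀ᵐ h ∂unitMeasure, Int.fract h = h := comp_fract_ae_eq fun x => x

theorem ae_flux_unit (S : TruncSol T L a b u₀ d₀ η) : ∀ᵐ t ∂timeMeasure T,
    ∀ᵐ h ∂unitMeasure, flux (S.u t) h = η (t, h) := by
  filter_upwards [S.ae_flux] with t ht
  filter_upwards [ae_restrict_of_ae ht, ae_fract_eq] with h h1 h2
  rw [h1, h2]

theorem sqInt_velocity (S : TruncSol T L a b u₀ d₀ η) :
    MemLp (Function.uncurry fun t h => -(S.u t h) ^ 2 * η (t, Int.fract h)) 2 (cylMeasure T) := by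
  have h1 : MemLp (fun q : ℝ × ℝ => -(S.u q.1 q.2) ^ 2 * η q) 2 (cylMeasure T) := by
    refine S.sol.sqInt.of_le_mul (c := a⁻¹ ^ 2) ?_ (Eventually.of_forall fun q => ?_)
    · exact ((S.continuous_u.pow 2).neg.aestronglyMeasurable).mul S.sol.meas.aestronglyMeasurable
    · rw [norm_mul, norm_neg, norm_pow, Real.norm_of_nonneg (S.u_pos _ _).le]
      exact mul_le_mul_of_nonneg_right
        (pow_le_pow_left₀ (S.u_pos _ _).le (S.u_mem _ _).2 2) (norm_nonneg _)
  refine h1.ae_eq ?_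
  filter_upwards [ae_cyl_of_ae_unit (T := T) ae_fract_eq] with q hq
  simp only [Function.uncurry, hq]

/-- The equation for `u = 1/w`: along almost every line `h = const`, `u_t = -w⁻² w_t = -u² η`. -/
theorem hasL2TimeDeriv (S : TruncSol T L a b u₀ d₀ η) :
    HasL2TimeDeriv T S.u fun t h => -(S.u t h) ^ 2 * η (t, Int.fract h) := by
  refine ⟨S.sqInt_velocity, fun t x => ?_, fun φ hφ _ hsupp => ?_⟩
  · simp only [S.periodic_u t x, Int.fract_add_one]
  filter_upwards [S.isPrim_inv, ae_fract_eq] with h h1 h2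
  have hu : IsPrim (fun t => S.u t h)
      (fun t => -((S.u t h)⁻¹ ^ 2)⁻¹ * (Icc 0 T).indicator (fun t => η (t, h)) t) := by
    have hc : Continuous fun t => -((S.u t h)⁻¹ ^ 2)⁻¹ := by
      refine Continuous.neg (Continuous.inv₀ (Continuous.pow ((S.continuous_u_left h).inv₀
        fun t => (S.u_pos t h).ne') 2) fun t => ?_)
      exact pow_ne_zero _ (inv_ne_zero (S.u_pos t h).ne')
    have := h1.comp (Φ := fun y => y⁻¹) (Φ' := fun y => -(y ^ 2)⁻¹)
      (fun t => hasDerivAt_inv (inv_ne_zero (S.u_pos t h).ne')) hc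
    simpa only [inv_inv] using this
  have hφp : IsPrim φ (deriv φ) := IsPrim.of_hasDerivAt
    (fun x => (hφ.differentiable (by simp) x).hasDerivAt) (hφ.continuous_deriv (by simp))
  have hφ0 : φ 0 = 0 := image_eq_zero_of_notMem_tsupport fun hm => (hsupp hm).1.false
  have hφT : φ T = 0 := image_eq_zero_of_notMem_tsupport fun hm => (hsupp hm).2.false
  have hm := hφp.mul hu
  have h3 := hm.integral_eq 0 T
  have i1 : IntervalIntegrable (fun t => deriv φ t * S.u t h) volume 0 T :=
    ((hφ.continuous_deriv (by simp)).mul (S.continuous_u_left h)).intervalIntegrable _ _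
  have i2 := (hm.intervalIntegrable 0 T).sub i1
  rw [hφ0, hφT, zero_mul, zero_mul, sub_zero] at h3
  have h4 : ∫ t in (0 : ℝ)..T, φ t * (-(S.u t h) ^ 2 * η (t, Int.fract h)) =
      ∫ t in (0 : ℝ)..T, (deriv φ t * S.u t h + φ t * (-((S.u t h)⁻¹ ^ 2)⁻¹ *
        (Icc 0 T).indicator (fun t => η (t, h)) t) - deriv φ t * S.u t h) := by
    refine intervalIntegral.integral_congr fun t ht => ?_
    rw [uIcc_of_le S.time_pos.le] at ht
    simp only [indicator_of_mem ht, h2, inv_pow, inv_inv]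
    ring
  rw [h4, intervalIntegral.integral_sub (hm.intervalIntegrable 0 T) i1, h3]
  ring

theorem memHper_two (S : TruncSol T L a b u₀ d₀ η) (t : ℝ) : MemHper 2 (S.u t) :=
  ((S.sol.perChain_derivs t).comp (Or.inl rfl) contDiff_cubicInv).memHper (by norm_num)

theorem memCHper (S : TruncSol T L a b u₀ d₀ η) : MemCHper T 2 S.u :=
  ⟨fun t _ => S.memHper_two t, fun t _ => (tendsto_hperNorm_comp S.sol.perChain_derivs
    (S.sol.continuous_derivs (by norm_num)) (S.sol.continuous_derivs (by norm_num))
    (S.sol.tendsto_integral_two t) contDiff_cubicInv).mono_left nhdsWithin_le_nhds⟩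

theorem memL2Hper (S : TruncSol T L a b u₀ d₀ η) : MemL2Hper T 4 S.u := by
  refine ⟨S.continuous_u.aestronglyMeasurable, ?_, ?_⟩
  · filter_upwards [S.sol.ae_exists_perChain_four] with t ⟨d, hd, hd0, hd4⟩
    have := (hd.comp (Or.inr rfl) contDiff_cubicInv).memHper (by norm_num)
    simp only [compChain, hd0] at this
    exact this
  · obtain ⟨K, hK0, hK⟩ := exists_hperNorm_comp_le contDiff_cubicInv (cubic b⁻¹) (cubic a⁻¹)
      (∫ h in (0 : ℝ)..1, d₀ 2 h ^ 2)
    have hi : Integrable (fun t => K * (1 + ∫ h in (0 : ℝ)..1, η (t, h) * η (t, h)))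
        (timeMeasure T) :=
      ((integrable_const 1).add (integrable_integral_mul S.sol.sqInt S.sol.sqInt)).const_mul K
    refine lt_of_le_of_lt (lintegral_mono_ae ?_) hi.lintegral_lt_top
    filter_upwards [S.sol.ae_exists_perChain_four] with t ⟨d, hd, hd0, hd4⟩
    refine ENNReal.ofReal_le_ofReal ?_
    have hd2 : ∫ h in (0 : ℝ)..1, d 2 h ^ 2 ≤ ∫ h in (0 : ℝ)..1, d₀ 2 h ^ 2 := by
      refine le_trans (le_of_eq ?_) (S.integral_derivs_le t)
      have h1 := hd.weakDeriv_ae_eq (by norm_num) (k := 2) (by norm_num)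
      rw [hd0] at h1
      have h2 := (S.sol.perChain_derivs t).weakDeriv_ae_eq (by norm_num) (k := 2) (by norm_num)
      refine intervalIntegral.integral_congr_ae ?_
      filter_upwards [h1, h2] with x h1 h2 _
      rw [← h1, ← h2]
    have h3 := hK d hd (fun x => by rw [hd0]; exact S.derivs_mem t x) hd2
    have h4 : ∫ h in (0 : ℝ)..1, d 4 h ^ 2 = ∫ h in (0 : ℝ)..1, η (t, h) * η (t, h) := by
      rw [← integral_unitMeasure, ← integral_unitMeasure, hd4]
      refine integral_congr_ae ?_
      filter_upwards [ae_fract_eq] with h hh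
      rw [hh, sq]
    rw [hd0, h4] at h3
    exact h3

theorem isStrongSolution (S : TruncSol T L a b u₀ d₀ η) : IsStrongSolution T u₀ S.u where
  pos t _ h := S.u_pos t h
  memC := S.memCHper
  memL2 := S.memL2Hper
  init := S.u_zero
  eqn := by
    refine ⟨_, S.hasL2TimeDeriv, ?_⟩
    filter_upwards [S.ae_flux_unit] with t ht
    filter_upwards [ht, ae_fract_eq] with h h1 h2
    rw [h1, h2]

theorem energyE_eq (S : TruncSol T L a b u₀ d₀ η) (t : ℝ) : energyE (S.u t) =
    WeakSol.energy T (truncDeriv a b) (fun h => (u₀ h)⁻¹) d₀ η t := by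
  rw [energyE, S.cubic_u, ← S.sol.integral_derivs_two_sq]
  refine intervalIntegral.integral_congr_ae ?_
  filter_upwards [(S.sol.perChain_derivs t).weakDeriv_ae_eq (by norm_num) (k := 2) le_rfl]
    with x hx _
  rw [hx]

theorem ae_dissDensity (S : TruncSol T L a b u₀ d₀ η) : ∀ᵐ t ∂timeMeasure T, ∀ᵐ h ∂unitMeasure,
    dissDensity (S.u t) h = -2 * (η (t, h) *
      WeakSol.rate T (truncDeriv a b) (fun h => (u₀ h)⁻¹) η (t, h)) := by
  filter_upwards [S.ae_flux_unit] with t ht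
  filter_upwards [ht, S.w_eq] with h h1 h2
  obtain ⟨h3, h4⟩ := S.u_inv_mem t h
  rw [dissDensity, h1, WeakSol.rate, h2 t, truncDeriv, min_eq_right h4, max_eq_right h3, inv_inv]
  ring

theorem ae_intervalIntegrable_dissDensity (S : TruncSol T L a b u₀ d₀ η) :
    ∀ᵐ t ∂timeMeasure T, IntervalIntegrable (dissDensity (S.u t)) volume 0 1 := by
  filter_upwards [S.ae_dissDensity, ae_memLp_slice S.sol.sqInt, ae_memLp_slice S.sol.sqInt_rate]
    with t ht h1 h2
  have h3 := (memLp_mul_intervalIntegrable h1 h2).const_mul (-2)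
  rw [intervalIntegrable_iff_integrableOn_Icc_of_le zero_le_one] at h3 ⊢
  exact h3.congr (ht.mono fun h hh => hh.symm)

theorem ae_integral_dissDensity (S : TruncSol T L a b u₀ d₀ η) : ∀ᵐ t ∂timeMeasure T,
    ∫ h in (0 : ℝ)..1, dissDensity (S.u t) h = -2 * ∫ h in (0 : ℝ)..1, η (t, h) *
      WeakSol.rate T (truncDeriv a b) (fun h => (u₀ h)⁻¹) η (t, h) := by
  filter_upwards [S.ae_dissDensity] with t ht
  rw [← intervalIntegral.integral_const_mul, ← integral_unitMeasure, ← integral_unitMeasure]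
  exact integral_congr_ae ht

theorem intervalIntegrable_dissipation (S : TruncSol T L a b u₀ d₀ η) :
    IntervalIntegrable (fun t => ∫ h in (0 : ℝ)..1, dissDensity (S.u t) h) volume 0 T := by
  rw [intervalIntegrable_iff_integrableOn_Icc_of_le S.time_pos.le]
  exact ((integrable_integral_mul S.sol.sqInt S.sol.sqInt_rate).const_mul (-2)).congr
    (S.ae_integral_dissDensity.mono fun t ht => ht.symm)

theorem energyE_identity (S : TruncSol T L a b u₀ d₀ η) :
    energyE (S.u T) + ∫ t in (0 : ℝ)..T, ∫ h in (0 : ℝ)..1, dissDensity (S.u t) h =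
      energyE (S.u 0) := by
  have h1 : ∫ t in (0 : ℝ)..T, ∫ h in (0 : ℝ)..1, dissDensity (S.u t) h =
      -2 * ∫ t in (0 : ℝ)..T, ∫ h in (0 : ℝ)..1, η (t, h) *
        WeakSol.rate T (truncDeriv a b) (fun h => (u₀ h)⁻¹) η (t, h) := by
    rw [← intervalIntegral.integral_const_mul]
    refine intervalIntegral.integral_congr_ae ?_
    have h2 := (ae_restrict_iff' measurableSet_Icc).1 S.ae_integral_dissDensity
    filter_upwards [h2] with t ht htm
    rw [uIoc_of_le S.time_pos.le] at htm
    exact ht (Ioc_subset_Icc_self htm)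
  rw [h1, S.energyE_eq, S.energyE_eq, WeakSol.energy, WeakSol.energy,
    tPrim_eq _ ⟨S.time_pos.le, le_rfl⟩, tPrim_zero _ _ le_rfl]
  ring

theorem continuous_energyE (S : TruncSol T L a b u₀ d₀ η) :
    Continuous fun t => energyE (S.u t) := by
  simp only [S.energyE_eq, WeakSol.energy]
  have := (isPrim_tPrim (integrable_integral_mul S.sol.sqInt S.sol.sqInt_rate)).continuous
  fun_prop

theorem lowerJ_le_u (S : TruncSol T L a b u₀ d₀ η) (t h : ℝ) :
    lowerJ L (energyE (S.u t)) ≤ S.u t h := by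
  have hd := S.sol.perChain_derivs t
  obtain ⟨h₀, hmin⟩ := hd.exists_min (by norm_num)
  have hmu : ∀ x, S.u t h₀ ≤ S.u t x := fun x => by
    rw [u, cubicInv_le_iff, u, cubic_cubicInv]; exact hmin x
  refine le_trans ?_ (hmu h)
  refine lowerJ_le hd S.mass_pos (le_of_eq ?_) hmin (S.u_pos t) (S.periodic_u t)
    (S.continuous_u_right t) (le_of_eq ?_) fun x => ?_
  · rw [S.sol.integral_derivs_two_sq, S.energyE_eq]
  · refine Eq.trans ?_ ((S.sol.integral_w t).trans S.mass)
    rw [← integral_unitMeasure, ← integral_unitMeasure]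
    refine integral_congr_ae ?_
    filter_upwards [S.w_eq] with h hh
    exact (hh t).symm
  · have := sub_le_cubic_sub (hmu x)
    have e : ∀ y, cubic (S.u t y) = S.sol.derivs t 0 y := fun y => cubic_cubicInv _
    rw [e, e] at this
    linarith

theorem energyE_le (S : TruncSol T L a b u₀ d₀ η) (t : ℝ) : energyE (S.u t) ≤ energyE u₀ := by
  have e : energyE u₀ = energyE (S.u 0) := by rw [S.u_zero]
  rw [e, S.energyE_eq, S.energyE_eq]
  refine (S.sol.energy_le t).trans (le_of_eq ?_)
  rw [WeakSol.energy, tPrim_zero _ _ le_rfl, mul_zero, add_zero]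

theorem energyF_identity (S : TruncSol T L a b u₀ d₀ η) :
    energyF (S.u T) + ∫ t in (0 : ℝ)..T, energyE (S.u t) = energyF (S.u 0) := by
  -- the density of `F` is `G(1/u)` with `G' (w) = -(w⁻³ + w⁻¹)`
  let V : ℝ × ℝ → ℝ := fun q => S.sol.derivs q.1 0 q.2
  have hV : Continuous V := S.sol.continuous_derivs (by norm_num)
  have hVη : MemLp (fun q => V q * η q) 2 (cylMeasure T) := by
    refine S.sol.sqInt.of_le_mul (c := cubic a⁻¹)
      (hV.aestronglyMeasurable.mul S.sol.meas.aestronglyMeasurable)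
      (Eventually.of_forall fun q => ?_)
    have h1 := S.derivs_mem q.1 q.2
    have h2 : 0 ≤ V q := le_trans (by have := S.high_pos; simp only [cubic]; positivity) h1.1
    rw [norm_mul, Real.norm_of_nonneg h2]
    exact mul_le_mul_of_nonneg_right h1.2 (norm_nonneg _)
  have hint := integrable_of_memLp hVη
  have h1 : ∀ᵐ h ∂unitMeasure, (1 / 2 * S.u T h ^ 2 + Real.log (S.u T h)) -
      (1 / 2 * S.u 0 h ^ 2 + Real.log (S.u 0 h)) = -∫ t, V (t, h) * η (t, h) ∂timeMeasure T := by
    filter_upwards [S.isPrim_inv] with h hh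
    have hw : ∀ t, (S.u t h)⁻¹ ≠ 0 := fun t => inv_ne_zero (S.u_pos t h).ne'
    have hc : Continuous fun t => -cubic ((S.u t h)⁻¹)⁻¹ := by
      simp only [inv_inv]
      exact (contDiff_cubic.continuous.comp (S.continuous_u_left h)).neg
    have h2 := hh.comp (Φ := fun w => 1 / 2 * w⁻¹ ^ 2 + Real.log w⁻¹) (Φ' := fun w => -cubic w⁻¹)
      (fun t => by
        have h3 := ((hasDerivAt_inv (hw t)).fun_pow 2).const_mul (1 / 2)
        have h4 := (hasDerivAt_inv (hw t)).log (inv_ne_zero (hw t))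
        refine (h3.fun_add h4).congr_deriv ?_
        have := (S.u_pos t h).ne'
        simp only [cubic]
        field_simp
        ring) hc
    have h5 := h2.integral_eq 0 T
    simp only [inv_inv] at h5
    rw [← h5, timeMeasure, ← restrict_Ioc_eq_restrict_Icc,
      ← intervalIntegral.integral_of_le S.time_pos.le, ← intervalIntegral.integral_neg]
    refine intervalIntegral.integral_congr fun t ht => ?_
    rw [uIcc_of_le S.time_pos.le] at ht
    simp only [indicator_of_mem ht, V, u, cubic_cubicInv, neg_mul]
  have hFc : ∀ t, Continuous fun h => 1 / 2 * S.u t h ^ 2 + Real.log (S.u t h) := fun t =>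
    (continuous_const.mul ((S.continuous_u_right t).pow 2)).add
      ((S.continuous_u_right t).log fun h => (S.u_pos t h).ne')
  have h6 : energyF (S.u T) - energyF (S.u 0) = -∫ q, V q * η q ∂cylMeasure T := by
    rw [energyF, energyF, ← intervalIntegral.integral_sub ((hFc T).intervalIntegrable _ _)
      ((hFc 0).intervalIntegrable _ _), ← integral_unitMeasure, integral_cyl_symm hint,
      ← integral_neg]
    exact integral_congr_ae h1
  have h7 : ∫ q, V q * η q ∂cylMeasure T = ∫ t in (0 : ℝ)..T, energyE (S.u t) := by
    rw [integral_cyl hint, intervalIntegral.integral_of_le S.time_pos.le,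
      restrict_Ioc_eq_restrict_Icc]
    refine integral_congr_ae ?_
    filter_upwards [S.sol.ae_integral_mul_eq_energy] with t ht
    rw [S.energyE_eq, ← ht, ← integral_unitMeasure]
    refine integral_congr_ae ?_
    filter_upwards [S.sol.derivs_zero_ae t] with h hh
    simp only [V, hh]
  linarith

end TruncSol

/-! ### The initial datum -/

section Datum

variable {u₀ : ℝ → ℝ} {L : ℝ}

theorem mass_pos_of_lintegral_inv (hc : Continuous u₀)
    (hL : ∫⁻ h in Icc (0 : ℝ) 1, (ENNReal.ofReal (u₀ h))⁻¹ = ENNReal.ofReal L) : 0 < L := by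
  by_contra hcon
  rw [ENNReal.ofReal_of_nonpos (not_lt.1 hcon),
    lintegral_eq_zero_iff (by have := hc.measurable; fun_prop)] at hL
  have h1 : ∀ᵐ h ∂unitMeasure, False := by
    filter_upwards [hL] with h hh
    simp at hh
  exact h1.exists.elim fun _ => id

theorem energyE_eq_of_perChain {d : ℕ → ℝ → ℝ} (hd : PerChain 2 d) :
    energyE (d 0) = ∫ h in (0 : ℝ)..1, compChain cubic d 2 h ^ 2 := by
  refine intervalIntegral.integral_congr_ae ?_
  filter_upwards [(hd.comp (Or.inl rfl) contDiff_cubic).weakDeriv_ae_eq (by norm_num) (k := 2) le_rfl]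
    with x hx _
  rw [← hx]
  rfl

/-- The datum is bounded below by `J`, hence positive. -/
theorem lowerJ_le_datum (hu₀ : MemHper 2 u₀) (hnonneg : ∀ h, 0 ≤ u₀ h)
    (hL : ∫⁻ h in Icc (0 : ℝ) 1, (ENNReal.ofReal (u₀ h))⁻¹ = ENNReal.ofReal L) (h : ℝ) :
    lowerJ L (energyE u₀) ≤ u₀ h := by
  have hL0 := mass_pos_of_lintegral_inv hu₀.continuous hL
  obtain ⟨d, rfl, hd⟩ := hu₀.exists_perChain (by norm_num)
  have he := hd.comp (Or.inl rfl) contDiff_cubic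
  obtain ⟨h₀, hmin⟩ := he.exists_min (by norm_num)
  have hmin' : ∀ x, d 0 h₀ ≤ d 0 x := fun x => cubic_strictMono.le_iff_le.1 (hmin x)
  -- as `u₀` may vanish a priori, the static bound is applied to `u₀ + ε`
  refine le_trans (le_of_forall_pos_le_add fun ε hε => ?_) (hmin' h)
  have hpos : ∀ x, 0 < d 0 x + ε := fun x => add_pos_of_nonneg_of_pos (hnonneg x) hε
  have hqc : Continuous fun x => d 0 x + ε := hu₀.continuous.add continuous_const
  refine lowerJ_le he hL0 (energyE_eq_of_perChain hd).ge hmin hpos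
    (fun x => by simp [hd.per 0 (by norm_num) x]) hqc ?_ fun x => ?_
  · -- compare with the extended integral of `1 / u₀`
    have hi : Integrable (fun x => (d 0 x + ε)⁻¹) unitMeasure :=
      (intervalIntegrable_iff_integrableOn_Icc_of_le zero_le_one).1
        ((hqc.inv₀ fun x => (hpos x).ne').intervalIntegrable 0 1)
    rw [← integral_unitMeasure, ← ENNReal.ofReal_le_ofReal_iff hL0.le, ← hL,
      ofReal_integral_eq_lintegral_ofReal hi (Eventually.of_forall fun x => (inv_pos.2 (hpos x)).le)]
    refine lintegral_mono fun x => ?_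
    rw [ENNReal.ofReal_inv_of_pos (hpos x), ENNReal.inv_le_inv]
    exact ENNReal.ofReal_le_ofReal (by linarith)
  · have := sub_le_cubic_sub (hmin' x)
    simp only [compChain]
    linarith

theorem integral_inv_datum (hu₀ : Continuous u₀) (hpos : ∀ h, 0 < u₀ h) (hL0 : 0 < L)
    (hL : ∫⁻ h in Icc (0 : ℝ) 1, (ENNReal.ofReal (u₀ h))⁻¹ = ENNReal.ofReal L) :
    ∫ h in (0 : ℝ)..1, (u₀ h)⁻¹ = L := by
  have h1 : ∀ h, (ENNReal.ofReal (u₀ h))⁻¹ = ENNReal.ofReal (u₀ h)⁻¹ := fun h =>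
    (ENNReal.ofReal_inv_of_pos (hpos h)).symm
  simp only [h1] at hL
  rw [← integral_unitMeasure, integral_eq_lintegral_of_nonneg_ae
    (Eventually.of_forall fun h => (inv_pos.2 (hpos h)).le)
    (hu₀.inv₀ fun h => (hpos h).ne').aestronglyMeasurable, hL, ENNReal.toReal_ofReal hL0.le]

theorem energyE_nonneg (u : ℝ → ℝ) : 0 ≤ energyE u :=
  intervalIntegral.integral_nonneg zero_le_one fun _ _ => sq_nonneg _

/-- There is a truncation wide enough for the datum and for the a priori bounds, and the truncated
equation is solvable on every time interval. -/
theorem exists_truncSol (hu₀ : MemHper 2 u₀) (hnonneg : ∀ h, 0 ≤ u₀ h)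
    (hL : ∫⁻ h in Icc (0 : ℝ) 1, (ENNReal.ofReal (u₀ h))⁻¹ = ENNReal.ofReal L) {T : ℝ}
    (hT : 0 < T) : ∃ a b d₀ η, TruncSol T L a b u₀ d₀ η := by
  have hL0 := mass_pos_of_lintegral_inv hu₀.continuous hL
  have hlow := lowerJ_le_datum hu₀ hnonneg hL
  obtain ⟨d, rfl, hd⟩ := hu₀.exists_perChain (by norm_num)
  set E := energyE (d 0) with hE
  have hE0 : 0 ≤ E := energyE_nonneg _
  obtain ⟨l, hl⟩ : ∃ l, l = lowerInit L E := ⟨_, rfl⟩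
  have hl0 : 0 < l := hl ▸ lowerInit_pos hL0 hE0
  have hlu : ∀ h, l ≤ d 0 h := fun h =>
    (hl.trans_le (lowerInit_le_lowerJ hL0 le_rfl)).trans (hlow h)
  have hpos : ∀ h, 0 < d 0 h := fun h => hl0.trans_le (hlu h)
  obtain ⟨M, hM⟩ : ∃ M, ∀ h, d 0 h ≤ M := by
    have hneg : PerChain 1 fun j x => -1 * d j x :=
      ⟨fun j hj => (hd.prim j (by omega)).const_mul _,
        fun j hj x => by simp [hd.per j (by omega) x], (hd.memLp_of_le (by norm_num)).const_mul _⟩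
    obtain ⟨h₀, hh⟩ := hneg.exists_min (by norm_num)
    exact ⟨d 0 h₀, fun h => by linarith [hh h]⟩
  have hM0 : 0 < M := (hpos 0).trans_le (hM 0)
  have hLi : 0 < L⁻¹ := inv_pos.2 hL0
  have hs := Real.sqrt_nonneg E
  -- The truncation is to `[A⁻¹, L + l⁻¹]`. In `A`, the term `M` makes room for the datum and `L⁻¹ + √E`
  -- for the solution, since `cubic A - cubic L⁻¹ ≥ A - L⁻¹`; and `l` bounds both from below.
  obtain ⟨A, hA⟩ : ∃ A, A = L⁻¹ + √E + M := ⟨_, rfl⟩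
  have hA0 : 0 < A := by linarith
  have hab : A⁻¹ ≤ L := inv_le_of_inv_le₀ hL0 (by linarith)
  have hLb : L ≤ L + l⁻¹ := by linarith [inv_pos.2 hl0]
  have hnl := decreasingBilipschitz_truncF (inv_pos.2 hA0) (hab.trans hLb)
  have hmem : ∀ h, (d 0 h)⁻¹ ∈ Icc A⁻¹ (L + l⁻¹) := fun h =>
    ⟨inv_anti₀ (hpos h) (by linarith [hM h]), by linarith [inv_anti₀ hl0 (hlu h)]⟩
  have hw₀ : Continuous fun h => (d 0 h)⁻¹ := hu₀.continuous.inv₀ fun h => (hpos h).ne'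
  have hc := hd.comp (Or.inl rfl) contDiff_cubic
  have hdat : ∀ h, compChain cubic d 0 h = truncF A⁻¹ (L + l⁻¹) (d 0 h)⁻¹ := fun h => by
    rw [truncF_eq (inv_pos.2 hA0) (hmem h), inv_inv]; rfl
  obtain ⟨η, h1, h2, h3⟩ := exists_weak_solution hT.le hnl hw₀ (by
    have := hc.hasSum_freq_mul_sq.summable
    rwa [funext hdat] at this)
  refine ⟨A⁻¹, L + l⁻¹, compChain cubic d, η, ⟨hnl, hw₀, hc, hdat, h1, h2, h3⟩, hT, hL0,
    inv_pos.2 hA0, hab, hLb, ?_, ?_, integral_inv_datum hu₀.continuous hpos hL0 hL, hmem⟩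
  · rw [← energyE_eq_of_perChain hd, ← hE, inv_inv]
    have := sub_le_cubic_sub (x := L⁻¹) (y := A) (by linarith)
    linarith
  · rw [← energyE_eq_of_perChain hd, ← hE, ← hl]
    exact inv_lt_of_inv_lt₀ hl0 (by linarith)

end Datum

/-! ### Uniqueness -/

/-- The nearest point of `[0,T]`. -/
def clip (T t : ℝ) : ℝ := max 0 (min T t)

theorem clip_mem {T : ℝ} (hT : 0 ≤ T) (t : ℝ) : clip T t ∈ Icc 0 T :=
  ⟨le_max_left _ _, max_le hT (min_le_left _ _)⟩

theorem clip_of_mem {T t : ℝ} (ht : t ∈ Icc 0 T) : clip T t = t := by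
  rw [clip, min_eq_right ht.2, max_eq_right ht.1]

theorem continuous_clip (T : ℝ) : Continuous (clip T) := by unfold clip; fun_prop

theorem timePrim_clip {T : ℝ} (hT : 0 ≤ T) (f : ℝ × ℝ → ℝ) (t h : ℝ) :
    timePrim T f (clip T t, h) = timePrim T f (t, h) := by
  rcases le_total t 0 with ht | ht
  · have : clip T t = 0 := max_eq_left ((min_le_right _ _).trans ht)
    rw [this, timePrim_zero _ le_rfl, timePrim_zero _ ht]
  · refine integral_congr_ae ?_
    filter_upwards [ae_restrict_mem measurableSet_Icc] with s hs
    have : s ≤ clip T t ↔ s ≤ t := by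
      rw [clip, max_eq_right (le_min hT ht), le_min_iff]
      exact ⟨fun h => h.2, fun h => ⟨hs.2, h⟩⟩
    simp only [this]

theorem memLp_cyl_continuous_mul {T : ℝ} {c g : ℝ × ℝ → ℝ} (hc : Continuous c)
    (hg : MemLp g 2 (cylMeasure T)) : MemLp (fun q => c q * g q) 2 (cylMeasure T) := by
  obtain ⟨M, hM⟩ := ((isCompact_Icc (a := 0) (b := T)).prod
    (isCompact_Icc (a := (0 : ℝ)) (b := 1))).exists_bound_of_continuousOn hc.continuousOn
  refine hg.of_le_mul (c := M) (hc.aestronglyMeasurable.mul hg.1) ?_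
  filter_upwards [ae_cyl_mem T, ae_cyl_of_ae_unit ae_unit_mem] with q h1 h2
  rw [norm_mul]
  exact mul_le_mul_of_nonneg_right (hM q ⟨h1, h2⟩) (norm_nonneg _)

theorem memLp_cyl_continuous {T : ℝ} {c : ℝ × ℝ → ℝ} (hc : Continuous c) :
    MemLp c 2 (cylMeasure T) := by
  simpa using memLp_cyl_continuous_mul hc (memLp_const (1 : ℝ))

theorem MemHper.abs_le_two_mul_hperNorm {f : ℝ → ℝ} (hf : MemHper 2 f) (x : ℝ) :
    |f x| ≤ 2 * hperNorm 2 f := by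
  obtain ⟨d, rfl, hd⟩ := hf.exists_perChain (by norm_num)
  have hle : ∀ k ∈ Finset.range 3, √(∫ t in (0 : ℝ)..1, d k t ^ 2) ≤ hperNorm 2 (d 0) := by
    intro k hk
    rw [Real.sqrt_le_left (hperNorm_nonneg _ _), hd.hperNorm_sq (by norm_num)]
    exact Finset.single_le_sum (f := fun k => ∫ t in (0 : ℝ)..1, d k t ^ 2)
      (fun i _ => intervalIntegral.integral_nonneg zero_le_one fun _ _ => sq_nonneg _) hk
  have := (hd.prim 0 (by norm_num)).abs_le (hd.per 0 (by norm_num)) (hd.memLp_of_le (by norm_num)) x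
  linarith [hle 0 (by simp), hle 1 (by simp)]

theorem MemHper.sub {m : ℕ} (hm : 1 ≤ m) {f g : ℝ → ℝ} (hf : MemHper m f) (hg : MemHper m g) :
    MemHper m fun x => f x - g x := by
  obtain ⟨d, rfl, hd⟩ := hf.exists_perChain hm
  obtain ⟨e, rfl, he⟩ := hg.exists_perChain hm
  exact (hd.sub he).memHper hm

/-- Functions in `C([0,T]; H²)` are jointly continuous. -/
theorem MemCHper.continuous_clip {T : ℝ} (hT : 0 ≤ T) {u : ℝ → ℝ → ℝ} (hu : MemCHper T 2 u) :
    Continuous fun q : ℝ × ℝ => u (clip T q.1) q.2 := by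
  rw [continuous_iff_continuousAt]
  rintro ⟨t, h⟩
  have hmem := fun t => clip_mem hT t
  have h0 : Tendsto (fun s => hperNorm 2 fun h => u (clip T s) h - u (clip T t) h) (𝓝 t) (𝓝 0) :=
    (hu.2 _ (hmem t)).comp (tendsto_nhdsWithin_iff.2
      ⟨(SlopeEq.continuous_clip T).tendsto t, Eventually.of_forall hmem⟩)
  have h1 : Tendsto (fun q : ℝ × ℝ => 2 * hperNorm 2 (fun h => u (clip T q.1) h - u (clip T t) h)
      + |u (clip T t) q.2 - u (clip T t) h|) (𝓝 (t, h)) (𝓝 0) := by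
    have h4 : Continuous fun q : ℝ × ℝ => |u (clip T t) q.2 - u (clip T t) h| := by
      have := (hu.1 _ (hmem t)).continuous
      fun_prop
    simpa using ((h0.comp (continuous_fst.tendsto (t, h))).const_mul 2).add (h4.tendsto (t, h))
  rw [ContinuousAt, tendsto_iff_dist_tendsto_zero]
  refine squeeze_zero (fun q => dist_nonneg) (fun q => ?_) h1
  have h5 := ((hu.1 _ (hmem q.1)).sub (by norm_num) (hu.1 _ (hmem t))).abs_le_two_mul_hperNorm q.2
  rw [Real.dist_eq]
  exact (abs_sub_le _ (u (clip T t) q.2) _).trans (add_le_add h5 le_rfl)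

/-- A weak time derivative in `L²` is a time derivative along almost every line `h = const`: both
sides have the same Fourier coefficients in `h`, by du Bois-Reymond's lemma. -/
theorem HasL2TimeDeriv.ae_eq_timePrim {T : ℝ} (hT : 0 < T) {u w : ℝ → ℝ → ℝ} {W : ℝ × ℝ → ℝ}
    (hu : Continuous fun q : ℝ × ℝ => u (clip T q.1) q.2) (hw : HasL2TimeDeriv T u w)
    (hW : StronglyMeasurable W) (hWw : Function.uncurry w =ᵐ[cylMeasure T] W) :
    ∀ᵐ h ∂unitMeasure, ∀ t, u (clip T t) h = u 0 h + timePrim T W (t, h) := by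
  have hW2 : MemLp W 2 (cylMeasure T) := hw.1.ae_eq hWw
  have hWi := integrable_of_memLp hW2
  have hslice : ∀ t, Continuous (u (clip T t)) := fun t =>
    Continuous.comp (g := fun q : ℝ × ℝ => u (clip T q.1) q.2) (f := fun h : ℝ => (t, h)) hu
      (by fun_prop)
  have hline : ∀ h, Continuous fun t => u (clip T t) h := fun h =>
    Continuous.comp (g := fun q : ℝ × ℝ => u (clip T q.1) q.2) (f := fun t : ℝ => (t, h)) hu
      (by fun_prop)
  have hW_line : ∀ᵐ h ∂unitMeasure, ∀ᵐ t ∂timeMeasure T, w t h = W (t, h) :=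
    ae_ae_of_ae_cyl_symm (q := fun q => w q.1 q.2 = W q) hWw
  have c0 : clip T 0 = 0 := clip_of_mem ⟨le_rfl, hT.le⟩
  -- the Fourier coefficients
  have hcoef : ∀ k, ∀ t ∈ Icc 0 T, fcoef (u (clip T t)) k =
      fcoef (u 0) k + tPrim T (fun s => fcoef (fun h => W (s, h)) k) t := by
    intro k
    have hWk : Integrable (fun s => fcoef (fun h => W (s, h)) k) (timeMeasure T) := by
      refine MemLp.integrable (q := 2) (by norm_num) ?_
      rw [memLp_two_iff_integrable_sq (stronglyMeasurable_fcoef hW k).aestronglyMeasurable]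
      exact integrable_fcoef_sq hW hW2 k
    have hp := isPrim_tPrim hWk
    have hUc : Continuous fun t => fcoef (u (clip T t)) k := by
      exact intervalIntegral.continuous_parametric_intervalIntegral_of_continuous'
        (f := fun t x => u (clip T t) x * cas k x)
        (hu.mul ((continuous_cas k).comp continuous_snd)) 0 1
    let g : ℝ → ℝ := fun t => fcoef (u (clip T t)) k - tPrim T (fun s => fcoef (fun h => W (s, h)) k) t
    have hg : Continuous g := hUc.sub hp.continuous
    have hweak : ∀ φ : ℝ → ℝ, ContDiff ℝ ∞ φ → HasCompactSupport φ → tsupport φ ⊆ Ioo 0 T →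
        ∫ x, g x * deriv φ x = 0 := by
      intro φ hφ hφc hφs
      have hφ' : Continuous (deriv φ) := hφ.continuous_deriv (by simp)
      have hφ'c : HasCompactSupport (deriv φ) := hφc.deriv
      have hzero : ∀ t, t ∉ Icc 0 T → φ t = 0 := fun t ht =>
        image_eq_zero_of_notMem_tsupport fun hm => ht (Ioo_subset_Icc_self (hφs hm))
      have hzero' : ∀ t, t ∉ Icc 0 T → deriv φ t = 0 := fun t ht =>
        image_eq_zero_of_notMem_tsupport fun hm => ht
          (Ioo_subset_Icc_self (hφs (tsupport_deriv_subset (𝕜 := ℝ) hm)))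
      have hcas : Continuous fun q : ℝ × ℝ => cas k q.2 := (continuous_cas k).comp continuous_snd
      have i1 : Integrable (fun q : ℝ × ℝ => u (clip T q.1) q.2 * cas k q.2 * deriv φ q.1)
          (cylMeasure T) := integrable_of_memLp (memLp_cyl_continuous
          ((hu.mul hcas).mul (hφ'.comp continuous_fst)))
      have hφcont := hφ.continuous
      have i2 : Integrable (fun q : ℝ × ℝ => (φ q.1 * cas k q.2) * W q) (cylMeasure T) :=
        integrable_of_memLp (memLp_cyl_continuous_mul
          ((hφcont.comp continuous_fst).mul hcas) hW2)
      have e1 : ∫ t, fcoef (u (clip T t)) k * deriv φ t =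
          ∫ q, u (clip T q.1) q.2 * cas k q.2 * deriv φ q.1 ∂cylMeasure T := by
        rw [integral_cyl i1, ← setIntegral_eq_integral_of_forall_compl_eq_zero
          (s := Icc 0 T) fun t ht => by rw [hzero' t ht, mul_zero]]
        refine integral_congr_ae (Eventually.of_forall fun t => ?_)
        simp only
        rw [integral_mul_const, fcoef_eq_integral_unitMeasure]
      have e2 : ∫ t, (Icc 0 T).indicator (fun s => fcoef (fun h => W (s, h)) k) t * φ t =
          ∫ q, (φ q.1 * cas k q.2) * W q ∂cylMeasure T := by
        rw [integral_cyl i2, ← setIntegral_eq_integral_of_forall_compl_eq_zero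
          (s := Icc 0 T) fun t ht => by rw [hzero t ht, mul_zero]]
        refine setIntegral_congr_fun measurableSet_Icc fun t ht => ?_
        simp only [indicator_of_mem ht]
        rw [fcoef_eq_integral_unitMeasure, ← integral_mul_const]
        refine integral_congr_ae (Eventually.of_forall fun h => ?_)
        simp only; ring
      have e3 : ∫ q, u (clip T q.1) q.2 * cas k q.2 * deriv φ q.1 ∂cylMeasure T =
          -∫ q, (φ q.1 * cas k q.2) * W q ∂cylMeasure T := by
        rw [integral_cyl_symm i1, integral_cyl_symm i2, ← integral_neg]
        refine integral_congr_ae ?_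
        filter_upwards [hw.2.2 φ hφ hφc hφs, hW_line] with h hh hWh
        have e4 : ∫ t, u (clip T t) h * cas k h * deriv φ t ∂timeMeasure T =
            cas k h * ∫ t in (0 : ℝ)..T, deriv φ t * u t h := by
          rw [intervalIntegral.integral_of_le hT.le, restrict_Ioc_eq_restrict_Icc,
            ← integral_const_mul]
          refine setIntegral_congr_fun measurableSet_Icc fun t ht => ?_
          simp only [clip_of_mem ht]; ring
        have e5 : ∫ t, φ t * cas k h * W (t, h) ∂timeMeasure T =
            cas k h * ∫ t in (0 : ℝ)..T, φ t * w t h := by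
          rw [intervalIntegral.integral_of_le hT.le, restrict_Ioc_eq_restrict_Icc,
            ← integral_const_mul]
          refine integral_congr_ae ?_
          filter_upwards [hWh] with t ht
          rw [ht]; ring
        rw [e4, e5, hh]; ring
      have e6 := hp.integral_mul_deriv hφ hφc
      have j1 : Integrable (fun t => fcoef (u (clip T t)) k * deriv φ t) :=
        (hUc.mul hφ').integrable_of_hasCompactSupport hφ'c.mul_left
      have j2 : Integrable (fun t => tPrim T (fun s => fcoef (fun h => W (s, h)) k) t * deriv φ t) :=
        (hp.continuous.mul hφ').integrable_of_hasCompactSupport hφ'c.mul_left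
      simp only [g, sub_mul]
      rw [integral_sub j1 j2, e1, e6, e2, e3]
      ring
    obtain ⟨c, hc⟩ := ae_eq_const_of_integral_deriv_mul_eq_zero isOpen_Ioo ordConnected_Ioo
      (nonempty_Ioo.2 hT) (hg.locallyIntegrable.locallyIntegrableOn _) hweak
    have hc' : g =ᵐ[volume.restrict (Icc 0 T)] fun _ => c := by
      rw [← restrict_Ioo_eq_restrict_Icc]
      exact (ae_restrict_iff' measurableSet_Ioo).2 hc
    have hc2 := Measure.eqOn_Icc_of_ae_eq volume hT.ne hc' hg.continuousOn continuousOn_const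
    intro t ht
    have h1 := hc2 ht
    have h2 := hc2 (⟨le_rfl, hT.le⟩ : (0 : ℝ) ∈ Icc 0 T)
    simp only [g, c0, tPrim_zero T _ le_rfl] at h1 h2
    linarith
  -- equality for fixed `t`, hence for all rational `t` almost everywhere
  have hfix : ∀ t, ∀ᵐ h ∂unitMeasure, u (clip T t) h = u 0 h + timePrim T W (t, h) := by
    intro t
    have m1 := memLp_timePrim_slice hW hW2 t
    have m2 : MemLp (u 0) 2 unitMeasure := by
      have := hslice 0
      rw [c0] at this
      exact memLp_two_of_continuous this
    have m3 : MemLp (fun h => u 0 h + timePrim T W (t, h)) 2 unitMeasure := m2.add m1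
    refine ae_eq_of_fcoef_eq (memLp_two_of_continuous (hslice t)) m3 fun k => ?_
    have h1 := hcoef k (clip T t) (clip_mem hT.le t)
    have h2 : fcoef (fun h => timePrim T W (t, h)) k =
        fcoef (fun h => u 0 h + timePrim T W (t, h)) k - fcoef (u 0) k := by
      rw [← fcoef_sub (memLp_intervalIntegrable m3) (memLp_intervalIntegrable m2)]
      simp
    have h3 : tPrim T (fun s => fcoef (fun h => W (s, h)) k) (clip T t) =
        fcoef (fun h => timePrim T W (t, h)) k := by
      rw [← fcoef_timePrim_eq_tPrim hWi]
      simp only [timePrim_clip hT.le]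
    rw [clip_of_mem (clip_mem hT.le t), h3, h2] at h1
    linarith
  have hrat := ae_all_iff.2 fun r : ℚ => hfix r
  filter_upwards [hrat, ae_integrable_time hWi] with h h1 h2
  exact fun t => congrFun (Rat.denseRange_cast.equalizer (hline h)
    (continuous_const.add (isPrim_timePrim h2).continuous) (funext h1)) t

/-- For a strong solution, `(1/u)_t = (u³ + u)_hhhh` in integrated form. -/
theorem IsStrongSolution.exists_rate {T : ℝ} (hT : 0 < T) {u₀ : ℝ → ℝ} {u : ℝ → ℝ → ℝ}
    (S : IsStrongSolution T u₀ u) : ∃ ζ : ℝ × ℝ → ℝ, StronglyMeasurable ζ ∧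
      MemLp ζ 2 (cylMeasure T) ∧
      (∀ᵐ h ∂unitMeasure, ∀ t, (u (clip T t) h)⁻¹ = (u₀ h)⁻¹ + timePrim T ζ (t, h)) ∧
      ∀ᵐ t ∂timeMeasure T, ∀ k, fcoef (fun h => ζ (t, h)) k =
        freq k ^ 4 * fcoef (fun h => cubic (u t h)) k := by
  have hu := S.memC.continuous_clip hT.le
  have hpos : ∀ t h, 0 < u (clip T t) h := fun t h => S.pos _ (clip_mem hT.le t) h
  obtain ⟨w, hw, heq⟩ := S.eqn
  let W := hw.1.1.mk _
  have hWm : StronglyMeasurable W := hw.1.1.stronglyMeasurable_mk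
  have hWw : Function.uncurry w =ᵐ[cylMeasure T] W := hw.1.1.ae_eq_mk
  have hline := hw.ae_eq_timePrim hT hu hWm hWw
  have hc : Continuous fun q : ℝ × ℝ => -((u (clip T q.1) q.2) ^ 2)⁻¹ :=
    ((hu.pow 2).inv₀ fun q => (pow_pos (hpos _ _) 2).ne').neg
  have hW2 : MemLp W 2 (cylMeasure T) := hw.1.ae_eq hWw
  let ζ : ℝ × ℝ → ℝ := fun q => -((u (clip T q.1) q.2) ^ 2)⁻¹ * W q
  have hζ2 : MemLp ζ 2 (cylMeasure T) := memLp_cyl_continuous_mul hc hW2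
  refine ⟨ζ, hc.stronglyMeasurable.mul hWm, hζ2, ?_, ?_⟩
  · filter_upwards [hline, ae_integrable_time (integrable_of_memLp hW2),
      ae_integrable_time (integrable_of_memLp hζ2)] with h h1 h2 h3 t
    have p1 := isPrim_timePrim h2
    have hl : Continuous fun t => u (clip T t) h :=
      Continuous.comp (g := fun q : ℝ × ℝ => u (clip T q.1) q.2) (f := fun t : ℝ => (t, h)) hu
        (by fun_prop)
    have p2 : IsPrim (fun t => u (clip T t) h) ((Icc 0 T).indicator fun t => W (t, h)) := by
      refine ⟨p1.locInt, fun t => ?_⟩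
      rw [h1 t, h1 0, p1.eq t]; ring
    have p3 := (p2.comp (Φ := fun y => y⁻¹) (Φ' := fun y => -(y ^ 2)⁻¹)
      (fun t => hasDerivAt_inv (hpos t h).ne')
      (((hl.pow 2).inv₀ fun t => (pow_pos (hpos t h) 2).ne').neg)).eq t
    have p4 := (isPrim_timePrim h3).eq t
    have e : (fun t => -((u (clip T t) h) ^ 2)⁻¹ * (Icc 0 T).indicator (fun t => W (t, h)) t) =
        (Icc 0 T).indicator fun t => ζ (t, h) := by
      funext s
      by_cases hs : s ∈ Icc 0 T
      · simp only [indicator_of_mem hs, ζ]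
      · simp only [indicator_of_notMem hs, mul_zero]
    rw [e] at p3
    rw [timePrim_zero _ le_rfl, zero_add] at p4
    rw [p3, p4, clip_of_mem ⟨le_rfl, hT.le⟩, S.init]
  · filter_upwards [heq, S.memL2.2.1, ae_ae_of_ae_cyl (q := fun q => w q.1 q.2 = W q) hWw,
      ae_restrict_mem measurableSet_Icc] with t ht hH hWt htm k
    obtain ⟨d, hd0, hd⟩ := hH.exists_perChain (by norm_num)
    have hcd := hd.comp (Or.inr rfl) contDiff_cubic
    have hc0 : compChain cubic d 0 = fun h => cubic (u t h) := by rw [← hd0]; rfl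
    have h4 : flux (u t) =ᵐ[volume] compChain cubic d 4 := by
      have := hcd.weakDeriv_ae_eq (by norm_num) (k := 4) le_rfl
      rwa [hc0] at this
    have h5 := hcd.fcoef_even (n := 2) k
    rw [← hc0, show freq k ^ 4 = (-freq k ^ 2) ^ 2 by ring, ← h5]
    refine fcoef_congr ?_ k
    filter_upwards [ht, ae_restrict_of_ae h4, hWt] with h h1 h2 h3
    have h6 := (S.pos t htm h).ne'
    simp only [ζ, clip_of_mem htm]
    rw [← h3, h1, h2]
    field_simp

/-- Strong solutions are unique: the difference of the functions `1/u` of two solutions is the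
accretive operator `∂⁴ ∫₀ᵗ` applied to the difference of the functions `u³ + u`, and `u³ + u` is a
strictly decreasing function of `1/u`. -/
theorem IsStrongSolution.unique {T : ℝ} (hT : 0 < T) {u₀ : ℝ → ℝ} {u v : ℝ → ℝ → ℝ}
    (Su : IsStrongSolution T u₀ u) (Sv : IsStrongSolution T u₀ v) : ∀ t ∈ Icc 0 T, u t = v t := by
  have hu := Su.memC.continuous_clip hT.le
  have hv := Sv.memC.continuous_clip hT.le
  have hup : ∀ t h, 0 < u (clip T t) h := fun t h => Su.pos _ (clip_mem hT.le t) h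
  have hvp : ∀ t h, 0 < v (clip T t) h := fun t h => Sv.pos _ (clip_mem hT.le t) h
  obtain ⟨ζ, hζm, hζ2, hζ, hζk⟩ := Su.exists_rate hT
  obtain ⟨ξ, hξm, hξ2, hξ, hξk⟩ := Sv.exists_rate hT
  let y : ℝ × ℝ → ℝ := fun q => (u (clip T q.1) q.2)⁻¹ - (v (clip T q.1) q.2)⁻¹
  let z : ℝ × ℝ → ℝ := fun q => cubic (u (clip T q.1) q.2) - cubic (v (clip T q.1) q.2)
  have hcub := contDiff_cubic.continuous
  have hyc : Continuous y := (hu.inv₀ fun q => (hup _ _).ne').sub (hv.inv₀ fun q => (hvp _ _).ne')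
  have hzc : Continuous z := (hcub.comp hu).sub (hcub.comp hv)
  have hy2 : MemLp y 2 (cylMeasure T) := memLp_cyl_continuous hyc
  have hz2 : MemLp z 2 (cylMeasure T) := memLp_cyl_continuous hzc
  have hyz : ∀ q, y q * z q ≤ 0 := by
    intro q
    have h1 := hup q.1 q.2
    have h2 := hvp q.1 q.2
    rcases le_total (u (clip T q.1) q.2) (v (clip T q.1) q.2) with h | h
    · exact mul_nonpos_of_nonneg_of_nonpos (sub_nonneg.2 (inv_anti₀ h1 h))
        (sub_nonpos.2 (cubic_strictMono.monotone h))
    · exact mul_nonpos_of_nonpos_of_nonneg (sub_nonpos.2 (inv_anti₀ h2 h))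
        (sub_nonneg.2 (cubic_strictMono.monotone h))
  -- the coefficients of `y` are time primitives
  let ρ : ℝ × ℝ → ℝ := fun q => ζ q - ξ q
  have hρm : StronglyMeasurable ρ := hζm.sub hξm
  have hρ2 : MemLp ρ 2 (cylMeasure T) := hζ2.sub hξ2
  have hyk : ∀ k t, fcoef (fun h => y (t, h)) k =
      tPrim T (fun s => fcoef (fun h => ρ (s, h)) k) t := by
    intro k t
    rw [← fcoef_timePrim_eq_tPrim (integrable_of_memLp hρ2)]
    refine fcoef_congr ?_ k
    filter_upwards [hζ, hξ, ae_integrable_time (integrable_of_memLp hζ2),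
      ae_integrable_time (integrable_of_memLp hξ2)] with h h1 h2 h3 h4
    simp only [y, h1 t, h2 t]
    have h5 : timePrim T ρ (t, h) = timePrim T ζ (t, h) - timePrim T ξ (t, h) := by
      have e1 := integrable_ite_le h3 t
      have e2 := integrable_ite_le h4 t
      simp only [timePrim]
      rw [← integral_sub e1 e2]
      refine integral_congr_ae (Eventually.of_forall fun s => ?_)
      simp only [ρ]
      split_ifs <;> ring
    rw [h5]; ring
  have hρk : ∀ᵐ t ∂timeMeasure T, ∀ k, fcoef (fun h => ρ (t, h)) k =
      freq k ^ 4 * fcoef (fun h => z (t, h)) k := by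
    filter_upwards [hζk, hξk, ae_memLp_slice hζ2, ae_memLp_slice hξ2,
      ae_restrict_mem measurableSet_Icc] with t h1 h2 h3 h4 htm k
    have c1 : Continuous fun h => cubic (u t h) := hcub.comp (Su.memC.1 t htm).continuous
    have c2 : Continuous fun h => cubic (v t h) := hcub.comp (Sv.memC.1 t htm).continuous
    simp only [ρ, z, clip_of_mem htm]
    rw [fcoef_sub (memLp_intervalIntegrable h3) (memLp_intervalIntegrable h4),
      fcoef_sub (c1.intervalIntegrable _ _) (c2.intervalIntegrable _ _), h1, h2]
    ring
  -- for `k ≠ 0` the integral is `y_k(T)² / (2 μ_k)`; for `k = 0` the coefficient `y_0` vanishes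
  have hterm : ∀ k, 0 ≤ tPrim T (fun s => fcoef (fun h => y (s, h)) k *
      fcoef (fun h => z (s, h)) k) T := by
    intro k
    have hρi : Integrable (fun s => fcoef (fun h => ρ (s, h)) k) (timeMeasure T) := by
      refine MemLp.integrable (q := 2) (by norm_num) ?_
      rw [memLp_two_iff_integrable_sq (stronglyMeasurable_fcoef hρm k).aestronglyMeasurable]
      exact integrable_fcoef_sq hρm hρ2 k
    rcases eq_or_ne k 0 with rfl | hk
    · have h0 : ∀ t, fcoef (fun h => y (t, h)) 0 = 0 := fun t => by
        rw [hyk]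
        refine integral_eq_zero_of_ae ?_
        filter_upwards [hρk] with s hs
        simp [hs 0, freq_zero]
      simp [tPrim, h0]
    · have p := (isPrim_tPrim hρi).sq
      have h1 := p.integral_eq 0 T
      rw [tPrim_zero _ _ le_rfl] at h1
      have h2 : ∫ s in (0 : ℝ)..T, 2 * tPrim T (fun s => fcoef (fun h => ρ (s, h)) k) s *
          (Icc 0 T).indicator (fun s => fcoef (fun h => ρ (s, h)) k) s =
          2 * freq k ^ 4 * ∫ s in (0 : ℝ)..T, fcoef (fun h => y (s, h)) k *
            fcoef (fun h => z (s, h)) k := by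
        rw [← intervalIntegral.integral_const_mul]
        refine intervalIntegral.integral_congr_ae ?_
        filter_upwards [(ae_restrict_iff' measurableSet_Icc).1 hρk] with s hs hsm
        rw [uIoc_of_le hT.le] at hsm
        have hsm' := Ioc_subset_Icc_self hsm
        rw [indicator_of_mem hsm', hs hsm' k, ← hyk]
        ring
      rw [h2] at h1
      have h3 : 0 < freq k ^ 4 := by
        have := freq_ne_zero hk
        positivity
      rw [tPrim_eq _ ⟨hT.le, le_rfl⟩]
      have h4 := sq_nonneg (tPrim T (fun s => fcoef (fun h => ρ (s, h)) k) T)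
      by_contra hcon
      nlinarith [not_le.1 hcon]
  have hsum := hasSum_tPrim_fcoef_mul hyc.stronglyMeasurable hy2 hzc.stronglyMeasurable hz2 T
  have htot := hsum.nonneg hterm
  have hint : Integrable (fun q => y q * z q) (cylMeasure T) :=
    integrable_of_memLp (memLp_cyl_continuous (hyc.mul hzc))
  have hzero : ∀ᵐ q ∂cylMeasure T, y q * z q = 0 := by
    have h1 : ∫ q, y q * z q ∂cylMeasure T =
        tPrim T (fun s => ∫ h in (0 : ℝ)..1, y (s, h) * z (s, h)) T := by
      rw [tPrim_eq _ ⟨hT.le, le_rfl⟩, integral_cyl hint, intervalIntegral.integral_of_le hT.le,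
        restrict_Ioc_eq_restrict_Icc]
      exact integral_congr_ae (Eventually.of_forall fun t => integral_unitMeasure _)
    have h2 : ∫ q, -(y q * z q) ∂cylMeasure T = 0 := by
      rw [integral_neg]
      have h3 : ∫ q, y q * z q ∂cylMeasure T ≤ 0 := integral_nonpos hyz
      linarith
    have h3 := (integral_eq_zero_iff_of_nonneg_ae (f := fun q => -(y q * z q))
      (Eventually.of_forall fun q => neg_nonneg.2 (hyz q)) hint.neg).1 h2
    filter_upwards [h3] with q hq
    simpa using hq
  -- almost everywhere equality and continuity
  have hae : ∀ᵐ t ∂timeMeasure T, u t = v t := by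
    filter_upwards [ae_ae_of_ae_cyl hzero, ae_restrict_mem measurableSet_Icc] with t ht htm
    refine eq_of_ae_eq_of_periodic ?_ (Su.memC.1 t htm).continuous (Sv.memC.1 t htm).continuous
      (Su.memC.1 t htm).periodic (Sv.memC.1 t htm).periodic
    filter_upwards [ht] with h hh
    rcases mul_eq_zero.1 hh with h1 | h1
    · simpa only [clip_of_mem htm] using inv_injective (sub_eq_zero.1 h1)
    · simpa only [clip_of_mem htm] using cubic_strictMono.injective (sub_eq_zero.1 h1)
  intro t ht
  funext h
  have hl : ∀ {g : ℝ → ℝ → ℝ}, (Continuous fun q : ℝ × ℝ => g (clip T q.1) q.2) →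
      Continuous fun t => g (clip T t) h := fun {g} hg =>
    Continuous.comp (g := fun q : ℝ × ℝ => g (clip T q.1) q.2) (f := fun t : ℝ => (t, h)) hg
      (by fun_prop)
  have h1 : (fun t => u (clip T t) h) =ᵐ[volume.restrict (Icc 0 T)] fun t => v (clip T t) h := by
    filter_upwards [hae, ae_restrict_mem measurableSet_Icc] with t ht htm
    rw [clip_of_mem htm, ht]
  have h2 := Measure.eqOn_Icc_of_ae_eq volume hT.ne h1 (hl hu).continuousOn (hl hv).continuousOn ht
  simpa only [clip_of_mem ht] using h2

/-! ### Restriction in time and global solutions -/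

theorem cylMeasure_mono {T' T : ℝ} (h : T' ≤ T) : cylMeasure T' ≤ cylMeasure T := by
  simp only [cylMeasure, Measure.prod_restrict]
  exact Measure.restrict_mono (prod_mono (Icc_subset_Icc_right h) le_rfl) le_rfl

theorem timeMeasure_mono {T' T : ℝ} (h : T' ≤ T) : timeMeasure T' ≤ timeMeasure T :=
  Measure.restrict_mono (Icc_subset_Icc_right h) le_rfl

theorem HasL2TimeDeriv.mono {T' T : ℝ} (h0 : 0 ≤ T') (h : T' ≤ T) {u w : ℝ → ℝ → ℝ}
    (hw : HasL2TimeDeriv T u w) : HasL2TimeDeriv T' u w := by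
  refine ⟨hw.1.mono_measure (cylMeasure_mono h), hw.2.1, fun φ hφ hc hs => ?_⟩
  filter_upwards [hw.2.2 φ hφ hc (hs.trans (Ioo_subset_Ioo_right h))] with x hx
  have hcut : ∀ F : ℝ → ℝ, (∀ t, t ∉ Ioo 0 T' → F t = 0) →
      ∫ t in (0 : ℝ)..T', F t = ∫ t in (0 : ℝ)..T, F t := by
    intro F hF
    rw [intervalIntegral.integral_of_le h0, intervalIntegral.integral_of_le (h0.trans h)]
    refine (setIntegral_eq_of_subset_of_forall_sdiff_eq_zero measurableSet_Ioc
      (Ioc_subset_Ioc_right h) fun t ht => hF t fun hm => ht.2 (Ioo_subset_Ioc_self hm)).symm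
  rw [hcut _ fun t ht => ?_, hcut _ fun t ht => ?_, hx]
  · rw [image_eq_zero_of_notMem_tsupport fun hm => ht (hs hm), zero_mul]
  · rw [image_eq_zero_of_notMem_tsupport fun hm =>
      ht (hs (tsupport_deriv_subset (𝕜 := ℝ) hm)), zero_mul]

theorem IsStrongSolution.mono {T' T : ℝ} (h0 : 0 ≤ T') (h : T' ≤ T) {u₀ : ℝ → ℝ}
    {u : ℝ → ℝ → ℝ} (S : IsStrongSolution T u₀ u) : IsStrongSolution T' u₀ u where
  pos t ht := S.pos t (Icc_subset_Icc_right h ht)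
  memC := ⟨fun t ht => S.memC.1 t (Icc_subset_Icc_right h ht), fun t ht =>
    (S.memC.2 t (Icc_subset_Icc_right h ht)).mono_left
      (nhdsWithin_mono _ (Icc_subset_Icc_right h))⟩
  memL2 := ⟨S.memL2.1.mono_measure (cylMeasure_mono h), ae_mono (timeMeasure_mono h) S.memL2.2.1,
    (lintegral_mono' (timeMeasure_mono h) le_rfl).trans_lt S.memL2.2.2⟩
  init := S.init
  eqn := by
    obtain ⟨w, hw, he⟩ := S.eqn
    exact ⟨w, hw.mono h0 h, ae_mono (timeMeasure_mono h) he⟩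

theorem IsStrongSolution.congr {T : ℝ} (hT : 0 ≤ T) {u₀ : ℝ → ℝ} {u v : ℝ → ℝ → ℝ}
    (S : IsStrongSolution T u₀ u) (h : ∀ t ∈ Icc 0 T, v t = u t) : IsStrongSolution T u₀ v where
  pos t ht := by rw [h t ht]; exact S.pos t ht
  memC := by
    refine ⟨fun t ht => by rw [h t ht]; exact S.memC.1 t ht, fun t ht => ?_⟩
    refine (S.memC.2 t ht).congr' ?_
    filter_upwards [self_mem_nhdsWithin] with s hs
    rw [h t ht, h s hs]
  memL2 := by
    have hae : ∀ᵐ t ∂timeMeasure T, u t = v t := by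
      filter_upwards [ae_restrict_mem measurableSet_Icc] with t ht
      exact (h t ht).symm
    refine ⟨S.memL2.1.congr ?_, ?_, ?_⟩
    · filter_upwards [ae_cyl_of_ae_time hae] with q hq
      simp only [Function.uncurry, hq]
    · filter_upwards [S.memL2.2.1, hae] with t ht he
      rwa [← he]
    · refine lt_of_le_of_lt (lintegral_mono_ae ?_) S.memL2.2.2
      filter_upwards [hae] with t ht
      rw [ht]
  init := by rw [h 0 ⟨le_rfl, hT⟩, S.init]
  eqn := by
    obtain ⟨w, hw, he⟩ := S.eqn
    refine ⟨w, ⟨hw.1, hw.2.1, fun φ hφ hc hs => ?_⟩, ?_⟩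
    · filter_upwards [hw.2.2 φ hφ hc hs] with x hx
      rw [← hx]
      refine intervalIntegral.integral_congr fun t ht => ?_
      rw [uIcc_of_le hT] at ht
      simp only [h t ht]
    · filter_upwards [he, ae_restrict_mem measurableSet_Icc] with t ht htm
      rwa [h t htm]

end

end SlopeEq

open SlopeEq
theorem theorem1 (u₀ : ℝ → ℝ) (L : ℝ) (hu₀ : MemHper 2 u₀) (hnonneg : ∀ h, 0 ≤ u₀ h)
    (hL : ∫⁻ h in Icc (0 : ℝ) 1, (ENNReal.ofReal (u₀ h))⁻¹ = ENNReal.ofReal L) :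
    ∃ u : ℝ → ℝ → ℝ, ∀ T : ℝ, 0 < T →
      -- existence
      IsStrongSolution T u₀ u ∧
      -- uniqueness
      (∀ v : ℝ → ℝ → ℝ, IsStrongSolution T u₀ v → ∀ t ∈ Icc 0 T, v t = u t) ∧
      -- energy-dissipation equality for `E`
      ((∀ᵐ t ∂(volume.restrict (Icc 0 T)),
          IntervalIntegrable (dissDensity (u t)) volume 0 1) ∧
        IntervalIntegrable (fun t => ∫ h in (0 : ℝ)..1, dissDensity (u t) h) volume 0 T ∧
        energyE (u T) + ∫ t in (0 : ℝ)..T, ∫ h in (0 : ℝ)..1, dissDensity (u t) h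
          = energyE (u 0)) ∧
      -- energy-dissipation equality for `F`
      (IntervalIntegrable (fun t => energyE (u t)) volume 0 T ∧
        energyF (u T) + ∫ t in (0 : ℝ)..T, energyE (u t) = energyF (u 0)) ∧
      -- lower bounds
      (∀ t ∈ Icc 0 T, ∀ h,
        lowerJ L (energyE (u t)) ≤ u t h ∧
        lowerMin L (energyE (u t)) ≤ lowerJ L (energyE (u t)) ∧
        lowerInit L (energyE u₀) ≤ lowerJ L (energyE (u t)) ∧
        0 < lowerInit L (energyE u₀)) := by
  have hL0 := mass_pos_of_lintegral_inv hu₀.continuous hL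
  choose a b d₀ η S using fun T : {T : ℝ // 0 < T} => exists_truncSol hu₀ hnonneg hL T.2
  -- by uniqueness, the solutions constructed on different time intervals agree
  obtain ⟨u, hu⟩ : ∃ u : ℝ → ℝ → ℝ, ∀ (T : ℝ) (hT : 0 < T), ∀ t ∈ Icc 0 T,
      u t = (S ⟨T, hT⟩).u t := by
    have hpos : ∀ t : ℝ, 0 < |t| + 1 := fun t => by positivity
    -- `|t| + 1` is a positive final time after `t`
    refine ⟨fun t => (S ⟨|t| + 1, hpos t⟩).u t, fun T hT t ht => ?_⟩
    have h1 : 0 < min (|t| + 1) T := lt_min (hpos t) hT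
    refine IsStrongSolution.unique h1
      ((S ⟨|t| + 1, hpos t⟩).isStrongSolution.mono h1.le (min_le_left _ _))
      ((S ⟨T, hT⟩).isStrongSolution.mono h1.le (min_le_right _ _)) t ⟨ht.1, le_min ?_ ht.2⟩
    linarith [le_abs_self t]
  refine ⟨u, fun T hT => ?_⟩
  have heq := hu T hT
  have hsol := (S ⟨T, hT⟩).isStrongSolution
  have hT' : T ∈ Icc 0 T := ⟨hT.le, le_rfl⟩
  have h0' : (0 : ℝ) ∈ Icc 0 T := ⟨le_rfl, hT.le⟩
  have hcut : ∀ F G : ℝ → ℝ, (∀ t ∈ Icc 0 T, F t = G t) →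
      ∫ t in (0 : ℝ)..T, F t = ∫ t in (0 : ℝ)..T, G t := fun F G h =>
    intervalIntegral.integral_congr fun t ht => h t (by rwa [uIcc_of_le hT.le] at ht)
  have hii : ∀ F G : ℝ → ℝ, (∀ t ∈ Icc 0 T, F t = G t) → IntervalIntegrable F volume 0 T →
      IntervalIntegrable G volume 0 T := fun F G h hF => by
    refine hF.congr fun t ht => ?_
    rw [uIoc_of_le hT.le] at ht
    exact h t (Ioc_subset_Icc_self ht)
  refine ⟨hsol.congr hT.le heq, fun v hv t ht => ?_, ⟨?_, ?_, ?_⟩, ⟨?_, ?_⟩, fun t ht h => ?_⟩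
  · rw [heq t ht]
    exact IsStrongSolution.unique hT hv hsol t ht
  · filter_upwards [(S ⟨T, hT⟩).ae_intervalIntegrable_dissDensity,
      ae_restrict_mem measurableSet_Icc] with t ht htm
    rwa [heq t htm]
  · exact hii _ _ (fun t ht => by rw [heq t ht]) (S ⟨T, hT⟩).intervalIntegrable_dissipation
  · rw [heq T hT', heq 0 h0', hcut _ _ fun t ht => by rw [heq t ht]]
    exact (S ⟨T, hT⟩).energyE_identity
  · exact hii _ _ (fun t ht => by rw [heq t ht])
      ((S ⟨T, hT⟩).continuous_energyE.intervalIntegrable 0 T)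
  · rw [heq T hT', heq 0 h0', hcut _ _ fun t ht => by rw [heq t ht]]
    exact (S ⟨T, hT⟩).energyF_identity
  · rw [heq t ht]
    exact ⟨(S ⟨T, hT⟩).lowerJ_le_u t h, lowerMin_le_lowerJ hL0,
      lowerInit_le_lowerJ hL0 ((S ⟨T, hT⟩).energyE_le t), lowerInit_pos hL0 (energyE_nonneg _)⟩
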